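/- Let $A=(a_{ij})_{1\le i,j\le N}$ be a symmetrizable generalized Cartan matrix ($a_{ij}\in\mathbb Z$, $a_{ii}=2$, $a_{ij}\le 0$ for $i\ne j$, $a_{ij}=0\iff a_{ji}=0$), with positive integers $r_i$ such that $b_{ij}=r_ia_{ij}$ is symmetric; put $I=\{1,\dots,N\}$, $v_i=v^{r_i}$, $[m]_v=\frac{v^{-m}-v^m}{v^{-1}-v}$. Let $U^+=U_v^+(\mathcal L\mathfrak g)$ be the positive half of the quantum loop algebra: the $\mathbb C(v)$-algebra generated by $E_{i,l}$ ($i\in I$, $l\in\mathbb Z$) and $H_{i,s}$ ($i\in I$, $s\ge 1$) with relations $$[H_{i,s},H_{j,t}]=0,\qquad [H_{i,s},E_{j,l}]=\tfrac{[sb_{ij}]_v}{s}E_{j,s+l},$$ $$v^{b_{ij}}E_{i,l+1}E_{j,m}-E_{j,m}E_{i,l+1}=E_{i,l}E_{j,m+1}-v^{b_{ij}}E_{j,m+1}E_{i,l},$$ and, for $i\neq j$, $r=1-a_{ij}$, $l_1,\dots,l_r,l'\in\mathbb Z$, $$\sum_{\sigma\in\mathfrak S_r}\sum_{k=0}^r(-1)^k\begin{bmatrix}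 r\\k\end{bmatrix}_{v_i}E_{i,l_{\sigma(1)}}\cdots E_{i,l_{\sigma(k)}}E_{j,l'}E_{i,l_{\sigma(k+1)}}\cdots E_{i,l_{\sigma(r)}}=0 .$$ Let $\theta^+_{i,s}$ be given by $\sum_{s\ge0}\theta^+_{i,s}z^s=\exp\big((v^{-1}-v)\sum_{s\ge1}H_{i,s}z^s\big)$, and let $U_v(\mathcal L\mathfrak n)\subset U^+$ be the subalgebra generated by the $E_{i,l}$. Grade $U^+$ by the root lattice with $\mathrm{wt}\,E_{i,l}=\alpha_i$, $\mathrm{wt}\,H_{i,s}=0$, $(\alpha_i,\alpha_j)=b_{ij}$, and give $U^+\otimes U^+$ the multiplication $(x_1\otimes x_2)(y_1\otimes y_2)=v^{-(\mathrm{wt}\,x_2,\mathrm{wt}\,y_1)}x_1y_1\otimes x_2y_2$; let $U^+\widehat\otimes U^+$ be its completion allowing infinite sums in which the degree of the first factor (for $\deg E_{i,l}=l$, $\deg H_{i,s}=s$) is bounded below and tends to $+\infty$. There is a unique algebra homomorphism $\Delta':U^+\to U^+\widehat\otimes U^+$ with $\Delta'(E_{i,n})=E_{i,n}\otimes1+\sum_{t\ge0}\theta^+_{i,t}\otimes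 E_{i,n-t}$ and $\Delta'(\theta^+_{i,m})=\sum_{0\le t\le m}\theta^+_{i,m-t}\otimes\theta^+_{i,t}$, and a unique symmetric bilinear form $(\ ,\ )$ on $U^+$ with $(x,yz)=(\Delta'(x),y\otimes z)$ (a finite sum), $(1,1)=1$, $(1,E_{i,k})=(1,H_{i,m})=(E_{i,k},H_{j,m})=0$, and $$(E_{i,k},E_{j,l})=\frac{\delta_{ij}\delta_{kl}}{v^{-2}-1},\qquad (H_{i,m},H_{j,n})=\delta_{mn}\frac{[mb_{ij}]_v}{m(v^{-1}-v)}.$$ Writing $\Delta'(x)=\sum x_{(1)}\otimes x_{(2)}$, the formula $F'_{i,n}(x)=\sum(v^{-2}-1)(E_{i,n},x_{(1)})x_{(2)}$ (a finite sum) defines linear operators on $U_v(\mathcal L\mathfrak n)$. Let $E_{i,n}$ act on $U_v(\mathcal L\mathfrak n)$ by left multiplication. Then for all $i,j\in I$ and $m,n\in\mathbb Z$, $$F'_{i,m}E_{j,n}-v^{-b_{ij}}E_{j,n}F'_{i,m}=\delta_{ij}\delta_{nm}+\sum_{t>0}v^{-tb_{ij}}(v^{-b_{ij}}-v^{b_{ij}})E_{j,n-t}F'_{i,m-t}$$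 as operators on $U_v(\mathcal L\mathfrak n)$, where the sum is finite on each vector. Moreover, for $i\in I$ and $n\in\mathbb Z$, the subspace $Z'_{i,n-1}=\bigcap_{k\le n-1}\ker F'_{i,k}$ is stable under $E_{i,n}$ and $F'_{i,n}$, and on it the $q$-Boson relation $F'_{i,n}E_{i,n}-v^{-b_{ii}}E_{i,n}F'_{i,n}=1$ holds (so $v^{-2}$ in place of $v^{-b_{ii}}$ when $r_i=1$). -/

import Mathlib

open scoped TensorProduct

noncomputable section

namespace QLoop

/-- The ground field `ℂ(v)`. -/
abbrev K : Type := RatFunc ℂ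

/-- The indeterminate `v`. -/
abbrev v : K := RatFunc.X

/-- The quantum integer `[m]_q = (q⁻ᵐ - qᵐ) / (q⁻¹ - q)`. -/
def qInt (q : K) (m : ℤ) : K := (q ^ (-m) - q ^ m) / (q⁻¹ - q)

/-- The quantum factorial `[m]_q!`. -/
def qFact (q : K) (m : ℕ) : K := ∏ k ∈ Finset.range m, qInt q ((k : ℤ) + 1)

/-- The quantum binomial coefficient. -/
def qBinom (q : K) (m k : ℕ) : K := qFact q m / (qFact q k * qFact q (m - k))

/-- A symmetrizable generalized Cartan matrix together with a symmetrizing diagonal matrix. -/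
structure CartanDatum (N : ℕ) where
  a : Matrix (Fin N) (Fin N) ℤ
  r : Fin N → ℕ
  diag : ∀ i, a i i = 2
  offDiag : ∀ i j, i ≠ j → a i j ≤ 0
  zero_iff : ∀ i j, a i j = 0 ↔ a j i = 0
  r_pos : ∀ i, 0 < r i
  symm : ∀ i j, (r i : ℤ) * a i j = (r j : ℤ) * a j i

variable {N : ℕ}

/-- The entries of the symmetrized Cartan matrix `B = D A`. -/
def CartanDatum.b (C : CartanDatum N) (i j : Fin N) : ℤ := (C.r i : ℤ) * C.a i j

/-- The symmetric bilinear form on the root lattice `⊕ ℤ αᵢ`, with `(αᵢ, αⱼ) = bᵢⱼ`. -/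
def CartanDatum.form (C : CartanDatum N) (α β : Fin N → ℤ) : ℤ :=
  ∑ i, ∑ j, α i * C.b i j * β j

/-- Generators `E_{i,l}` (`l ∈ ℤ`) and `H_{i,s}` (`s > 0`). -/
inductive Gen (N : ℕ) : Type
  | E (i : Fin N) (l : ℤ) : Gen N
  | H (i : Fin N) (s : ℕ+) : Gen N

/-- The left-hand side of the loop Serre relation, in any `ℂ(v)`-algebra, for given elements
`x₀, …, x_{r-1}` (the `E_{i,l_a}`) and `y` (which is `E_{j,l'}`), at the parameter `q`. -/
def serreSum {R : Type*} [Ring R] [Algebra K R] (q : K) (r : ℕ) (x : Fin r → R) (y : R) : R :=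
  ∑ σ : Equiv.Perm (Fin r), ∑ k ∈ Finset.range (r + 1),
    ((-1) ^ k * qBinom q r k) •
      (((List.ofFn fun a => x (σ a)).take k).prod * y *
        ((List.ofFn fun a => x (σ a)).drop k).prod)

/-- The free generators. -/
def freeE (i : Fin N) (l : ℤ) : FreeAlgebra K (Gen N) := FreeAlgebra.ι K (Gen.E i l)

def freeH (i : Fin N) (s : ℕ+) : FreeAlgebra K (Gen N) := FreeAlgebra.ι K (Gen.H i s)

/-- The defining relations of the (Drinfeld) positive half of the quantum loop algebra. -/
inductive Rel (C : CartanDatum N) : FreeAlgebra K (Gen N) → FreeAlgebra K (Gen N) → Prop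
  | HH (i j : Fin N) (s t : ℕ+) : Rel C (freeH i s * freeH j t) (freeH j t * freeH i s)
  | HE (i j : Fin N) (s : ℕ+) (l : ℤ) :
      Rel C (freeH i s * freeE j l - freeE j l * freeH i s)
        ((qInt v ((s : ℤ) * C.b i j) / ((s : ℕ) : K)) • freeE j ((s : ℤ) + l))
  | EE (i j : Fin N) (l m : ℤ) :
      Rel C (v ^ C.b i j • (freeE i (l + 1) * freeE j m) - freeE j m * freeE i (l + 1))
        (freeE i l * freeE j (m + 1) - v ^ C.b i j • (freeE j (m + 1) * freeE i l))
  | serre (i j : Fin N) (hij : i ≠ j) (l : Fin (1 - C.a i j).toNat → ℤ) (l' : ℤ) :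
      Rel C (serreSum (v ^ C.r i) (1 - C.a i j).toNat (fun k => freeE i (l k)) (freeE j l')) 0

/-- The positive half `U_v⁺(𝓛𝔤)`. -/
def U (C : CartanDatum N) : Type := RingQuot (Rel C)

instance (C : CartanDatum N) : Ring (U C) := inferInstanceAs (Ring (RingQuot (Rel C)))

instance (C : CartanDatum N) : Algebra K (U C) := inferInstanceAs (Algebra K (RingQuot (Rel C)))

variable (C : CartanDatum N)

def proj : FreeAlgebra K (Gen N) →ₐ[K] U C := RingQuot.mkAlgHom K (Rel C)

/-- `E_{i,l}` in `U_v⁺(𝓛𝔤)`. -/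
def E (i : Fin N) (l : ℤ) : U C := proj C (freeE i l)

/-- `H_{i,s}` in `U_v⁺(𝓛𝔤)`. -/
def H (i : Fin N) (s : ℕ+) : U C := proj C (freeH i s)

/-- The series `(v⁻¹ - v) ∑_{s ≥ 1} H_{i,s} zˢ`. -/
def hSeries (i : Fin N) : PowerSeries (U C) :=
  PowerSeries.mk fun s => if hs : 0 < s then (v⁻¹ - v) • H C i ⟨s, hs⟩ else 0

/-- `θ⁺_{i,s}`: the coefficient of `zˢ` in `exp ((v⁻¹ - v) ∑_{s ≥ 1} H_{i,s} zˢ)`. As the exponent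
has no constant term, only its powers up to the `s`-th contribute to that coefficient. -/
def theta (i : Fin N) (s : ℕ) : U C :=
  ∑ k ∈ Finset.range (s + 1), ((k.factorial : K)⁻¹) • PowerSeries.coeff s (hSeries C i ^ k)

/-- `U_v(𝓛𝔫)`: the subalgebra generated by the `E_{i,l}`. -/
def Un : Subalgebra K (U C) := Algebra.adjoin K {x | ∃ i l, x = E C i l}

/-- `E_{i,l}` as an element of `U_v(𝓛𝔫)`. -/
def En (i : Fin N) (l : ℤ) : Un C := ⟨E C i l, Algebra.subset_adjoin ⟨i, l, rfl⟩⟩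

/-! ### The grading by the root lattice -/

/-- The simple root `αᵢ`. -/
def root (i : Fin N) : Fin N → ℤ := Pi.single i 1

/-- Weight bookkeeping on the free algebra: `E_{i,l} ↦ E_{i,l} ⊗ T^{αᵢ}`, `H_{i,s} ↦ H_{i,s} ⊗ 1`. -/
def freeWt : FreeAlgebra K (Gen N) →ₐ[K] AddMonoidAlgebra (U C) (Fin N → ℤ) :=
  FreeAlgebra.lift K fun g => match g with
    | Gen.E i l => AddMonoidAlgebra.single (root i) (E C i l)
    | Gen.H i s => AddMonoidAlgebra.single 0 (H C i s)

theorem freeWt_E (i : Fin N) (l : ℤ) :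
    freeWt C (freeE i l) = AddMonoidAlgebra.single (root i) (E C i l) := by
  simp [freeWt, freeE]

theorem freeWt_H (i : Fin N) (s : ℕ+) :
    freeWt C (freeH i s) = AddMonoidAlgebra.single 0 (H C i s) := by
  simp [freeWt, freeH]

theorem proj_rel {x y : FreeAlgebra K (Gen N)} (h : Rel C x y) : proj C x = proj C y :=
  RingQuot.mkAlgHom_rel K h

theorem list_prod_single {R : Type*} [Ring R] (α : Fin N → ℤ) (L : List R) :
    (L.map fun x => (AddMonoidAlgebra.single α x : AddMonoidAlgebra R (Fin N → ℤ))).prod =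
      AddMonoidAlgebra.single (L.length • α) L.prod := by
  induction L with
  | nil => simp [AddMonoidAlgebra.one_def]
  | cons x L ih =>
    rw [List.map_cons, List.prod_cons, ih, AddMonoidAlgebra.single_mul_single, List.prod_cons,
      List.length_cons, succ_nsmul']

theorem map_serreSum {R S : Type*} [Ring R] [Algebra K R] [Ring S] [Algebra K S] (f : R →ₐ[K] S)
    (q : K) (r : ℕ) (x : Fin r → R) (y : R) :
    f (serreSum q r x y) = serreSum q r (fun a => f (x a)) (f y) := by
  simp only [serreSum, map_sum, map_smul, map_mul, map_list_prod, List.map_take, List.map_drop,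
    List.map_ofFn, Function.comp_def]

theorem serreSum_single {R : Type*} [Ring R] [Algebra K R] (q : K) (r : ℕ) (x : Fin r → R) (y : R)
    (α β : Fin N → ℤ) :
    serreSum q r (fun a => (AddMonoidAlgebra.single α (x a) : AddMonoidAlgebra R (Fin N → ℤ)))
      (AddMonoidAlgebra.single β y) =
      AddMonoidAlgebra.single (r • α + β) (serreSum q r x y) := by
  have key : ∀ (σ : Equiv.Perm (Fin r)) (k : ℕ), k ∈ Finset.range (r + 1) →
      ((List.ofFn fun a =>
          (AddMonoidAlgebra.single α (x (σ a)) : AddMonoidAlgebra R (Fin N → ℤ))).take k).prod *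
        AddMonoidAlgebra.single β y *
        ((List.ofFn fun a =>
          (AddMonoidAlgebra.single α (x (σ a)) : AddMonoidAlgebra R (Fin N → ℤ))).drop k).prod =
      AddMonoidAlgebra.single (r • α + β)
        (((List.ofFn fun a => x (σ a)).take k).prod * y *
          ((List.ofFn fun a => x (σ a)).drop k).prod) := by
    intro σ k hk
    have hk' : k ≤ r := Nat.lt_succ_iff.mp (Finset.mem_range.mp hk)
    have e : (List.ofFn fun a =>
        (AddMonoidAlgebra.single α (x (σ a)) : AddMonoidAlgebra R (Fin N → ℤ))) =
        (List.ofFn fun a => x (σ a)).map fun z => AddMonoidAlgebra.single α z := by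
      rw [List.map_ofFn]; rfl
    rw [e, ← List.map_take, ← List.map_drop, list_prod_single, list_prod_single,
      AddMonoidAlgebra.single_mul_single, AddMonoidAlgebra.single_mul_single]
    congr 1
    simp only [List.length_take, List.length_drop, List.length_ofFn, min_eq_left hk']
    rw [add_right_comm, ← add_smul, Nat.add_sub_cancel' hk']
  have hs : ∀ (s : Finset (Equiv.Perm (Fin r))) (g : Equiv.Perm (Fin r) → R),
      (AddMonoidAlgebra.single (r • α + β) (∑ σ ∈ s, g σ) : AddMonoidAlgebra R (Fin N → ℤ)) =
      ∑ σ ∈ s, AddMonoidAlgebra.single (r • α + β) (g σ) := fun s g =>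
    map_sum (AddMonoidAlgebra.singleAddHom (R := R) (r • α + β)) g s
  have hs' : ∀ (s : Finset ℕ) (g : ℕ → R),
      (AddMonoidAlgebra.single (r • α + β) (∑ k ∈ s, g k) : AddMonoidAlgebra R (Fin N → ℤ)) =
      ∑ k ∈ s, AddMonoidAlgebra.single (r • α + β) (g k) := fun s g =>
    map_sum (AddMonoidAlgebra.singleAddHom (R := R) (r • α + β)) g s
  simp only [serreSum]
  rw [hs]
  refine Finset.sum_congr rfl fun σ _ => ?_
  rw [hs']
  refine Finset.sum_congr rfl fun k hk => ?_
  rw [key σ k hk, AddMonoidAlgebra.smul_single]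

theorem freeWt_rel {x y : FreeAlgebra K (Gen N)} (h : Rel C x y) :
    freeWt C x = freeWt C y := by
  have h' := proj_rel C h
  cases h with
  | HH i j s t =>
    simp only [map_mul, freeWt_H, AddMonoidAlgebra.single_mul_single] at h' ⊢
    exact congrArg _ h'
  | HE i j s l =>
    simp only [map_sub, map_mul, map_smul, freeWt_H, freeWt_E,
      AddMonoidAlgebra.single_mul_single, AddMonoidAlgebra.smul_single, zero_add, add_zero] at h' ⊢
    rw [← AddMonoidAlgebra.single_sub]
    exact congrArg _ h'
  | EE i j l m =>
    simp only [map_sub, map_mul, map_smul, freeWt_E,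
      AddMonoidAlgebra.single_mul_single, AddMonoidAlgebra.smul_single] at h' ⊢
    rw [add_comm (root j) (root i), ← AddMonoidAlgebra.single_sub, ← AddMonoidAlgebra.single_sub]
    exact congrArg _ h'
  | serre i j hij l l' =>
    rw [map_serreSum, map_zero] at h' ⊢
    simp only [freeWt_E]
    rw [serreSum_single]
    have h'' : serreSum (v ^ C.r i) (1 - C.a i j).toNat (fun a => E C i (l a)) (E C j l') = 0 := h'
    rw [h'', AddMonoidAlgebra.single_zero]

/-- The decomposition into weight components: `wt x = ∑_α x_α T^α`, with `x_α` the component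
of `x` of weight `α`; it is the algebra homomorphism with `E_{i,l} ↦ E_{i,l} T^{αᵢ}` and
`H_{i,s} ↦ H_{i,s}`. -/
def wt : U C →ₐ[K] AddMonoidAlgebra (U C) (Fin N → ℤ) :=
  RingQuot.liftAlgHom K ⟨freeWt C, fun _ _ h => freeWt_rel C h⟩

theorem wt_E (i : Fin N) (l : ℤ) : wt C (E C i l) = AddMonoidAlgebra.single (root i) (E C i l) := by
  simp only [wt, E, proj]
  exact (RingQuot.liftAlgHom_mkAlgHom_apply K _ _ _).trans (freeWt_E C i l)

theorem wt_H (i : Fin N) (s : ℕ+) : wt C (H C i s) = AddMonoidAlgebra.single 0 (H C i s) := by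
  simp only [wt, H, proj]
  exact (RingQuot.liftAlgHom_mkAlgHom_apply K _ _ _).trans (freeWt_H C i s)

/-! ### The twisted tensor square and its completion -/

/-- The family of weight components of an element, as a linear map. -/
def comps : U C →ₗ[K] ((Fin N → ℤ) →₀ U C) where
  toFun x := (wt C x).coeff
  map_add' x y := by rw [map_add, AddMonoidAlgebra.coeff_add]
  map_smul' c x := by rw [map_smul, AddMonoidAlgebra.coeff_smul]; rfl

/-- The twisted flip `x ⊗ y ↦ ∑_{α,β} v^{-(α,β)} y_β ⊗ x_α`. -/
def twFlip : U C →ₗ[K] U C →ₗ[K] U C ⊗[K] U C :=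
  (Finsupp.lsum K fun α =>
    (Finsupp.lsum K).toLinearMap ∘ₗ LinearMap.pi fun β =>
      v ^ (-C.form α β) • (TensorProduct.mk K (U C) (U C)).flip).compl₁₂ (comps C) (comps C)

/-- The twisted multiplication
`(x₁ ⊗ x₂) (y₁ ⊗ y₂) = v^{-(wt x₂, wt y₁)} x₁ y₁ ⊗ x₂ y₂` for `x₂`, `y₁` homogeneous
(see `tmul_mul_tmul`). -/
def twMul : U C ⊗[K] U C →ₗ[K] U C ⊗[K] U C →ₗ[K] U C ⊗[K] U C :=
  TensorProduct.lift (LinearMap.mk₂ K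
    (fun x₁ x₂ : U C => TensorProduct.lift (LinearMap.mk₂ K
      (fun y₁ y₂ : U C =>
        TensorProduct.map (LinearMap.mulLeft K x₁) (LinearMap.mulRight K y₂) (twFlip C x₂ y₁))
      (fun a b c => by simp only [map_add])
      (fun r a c => by simp only [map_smul])
      (fun a b c => by
        rw [show LinearMap.mulRight K (b + c) = LinearMap.mulRight K b + LinearMap.mulRight K c from
          LinearMap.ext fun z => mul_add z b c, TensorProduct.map_add_right, LinearMap.add_apply])
      (fun r a c => by
        rw [show LinearMap.mulRight K (r • c) = r • LinearMap.mulRight K c from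
          LinearMap.ext fun z => mul_smul_comm r z c, TensorProduct.map_smul_right,
          LinearMap.smul_apply])))
    (fun a b c => TensorProduct.ext' fun y₁ y₂ => by
      simp only [TensorProduct.lift.tmul, LinearMap.mk₂_apply, LinearMap.add_apply]
      rw [show LinearMap.mulLeft K (a + b) = LinearMap.mulLeft K a + LinearMap.mulLeft K b from
        LinearMap.ext fun z => add_mul a b z, TensorProduct.map_add_left, LinearMap.add_apply])
    (fun r a c => TensorProduct.ext' fun y₁ y₂ => by
      simp only [TensorProduct.lift.tmul, LinearMap.mk₂_apply, LinearMap.smul_apply]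
      rw [show LinearMap.mulLeft K (r • a) = r • LinearMap.mulLeft K a from
        LinearMap.ext fun z => smul_mul_assoc r a z, TensorProduct.map_smul_left,
        LinearMap.smul_apply])
    (fun a b c => TensorProduct.ext' fun y₁ y₂ => by
      simp only [TensorProduct.lift.tmul, LinearMap.mk₂_apply, LinearMap.add_apply, map_add])
    (fun r a c => TensorProduct.ext' fun y₁ y₂ => by
      simp only [TensorProduct.lift.tmul, LinearMap.mk₂_apply, LinearMap.smul_apply, map_smul]))

/-- The tensor square `U_v⁺(𝓛𝔤) ⊗ U_v⁺(𝓛𝔤)`, to carry the twisted multiplication. -/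
def Tw : Type := U C ⊗[K] U C

instance : AddCommGroup (Tw C) := inferInstanceAs (AddCommGroup (U C ⊗[K] U C))

instance : Module K (Tw C) := inferInstanceAs (Module K (U C ⊗[K] U C))

/-- The pure tensor `x ⊗ y`. -/
def tmul (x y : U C) : Tw C := (x ⊗ₜ[K] y : U C ⊗[K] U C)

instance : NonUnitalNonAssocRing (Tw C) where
  mul x y := twMul C x y
  left_distrib x y z := map_add (twMul C x) y z
  right_distrib x y z := LinearMap.map_add₂ (twMul C) x y z
  zero_mul x := LinearMap.map_zero₂ (twMul C) x
  mul_zero x := map_zero (twMul C x)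

theorem tmul_mul_tmul (x₁ x₂ y₁ y₂ : U C) (α β : Fin N → ℤ)
    (hx : wt C x₂ = AddMonoidAlgebra.single α x₂) (hy : wt C y₁ = AddMonoidAlgebra.single β y₁) :
    tmul C x₁ x₂ * tmul C y₁ y₂ = v ^ (-C.form α β) • tmul C (x₁ * y₁) (x₂ * y₂) := by
  have hc : comps C x₂ = Finsupp.single α x₂ := by
    change (wt C x₂).coeff = _
    rw [hx, AddMonoidAlgebra.coeff_single]
  have hd : comps C y₁ = Finsupp.single β y₁ := by
    change (wt C y₁).coeff = _
    rw [hy, AddMonoidAlgebra.coeff_single]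
  change TensorProduct.map (LinearMap.mulLeft K x₁) (LinearMap.mulRight K y₂) (twFlip C x₂ y₁) = _
  simp only [twFlip, LinearMap.compl₁₂_apply, hc, hd, Finsupp.lsum_single]
  simp [Finsupp.lsum_single]
  rfl

/-- The completed tensor square. An element is a formal sum `∑_k f_k`, where `f_k` collects
the terms whose first tensor factor has degree `k` for the `ℤ`-grading `deg E_{i,l} = l`,
`deg H_{i,s} = s`, and where `f_k = 0` for `k` sufficiently negative. The multiplication is
the one induced by the twisted multiplication. -/
abbrev CTw : Type := HahnSeries ℤ (Tw C)

/-- `Δ'` is the algebra homomorphism into the completed twisted tensor square with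
`Δ'(E_{i,n}) = E_{i,n} ⊗ 1 + ∑_{t ≥ 0} θ⁺_{i,t} ⊗ E_{i,n-t}` and
`Δ'(θ⁺_{i,m}) = ∑_{0 ≤ t ≤ m} θ⁺_{i,m-t} ⊗ θ⁺_{i,t}`. -/
structure IsCoproduct (Δ : U C →ₗ[K] CTw C) : Prop where
  map_one : Δ 1 = HahnSeries.single 0 (tmul C 1 1)
  map_mul : ∀ x y, Δ (x * y) = Δ x * Δ y
  map_E : ∀ i n k, (Δ (E C i n)).coeff k =
    (if k = n then tmul C (E C i n) 1 else 0) +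
      (if 0 ≤ k then tmul C (theta C i k.toNat) (E C i (n - k)) else 0)
  map_theta : ∀ i m, Δ (theta C i m) =
    ∑ t ∈ Finset.range (m + 1),
      HahnSeries.single ((m - t : ℕ) : ℤ) (tmul C (theta C i (m - t)) (theta C i t))

variable {C}

/-- The pairing `(x₁ ⊗ x₂, y ⊗ z) = (x₁, y) (x₂, z)`, as a linear form in `x₁ ⊗ x₂`. -/
def pair (B : LinearMap.BilinForm K (U C)) (y z : U C) : Tw C →ₗ[K] K :=
  TensorProduct.lift ((LinearMap.mul K K).compl₁₂ (B.flip y) (B.flip z))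

/-- The contraction `x₁ ⊗ x₂ ↦ (y, x₁) x₂`. -/
def contract (B : LinearMap.BilinForm K (U C)) (y : U C) : Tw C →ₗ[K] U C :=
  TensorProduct.lift (LinearMap.lsmul K (U C) ∘ₗ B y)

/-- The symmetric bilinear form on `U_v⁺(𝓛𝔤)` with the prescribed values on generators which is
a Hopf pairing: `(x, y z) = (Δ'(x), y ⊗ z)`, the right-hand side being a finite sum. -/
structure IsHopfPairing (Δ : U C →ₗ[K] CTw C) (B : LinearMap.BilinForm K (U C)) : Prop where
  symm : ∀ x y, B x y = B y x
  one_one : B 1 1 = 1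
  one_E : ∀ i k, B 1 (E C i k) = 0
  one_H : ∀ i m, B 1 (H C i m) = 0
  E_E : ∀ i j k l, B (E C i k) (E C j l) = if i = j ∧ k = l then 1 / (v ^ (-2 : ℤ) - 1) else 0
  H_H : ∀ i j m n, B (H C i m) (H C j n) =
    if m = n then qInt v ((m : ℤ) * C.b i j) / (((m : ℕ) : K) * (v⁻¹ - v)) else 0
  E_H : ∀ i j k m, B (E C i k) (H C j m) = 0
  hopf_finite : ∀ x y z, (Function.support fun k : ℤ => pair B y z ((Δ x).coeff k)).Finite
  hopf : ∀ x y z, B x (y * z) = ∑ᶠ k : ℤ, pair B y z ((Δ x).coeff k)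

/-- `F'` is the family of linear operators on `U_v(𝓛𝔫)` given by
`F'_{i,n}(x) = ∑ (v⁻² - 1) (E_{i,n}, x₍₁₎) x₍₂₎`, with `Δ'(x) = ∑ x₍₁₎ ⊗ x₍₂₎`; the sum has only
finitely many nonzero terms. -/
def IsFprime (Δ : U C →ₗ[K] CTw C) (B : LinearMap.BilinForm K (U C))
    (F' : Fin N → ℤ → Module.End K (Un C)) : Prop :=
  ∀ i n (x : Un C),
    (Function.support fun k : ℤ => contract B (E C i n) ((Δ (x : U C)).coeff k)).Finite ∧
    ((F' i n x : Un C) : U C) =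
      ∑ᶠ k : ℤ, (v ^ (-2 : ℤ) - 1) • contract B (E C i n) ((Δ (x : U C)).coeff k)

/-- `Z'_{i,k} = ⋂_{n ≤ k} ker F'_{i,n}`. -/
def Z' (F' : Fin N → ℤ → Module.End K (Un C)) (i : Fin N) (k : ℤ) : Submodule K (Un C) :=
  ⨅ n : ℤ, ⨅ _ : n ≤ k, LinearMap.ker (F' i n)

end QLoop

end

open scoped TensorProduct
open Finset.HasAntidiagonal (antidiagonal mem_antidiagonal)

noncomputable section

namespace QLoop

section

variable {N : ℕ} (C : CartanDatum N)

/-! ### Generators, relations and induction -/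

/-- The image of a generator. -/
def gen : Gen N → U C
  | Gen.E i l => E C i l
  | Gen.H i s => H C i s

theorem proj_ι (g : Gen N) : proj C (FreeAlgebra.ι K g) = gen C g := by
  cases g <;> rfl

theorem proj_surjective : Function.Surjective (proj C) := RingQuot.mkAlgHom_surjective K (Rel C)

/-- Induction on the free algebra through left multiplication by generators. -/
theorem free_induction {X : Type*} {P : FreeAlgebra K X → Prop} (one : P 1)
    (add : ∀ x y, P x → P y → P (x + y)) (smul : ∀ (c : K) x, P x → P (c • x))
    (gen_mul : ∀ g x, P x → P (FreeAlgebra.ι K g * x)) (x : FreeAlgebra K X) : P x := by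
  have key : ∀ a w : FreeAlgebra K X, P w → P (a * w) := by
    intro a
    induction a using FreeAlgebra.induction with
    | grade0 c => intro w hw; rw [← Algebra.smul_def]; exact smul c w hw
    | grade1 g => exact gen_mul g
    | mul a b ha hb => intro w hw; rw [mul_assoc]; exact ha _ (hb _ hw)
    | add a b ha hb => intro w hw; rw [add_mul]; exact add _ _ (ha _ hw) (hb _ hw)
  simpa using key x 1 one

variable {C} in
/-- Induction on `U` through left multiplication by generators. -/
theorem U_induction {P : U C → Prop} (one : P 1)
    (add : ∀ x y, P x → P y → P (x + y)) (smul : ∀ (c : K) x, P x → P (c • x))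
    (E_mul : ∀ i l x, P x → P (E C i l * x)) (H_mul : ∀ i s x, P x → P (H C i s * x))
    (x : U C) : P x := by
  obtain ⟨w, rfl⟩ := proj_surjective C x
  induction w using free_induction with
  | one => simpa using one
  | add a b ha hb => rw [map_add]; exact add _ _ ha hb
  | smul c a ha => rw [map_smul]; exact smul _ _ ha
  | gen_mul g a ha =>
    rw [map_mul, proj_ι]
    cases g with
    | E i l => exact E_mul _ _ _ ha
    | H i s => exact H_mul _ _ _ ha

theorem H_mul_H (i j : Fin N) (s t : ℕ+) : H C i s * H C j t = H C j t * H C i s := by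
  simpa [H] using proj_rel C (Rel.HH i j s t)

theorem H_mul_E (i j : Fin N) (s : ℕ+) (l : ℤ) :
    H C i s * E C j l = E C j l * H C i s +
      (qInt v ((s : ℤ) * C.b i j) / ((s : ℕ) : K)) • E C j ((s : ℤ) + l) := by
  have h := proj_rel C (Rel.HE i j s l)
  simp only [map_sub, map_mul, map_smul] at h
  rw [← sub_eq_iff_eq_add']
  exact h

theorem E_quadratic (i j : Fin N) (l m : ℤ) :
    v ^ C.b i j • (E C i (l + 1) * E C j m) - E C j m * E C i (l + 1) =
      E C i l * E C j (m + 1) - v ^ C.b i j • (E C j (m + 1) * E C i l) := by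
  have h := proj_rel C (Rel.EE i j l m)
  simp only [map_sub, map_mul, map_smul] at h
  exact h

theorem E_serre (i j : Fin N) (hij : i ≠ j) (l : Fin (1 - C.a i j).toNat → ℤ) (l' : ℤ) :
    serreSum (v ^ C.r i) (1 - C.a i j).toNat (fun k => E C i (l k)) (E C j l') = 0 := by
  have h := proj_rel C (Rel.serre i j hij l l')
  rw [map_serreSum, map_zero] at h
  exact h

/-- The universal property of `U`. -/
def lift {R : Type*} [Ring R] [Algebra K R] (f : Gen N → R)
    (h : ∀ x y, Rel C x y → FreeAlgebra.lift K f x = FreeAlgebra.lift K f y) : U C →ₐ[K] R :=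
  RingQuot.liftAlgHom K ⟨FreeAlgebra.lift K f, fun _ _ hr => h _ _ hr⟩

theorem lift_gen {R : Type*} [Ring R] [Algebra K R] (f : Gen N → R) (h) (g : Gen N) :
    lift C f h (gen C g) = f g := by
  rw [← proj_ι]
  exact (RingQuot.liftAlgHom_mkAlgHom_apply K _ _ _).trans (FreeAlgebra.lift_ι_apply f g)

/-- The relations to check in order to define a homomorphism on `U`. -/
theorem lift_rel {R : Type*} [Ring R] [Algebra K R] (e : Fin N → ℤ → R) (h : Fin N → ℕ+ → R)
    (f : Gen N → R) (hfE : ∀ i l, f (Gen.E i l) = e i l) (hfH : ∀ i s, f (Gen.H i s) = h i s)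
    (HH : ∀ i j s t, h i s * h j t = h j t * h i s)
    (HE : ∀ i j s l, h i s * e j l - e j l * h i s =
      (qInt v ((s : ℤ) * C.b i j) / ((s : ℕ) : K)) • e j ((s : ℤ) + l))
    (EE : ∀ i j l m, v ^ C.b i j • (e i (l + 1) * e j m) - e j m * e i (l + 1) =
      e i l * e j (m + 1) - v ^ C.b i j • (e j (m + 1) * e i l))
    (serre : ∀ i j, i ≠ j → ∀ (l : Fin (1 - C.a i j).toNat → ℤ) (l' : ℤ),
      serreSum (v ^ C.r i) (1 - C.a i j).toNat (fun k => e i (l k)) (e j l') = 0) :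
    ∀ x y, Rel C x y → FreeAlgebra.lift K f x = FreeAlgebra.lift K f y := by
  have hE : ∀ i l, FreeAlgebra.lift K f (freeE i l) = e i l := fun i l =>
    (FreeAlgebra.lift_ι_apply f _).trans (hfE i l)
  have hH : ∀ i s, FreeAlgebra.lift K f (freeH i s) = h i s := fun i l =>
    (FreeAlgebra.lift_ι_apply f _).trans (hfH i l)
  intro x y hr
  cases hr with
  | HH i j s t => simp only [map_mul, hH]; exact HH i j s t
  | HE i j s l => simp only [map_mul, map_sub, map_smul, hH, hE]; exact HE i j s l
  | EE i j l m => simp only [map_mul, map_sub, map_smul, hE]; exact EE i j l m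
  | serre i j hij l l' =>
    rw [map_serreSum, map_zero]; simp only [hE]; exact serre i j hij l _

/-! ### Homogeneous elements and the twist -/

/-- `x` is homogeneous of weight `α`. -/
def IsHom (α : Fin N → ℤ) (x : U C) : Prop := wt C x = AddMonoidAlgebra.single α x

variable {C}

theorem IsHom.mul {α β : Fin N → ℤ} {x y : U C} (hx : IsHom C α x) (hy : IsHom C β y) :
    IsHom C (α + β) (x * y) := by
  unfold IsHom at *
  rw [map_mul, hx, hy, AddMonoidAlgebra.single_mul_single]

theorem IsHom.smul {α : Fin N → ℤ} {x : U C} (hx : IsHom C α x) (c : K) :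
    IsHom C α (c • x) := by
  unfold IsHom at *
  rw [map_smul, hx, AddMonoidAlgebra.smul_single]

theorem IsHom.add {α : Fin N → ℤ} {x y : U C} (hx : IsHom C α x) (hy : IsHom C α y) :
    IsHom C α (x + y) := by
  unfold IsHom at *
  rw [map_add, hx, hy, AddMonoidAlgebra.single_add]

variable (C) in
theorem isHom_zero (α : Fin N → ℤ) : IsHom C α 0 := by
  unfold IsHom; rw [map_zero, AddMonoidAlgebra.single_zero]

theorem IsHom.sum {ι : Type*} {α : Fin N → ℤ} {s : Finset ι} {f : ι → U C}
    (h : ∀ a ∈ s, IsHom C α (f a)) : IsHom C α (∑ a ∈ s, f a) := by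
  classical
  induction s using Finset.induction_on with
  | empty => simpa using isHom_zero C α
  | insert a s ha ih =>
    rw [Finset.sum_insert ha]
    exact (h a (Finset.mem_insert_self _ _)).add
      (ih fun b hb => h b (Finset.mem_insert_of_mem hb))

variable (C)

theorem isHom_one : IsHom C 0 1 := by
  unfold IsHom; rw [map_one, AddMonoidAlgebra.one_def]

theorem isHom_E (i : Fin N) (l : ℤ) : IsHom C (root i) (E C i l) := wt_E C i l

theorem isHom_H (i : Fin N) (s : ℕ+) : IsHom C 0 (H C i s) := wt_H C i s

/-- `U` is spanned by homogeneous elements. -/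
theorem hom_induction {P : U C → Prop} (add : ∀ x y, P x → P y → P (x + y))
    (hom : ∀ α x, IsHom C α x → P x) (x : U C) : P x := by
  -- An arbitrary `P` need not be stable under multiplication by generators, so the induction is run
  -- on the existence of a decomposition instead.
  have key : ∃ L : List (U C), (∀ y ∈ L, ∃ α, IsHom C α y) ∧ L.sum = x := by
    induction x using U_induction with
    | one => exact ⟨[1], by simpa using ⟨0, isHom_one C⟩, by simp⟩
    | add x y hx hy =>
      obtain ⟨L, hL, rfl⟩ := hx
      obtain ⟨L', hL', rfl⟩ := hy
      refine ⟨L ++ L', ?_, by simp⟩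
      intro y hy
      rcases List.mem_append.1 hy with h | h
      exacts [hL y h, hL' y h]
    | smul c x hx =>
      obtain ⟨L, hL, rfl⟩ := hx
      refine ⟨L.map (c • ·), ?_, by rw [List.smul_sum]⟩
      intro y hy
      obtain ⟨z, hz, rfl⟩ := List.mem_map.1 hy
      obtain ⟨α, hα⟩ := hL z hz
      exact ⟨α, hα.smul c⟩
    | E_mul i l x hx =>
      obtain ⟨L, hL, rfl⟩ := hx
      refine ⟨L.map (E C i l * ·), ?_, by rw [List.sum_map_mul_left]; simp⟩
      intro y hy
      obtain ⟨z, hz, rfl⟩ := List.mem_map.1 hy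
      obtain ⟨α, hα⟩ := hL z hz
      exact ⟨_, (isHom_E C i l).mul hα⟩
    | H_mul i l x hx =>
      obtain ⟨L, hL, rfl⟩ := hx
      refine ⟨L.map (H C i l * ·), ?_, by rw [List.sum_map_mul_left]; simp⟩
      intro y hy
      obtain ⟨z, hz, rfl⟩ := List.mem_map.1 hy
      obtain ⟨α, hα⟩ := hL z hz
      exact ⟨_, (isHom_H C i l).mul hα⟩
  obtain ⟨L, hL, rfl⟩ := key
  induction L with
  | nil => exact hom 0 _ (isHom_zero C 0)
  | cons y L ih =>
    rw [List.sum_cons]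
    obtain ⟨α, hα⟩ := hL y (List.mem_cons_self)
    exact add _ _ (hom α y hα) (ih fun z hz => hL z (List.mem_cons_of_mem _ hz))

theorem form_add_left (α β γ : Fin N → ℤ) : C.form (α + β) γ = C.form α γ + C.form β γ := by
  simp only [CartanDatum.form, ← Finset.sum_add_distrib, Pi.add_apply]
  refine Finset.sum_congr rfl fun i _ => Finset.sum_congr rfl fun j _ => by ring

theorem form_add_right (α β γ : Fin N → ℤ) : C.form α (β + γ) = C.form α β + C.form α γ := by
  simp only [CartanDatum.form, ← Finset.sum_add_distrib, Pi.add_apply]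
  refine Finset.sum_congr rfl fun i _ => Finset.sum_congr rfl fun j _ => by ring

theorem form_zero_left (α : Fin N → ℤ) : C.form 0 α = 0 := by simp [CartanDatum.form]

theorem form_zero_right (α : Fin N → ℤ) : C.form α 0 = 0 := by simp [CartanDatum.form]

theorem form_root (i j : Fin N) : C.form (root i) (root j) = C.b i j := by
  simp [CartanDatum.form, root, Pi.single_apply]

theorem b_symm (i j : Fin N) : C.b i j = C.b j i := C.symm i j

theorem v_ne_zero : v ≠ 0 := RatFunc.X_ne_zero

/-- The character `α ↦ v^{-(β,α)}` of the root lattice. -/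
def twistChar (β : Fin N → ℤ) : Multiplicative (Fin N → ℤ) →* U C where
  toFun α := algebraMap K (U C) (v ^ (-C.form β α.toAdd))
  map_one' := by simp [form_zero_right]
  map_mul' α α' := by
    rw [← map_mul, ← zpow_add₀ v_ne_zero, toAdd_mul, form_add_right, neg_add]

/-- The twist `x_α ↦ v^{-(β,α)} x_α`. -/
def tau (β : Fin N → ℤ) : U C →ₐ[K] U C :=
  (AddMonoidAlgebra.liftNCAlgHom (AlgHom.id K (U C)) (twistChar C β)
    (fun x α => Algebra.commute_algebraMap_right (v ^ (-C.form β α.toAdd)) x)).comp (wt C)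

variable {C}

theorem IsHom.tau {α : Fin N → ℤ} {x : U C} (hx : IsHom C α x) (β : Fin N → ℤ) :
    tau C β x = v ^ (-C.form β α) • x := by
  have : wt C x = AddMonoidAlgebra.single α x := hx
  simp [QLoop.tau, twistChar, this, Algebra.smul_def, Algebra.commutes]

variable (C)

theorem tau_E (β : Fin N → ℤ) (i : Fin N) (l : ℤ) :
    tau C β (E C i l) = v ^ (-C.form β (root i)) • E C i l := (isHom_E C i l).tau β

theorem tau_H (β : Fin N → ℤ) (i : Fin N) (s : ℕ+) : tau C β (H C i s) = H C i s := by
  rw [(isHom_H C i s).tau, form_zero_right]; simp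

theorem tau_add (β γ : Fin N → ℤ) (x : U C) : tau C (β + γ) x = tau C β (tau C γ x) := by
  induction x using hom_induction C with
  | add x y hx hy => simp only [map_add, hx, hy]
  | hom α x hx =>
    rw [hx.tau, hx.tau, map_smul, hx.tau, smul_smul, ← zpow_add₀ v_ne_zero, form_add_left]
    congr 2; ring

theorem tau_zero (x : U C) : tau C 0 x = x := by
  induction x using hom_induction C with
  | add x y hx hy => simp only [map_add, hx, hy]
  | hom α x hx => rw [hx.tau, form_zero_left]; simp

/-! ### The ring structure on the twisted tensor square -/

/-- The tensor product of two linear maps as a map between twisted tensor squares. -/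
def twMap (f g : U C →ₗ[K] U C) : Tw C →ₗ[K] Tw C := TensorProduct.map f g

theorem twMap_tmul (f g : U C →ₗ[K] U C) (x y : U C) :
    twMap C f g (tmul C x y) = tmul C (f x) (g y) := TensorProduct.map_tmul f g x y

variable {C} in
theorem Tw_induction {P : Tw C → Prop} (zero : P 0) (add : ∀ x y, P x → P y → P (x + y))
    (tm : ∀ x y, P (tmul C x y)) (t : Tw C) : P t :=
  TensorProduct.induction_on t zero tm add

theorem tmul_add (x y z : U C) : tmul C x (y + z) = tmul C x y + tmul C x z :=
  TensorProduct.tmul_add x y z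

theorem add_tmul (x y z : U C) : tmul C (x + y) z = tmul C x z + tmul C y z :=
  TensorProduct.add_tmul x y z

theorem tmul_smul (c : K) (x y : U C) : tmul C x (c • y) = c • tmul C x y :=
  TensorProduct.tmul_smul c x y

theorem smul_tmul (c : K) (x y : U C) : tmul C (c • x) y = c • tmul C x y :=
  (TensorProduct.smul_tmul c x y).trans (TensorProduct.tmul_smul c x y)

theorem tmul_zero (x : U C) : tmul C x 0 = 0 := TensorProduct.tmul_zero _ x

theorem zero_tmul (x : U C) : tmul C 0 x = 0 := TensorProduct.zero_tmul _ x

theorem tmul_sum {ι : Type*} (s : Finset ι) (x : U C) (f : ι → U C) :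
    tmul C x (∑ a ∈ s, f a) = ∑ a ∈ s, tmul C x (f a) := TensorProduct.tmul_sum x s f

theorem sum_tmul {ι : Type*} (s : Finset ι) (f : ι → U C) (x : U C) :
    tmul C (∑ a ∈ s, f a) x = ∑ a ∈ s, tmul C (f a) x := TensorProduct.sum_tmul s f x

theorem Tw_smul_mul (c : K) (x y : Tw C) : (c • x) * y = c • (x * y) :=
  LinearMap.map_smul₂ (twMul C) c x y

theorem Tw_mul_smul (c : K) (x y : Tw C) : x * (c • y) = c • (x * y) :=
  map_smul (twMul C x) c y

/-- The scalar of the twist depends multiplicatively on the weight of x, so it is absorbed in the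
algebra homomorphism `tau`. Only the right factor b has to be homogeneous. -/
theorem tmul_mul_tmul_of_isHom (a : U C) {b : U C} {β : Fin N → ℤ} (hb : IsHom C β b)
    (x y : U C) : tmul C a b * tmul C x y = tmul C (a * tau C β x) (b * y) := by
  induction x using hom_induction C with
  | add x x' h h' => rw [add_tmul, mul_add, h, h', map_add, mul_add, add_tmul]
  | hom α x hx =>
    rw [tmul_mul_tmul C a b x y β α hb hx, hx.tau, mul_smul_comm, smul_tmul]

/-- For b of weight β and d of weight δ, both bracketings of (a ⊗ b)(c ⊗ d)(e ⊗ f) are a τ_β(c)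
τ_{β+δ}(e) ⊗ b d f: `tau` is multiplicative, and additive in the weight. -/
theorem Tw_mul_assoc (X Y Z : Tw C) : X * Y * Z = X * (Y * Z) := by
  induction X using Tw_induction with
  | zero => simp only [zero_mul]
  | add x y hx hy => simp only [add_mul, hx, hy]
  | tm a b =>
    induction b using hom_induction C with
    | add b b' h h' => simp only [tmul_add, add_mul, h, h']
    | hom β b hb =>
      induction Y using Tw_induction with
      | zero => simp only [zero_mul, mul_zero]
      | add x y hx hy => simp only [add_mul, mul_add, hx, hy]
      | tm c d =>
        induction d using hom_induction C with
        | add b b' h h' => simp only [tmul_add, add_mul, mul_add, h, h']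
        | hom δ d hd =>
          induction Z using Tw_induction with
          | zero => simp only [mul_zero]
          | add x y hx hy => simp only [mul_add, hx, hy]
          | tm e f =>
            rw [tmul_mul_tmul_of_isHom C a hb, tmul_mul_tmul_of_isHom C _ (hb.mul hd),
              tmul_mul_tmul_of_isHom C c hd, tmul_mul_tmul_of_isHom C a hb, tau_add, map_mul,
              mul_assoc, mul_assoc]

scoped instance : Ring (Tw C) where
  __ := (inferInstance : NonUnitalNonAssocRing (Tw C))
  mul_assoc := Tw_mul_assoc C
  one := tmul C 1 1
  one_mul Y := by
    change tmul C 1 1 * Y = Y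
    induction Y using Tw_induction with
    | zero => rw [mul_zero]
    | add x y hx hy => rw [mul_add, hx, hy]
    | tm x y => rw [tmul_mul_tmul_of_isHom C 1 (isHom_one C), tau_zero, one_mul, one_mul]
  mul_one Y := by
    change Y * tmul C 1 1 = Y
    induction Y using Tw_induction with
    | zero => rw [zero_mul]
    | add x y hx hy => rw [add_mul, hx, hy]
    | tm x y =>
      induction y using hom_induction C with
      | add b b' h h' => simp only [tmul_add, add_mul, h, h']
      | hom β b hb => rw [tmul_mul_tmul_of_isHom C x hb, map_one, mul_one, mul_one]

scoped instance : Algebra K (Tw C) := Algebra.ofModule (Tw_smul_mul C) (Tw_mul_smul C)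

theorem Tw_one : (1 : Tw C) = tmul C 1 1 := rfl

end

section

/-! ### The Euler derivation on power series over a noncommutative algebra -/

section Euler

variable {R : Type*} [Ring R]

theorem coeff_pow_eq_zero {f : PowerSeries R} (hf : PowerSeries.coeff 0 f = 0) {m k : ℕ}
    (h : m < k) : PowerSeries.coeff m (f ^ k) = 0 := by
  induction k generalizing m with
  | zero => omega
  | succ k ih =>
    rw [pow_succ', PowerSeries.coeff_mul]
    refine Finset.sum_eq_zero fun p hp => ?_
    have := mem_antidiagonal.1 hp
    rcases Nat.eq_zero_or_pos p.1 with h0 | h0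
    · rw [h0, hf, zero_mul]
    · rw [ih (by omega), mul_zero]

variable [Algebra K R]

/-- The Euler operator `z d/dz`. -/
def eulerD (f : PowerSeries R) : PowerSeries R :=
  PowerSeries.mk fun s => ((s : ℕ) : K) • PowerSeries.coeff s f

theorem coeff_eulerD (f : PowerSeries R) (s : ℕ) :
    PowerSeries.coeff s (eulerD f) = (s : K) • PowerSeries.coeff s f := by
  rw [eulerD, PowerSeries.coeff_mk]

theorem eulerD_mul (f g : PowerSeries R) : eulerD (f * g) = eulerD f * g + f * eulerD g := by
  ext s
  rw [coeff_eulerD, map_add, PowerSeries.coeff_mul, PowerSeries.coeff_mul, PowerSeries.coeff_mul,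
    Finset.smul_sum, ← Finset.sum_add_distrib]
  refine Finset.sum_congr rfl fun p hp => ?_
  rw [coeff_eulerD, coeff_eulerD, smul_mul_assoc, mul_smul_comm, ← add_smul,
    ← mem_antidiagonal.1 hp, Nat.cast_add]

theorem eulerD_C (x : R) : eulerD (PowerSeries.C x) = 0 := by
  ext s
  rw [coeff_eulerD, PowerSeries.coeff_C]
  split_ifs with h
  · simp [h]
  · simp

/-- The equation `z f' = d f`, with `d` without constant term, determines `f` from `f(0)`. -/
theorem eulerD_unique {d f g : PowerSeries R} (hd : PowerSeries.coeff 0 d = 0)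
    (hf : eulerD f = d * f) (hg : eulerD g = d * g)
    (h0 : PowerSeries.coeff 0 f = PowerSeries.coeff 0 g) : f = g := by
  ext s
  induction s using Nat.strong_induction_on with
  | _ s ih =>
    rcases Nat.eq_zero_or_pos s with rfl | hs
    · exact h0
    · have hs' : (s : K) ≠ 0 := Nat.cast_ne_zero.2 hs.ne'
      have e : (s : K) • PowerSeries.coeff s f = (s : K) • PowerSeries.coeff s g := by
        rw [← coeff_eulerD, ← coeff_eulerD, hf, hg, PowerSeries.coeff_mul, PowerSeries.coeff_mul]
        refine Finset.sum_congr rfl fun p hp => ?_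
        rcases Nat.eq_zero_or_pos p.1 with h | h
        · rw [h, hd, zero_mul, zero_mul]
        · rw [ih p.2 (by have := mem_antidiagonal.1 hp; omega)]
      exact smul_right_injective _ hs' e

theorem commute_eulerD {f : PowerSeries R}
    (hf : ∀ a b, Commute (PowerSeries.coeff a f) (PowerSeries.coeff b f)) :
    f * eulerD f = eulerD f * f := by
  ext s
  rw [PowerSeries.coeff_mul, PowerSeries.coeff_mul, ← Finset.Nat.sum_antidiagonal_swap]
  refine Finset.sum_congr rfl fun p _ => ?_
  rw [coeff_eulerD, coeff_eulerD, Prod.fst_swap, Prod.snd_swap, mul_smul_comm, smul_mul_assoc,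
    hf p.2 p.1]

theorem eulerD_pow {f : PowerSeries R} (hf : f * eulerD f = eulerD f * f) (k : ℕ) :
    eulerD (f ^ (k + 1)) = (k + 1) • (eulerD f * f ^ k) := by
  induction k with
  | zero => simp
  | succ k ih =>
    rw [pow_succ' f (k + 1), eulerD_mul, ih, mul_smul_comm, ← mul_assoc, hf, mul_assoc,
      ← pow_succ', succ_nsmul (_) (k + 1), add_comm]

/-- The exponential of a power series without constant term. -/
def psExp (f : PowerSeries R) : PowerSeries R :=
  PowerSeries.mk fun s =>
    ∑ k ∈ Finset.range (s + 1), ((k.factorial : K)⁻¹) • PowerSeries.coeff s (f ^ k)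

theorem coeff_psExp {f : PowerSeries R} (hf : PowerSeries.coeff 0 f = 0) {s M : ℕ} (h : s < M) :
    PowerSeries.coeff s (psExp f) =
      ∑ k ∈ Finset.range M, ((k.factorial : K)⁻¹) • PowerSeries.coeff s (f ^ k) := by
  rw [psExp, PowerSeries.coeff_mk]
  refine Finset.sum_subset (fun a ha => ?_) fun k _ hk => ?_
  · simp only [Finset.mem_range] at *; omega
  · rw [coeff_pow_eq_zero hf (by simp only [Finset.mem_range] at hk; omega), smul_zero]

/-- The chain rule for the exponential, valid here because the coefficients of f commute with one
another. -/
theorem eulerD_psExp {f : PowerSeries R} (hf : PowerSeries.coeff 0 f = 0)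
    (hc : ∀ a b, Commute (PowerSeries.coeff a f) (PowerSeries.coeff b f)) :
    eulerD (psExp f) = eulerD f * psExp f := by
  ext s
  -- One term more than necessary is kept: once k = 0 is split off, the shifted sum has the length s
  -- + 1 used for the factor `psExp f` on the right.
  rw [coeff_eulerD, coeff_psExp hf (show s < s + 2 by omega), Finset.sum_range_succ',
    pow_zero, smul_add, Finset.smul_sum]
  have h0 : (s : K) • ((Nat.factorial 0 : K)⁻¹ • PowerSeries.coeff s (1 : PowerSeries R)) = 0 := by
    rw [PowerSeries.coeff_one]
    split_ifs with h
    · simp [h]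
    · simp
  rw [h0, add_zero, PowerSeries.coeff_mul]
  have h1 : ∀ p ∈ antidiagonal s,
      PowerSeries.coeff p.1 (eulerD f) * PowerSeries.coeff p.2 (psExp f) =
      ∑ k ∈ Finset.range (s + 1), ((k.factorial : K)⁻¹) •
        (PowerSeries.coeff p.1 (eulerD f) * PowerSeries.coeff p.2 (f ^ k)) := by
    intro p hp
    rw [coeff_psExp hf (show p.2 < s + 1 by have := mem_antidiagonal.1 hp; omega),
      Finset.mul_sum]
    simp only [mul_smul_comm]
  rw [Finset.sum_congr rfl h1, Finset.sum_comm]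
  refine Finset.sum_congr rfl fun k _ => ?_
  rw [← Finset.smul_sum, ← PowerSeries.coeff_mul, smul_comm, ← coeff_eulerD,
    eulerD_pow (commute_eulerD hc), map_nsmul, ← Nat.cast_smul_eq_nsmul K, smul_smul]
  congr 1
  rw [Nat.factorial_succ, Nat.cast_mul, mul_inv]
  have : ((k + 1 : ℕ) : K) ≠ 0 := Nat.cast_ne_zero.2 k.succ_ne_zero
  field_simp

/-- Both x f and f x solve the equation with datum d and have constant term x, so they agree by
`eulerD_unique`. -/
theorem commute_of_eulerD {d f : PowerSeries R} {x : R} (hd : PowerSeries.coeff 0 d = 0)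
    (hf : eulerD f = d * f) (h0 : PowerSeries.coeff 0 f = 1)
    (hx : ∀ a, Commute x (PowerSeries.coeff a d)) (m : ℕ) : Commute x (PowerSeries.coeff m f) := by
  have hx' : PowerSeries.C x * d = d * PowerSeries.C x := by
    ext a
    rw [PowerSeries.coeff_C_mul, PowerSeries.coeff_mul_C]
    exact hx a
  have : PowerSeries.C x * f = f * PowerSeries.C x := by
    refine eulerD_unique hd ?_ ?_ ?_
    · rw [eulerD_mul, eulerD_C, zero_mul, zero_add, hf, ← mul_assoc, hx', mul_assoc]
    · rw [eulerD_mul, eulerD_C, mul_zero, add_zero, hf, mul_assoc]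
    · rw [PowerSeries.coeff_C_mul, PowerSeries.coeff_mul_C, h0, mul_one, one_mul]
  have h := congrArg (PowerSeries.coeff m) this
  rwa [PowerSeries.coeff_C_mul, PowerSeries.coeff_mul_C] at h

end Euler

variable {N : ℕ} (C : CartanDatum N)

/-! ### The elements `θ` -/

/-- The coefficients `(v⁻¹ - v) H_{i,s}`. -/
def hCoeff (i : Fin N) (s : ℕ) : U C := PowerSeries.coeff s (hSeries C i)

theorem hCoeff_zero (i : Fin N) : hCoeff C i 0 = 0 := by simp [hCoeff, hSeries]

theorem hCoeff_pos (i : Fin N) (s : ℕ+) : hCoeff C i s = (v⁻¹ - v) • H C i s := by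
  rw [hCoeff, hSeries, PowerSeries.coeff_mk, dif_pos s.pos]
  rfl

theorem hCoeff_cases (i : Fin N) {P : U C → Prop} (h0 : P 0) (h : ∀ s, P ((v⁻¹ - v) • H C i s))
    (s : ℕ) : P (hCoeff C i s) := by
  rcases Nat.eq_zero_or_pos s with rfl | hs
  · rwa [hCoeff_zero]
  · lift s to ℕ+ using hs
    rw [hCoeff_pos]
    exact h s

theorem hCoeff_commute (i j : Fin N) (s t : ℕ) : Commute (hCoeff C i s) (hCoeff C j t) := by
  refine hCoeff_cases C i (P := fun x => Commute x _) (Commute.zero_left _) (fun s => ?_) s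
  refine hCoeff_cases C j (P := fun x => Commute _ x) (Commute.zero_right _) (fun t => ?_) t
  exact ((show Commute _ _ from H_mul_H C i j s t).smul_left _).smul_right _

/-- The generating series of the `θ_{i,s}`. -/
def thetaSeries (i : Fin N) : PowerSeries (U C) := PowerSeries.mk (theta C i)

theorem coeff_thetaSeries (i : Fin N) (s : ℕ) :
    PowerSeries.coeff s (thetaSeries C i) = theta C i s := PowerSeries.coeff_mk _ _

theorem coeff_zero_hSeries (i : Fin N) : PowerSeries.coeff 0 (hSeries C i) = 0 := hCoeff_zero C i

/-- This first-order equation replaces the exponential in later arguments: identities about θ are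
proved by uniqueness of its solution, or by the recursion it gives for the coefficients. -/
theorem eulerD_thetaSeries (i : Fin N) :
    eulerD (thetaSeries C i) = eulerD (hSeries C i) * thetaSeries C i :=
  eulerD_psExp (coeff_zero_hSeries C i) (hCoeff_commute C i i)

theorem theta_zero (i : Fin N) : theta C i 0 = 1 := by
  simp [theta]

theorem coeff_zero_eulerD_hSeries (i : Fin N) :
    PowerSeries.coeff 0 (eulerD (hSeries C i)) = 0 := by
  rw [coeff_eulerD]; simp

theorem theta_rec (i : Fin N) (m : ℕ) : (m : K) • theta C i m =
    ∑ p ∈ antidiagonal m, (p.1 : K) • (hCoeff C i p.1 * theta C i p.2) := by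
  rw [← coeff_thetaSeries, ← coeff_eulerD, eulerD_thetaSeries, PowerSeries.coeff_mul]
  refine Finset.sum_congr rfl fun p _ => ?_
  rw [coeff_eulerD, coeff_thetaSeries, smul_mul_assoc]; rfl

theorem commute_theta {x : U C} {i : Fin N} (hx : ∀ s, Commute x (H C i s)) (m : ℕ) :
    Commute x (theta C i m) := by
  rw [← coeff_thetaSeries]
  refine commute_of_eulerD (coeff_zero_eulerD_hSeries C i) (eulerD_thetaSeries C i)
    ((coeff_thetaSeries C i 0).trans (theta_zero C i)) (fun a => ?_) m
  rw [coeff_eulerD]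
  refine Commute.smul_right ?_ _
  exact hCoeff_cases C i (P := fun y => Commute x y) (Commute.zero_right _)
    (fun s => (hx s).smul_right _) a

theorem H_commute_theta (i j : Fin N) (s : ℕ+) (m : ℕ) : Commute (H C i s) (theta C j m) :=
  commute_theta C (fun t => H_mul_H C i j s t) m

theorem theta_commute_theta (i j : Fin N) (s t : ℕ) : Commute (theta C i s) (theta C j t) :=
  commute_theta C (fun u => (H_commute_theta C j i u s).symm) t

/-- Strong induction for statements about `θ`, through the recursion that defines it. -/
theorem theta_induction (i : Fin N) {P : ℕ → U C → Prop} (h0 : P 0 1)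
    (step : ∀ m, 0 < m → (∀ k < m, P k (theta C i k)) →
      P m ((m : K)⁻¹ • ∑ p ∈ antidiagonal m,
        (p.1 : K) • (hCoeff C i p.1 * theta C i p.2))) (m : ℕ) : P m (theta C i m) := by
  induction m using Nat.strong_induction_on with
  | _ m ih =>
    rcases Nat.eq_zero_or_pos m with rfl | hm
    · rwa [theta_zero]
    · have := step m hm ih
      rwa [← theta_rec, smul_smul, inv_mul_cancel₀ (Nat.cast_ne_zero.2 hm.ne'), one_smul] at this

theorem isHom_hCoeff (i : Fin N) (s : ℕ) : IsHom C 0 (hCoeff C i s) :=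
  hCoeff_cases C i (isHom_zero C 0) (fun s => (isHom_H C i s).smul _) s

theorem isHom_theta (i : Fin N) (m : ℕ) : IsHom C 0 (theta C i m) := by
  refine theta_induction C i (P := fun _ x => IsHom C 0 x) (isHom_one C) (fun m _ ih => ?_) m
  refine (IsHom.sum fun p hp => ?_).smul _
  rcases Nat.eq_zero_or_pos p.1 with h | h
  · rw [h, Nat.cast_zero, zero_smul]; exact isHom_zero C 0
  · have := ((isHom_hCoeff C i p.1).mul
      (ih p.2 (by have := mem_antidiagonal.1 hp; omega))).smul (p.1 : K)
    rwa [add_zero] at this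

/-! ### Commutation of `θ` and `E` -/

/-- The coefficients of `(1 - p⁻¹ z) / (1 - p z)`. -/
def gCoeff (p : K) (u : ℕ) : K := if u = 0 then 1 else (p - p⁻¹) * p ^ (u - 1)

theorem gCoeff_zero (p : K) : gCoeff p 0 = 1 := by simp [gCoeff]

theorem gCoeff_succ (p : K) (u : ℕ) : gCoeff p (u + 1) = (p - p⁻¹) * p ^ u := by simp [gCoeff]

/-- The logarithmic derivative of g(z) = (1 - p⁻¹z)/(1 - pz) is z g'/g = ∑_{k≥1} (p^k - p^{-k}) z^k;
this is z g' = (z g'/g) g, coefficient by coefficient. -/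
theorem gCoeff_rec (p : K) (w : ℕ) :
    ∑ x ∈ antidiagonal w, (p ^ x.1 - p⁻¹ ^ x.1) * gCoeff p x.2 = w * gCoeff p w := by
  cases w with
  | zero => simp
  | succ w =>
    have key : ∀ w : ℕ, ∑ x ∈ antidiagonal w,
        (p ^ x.1 - p⁻¹ ^ x.1) * ((p - p⁻¹) * p ^ x.2) =
        (w + 1) * ((p - p⁻¹) * p ^ w) - (p ^ (w + 1) - p⁻¹ ^ (w + 1)) := by
      intro w
      induction w with
      | zero => simp
      | succ w ih =>
        rw [Finset.Nat.sum_antidiagonal_succ']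
        have : ∀ x ∈ antidiagonal w,
            (p ^ x.1 - p⁻¹ ^ x.1) * ((p - p⁻¹) * p ^ (x.2 + 1)) =
            p * ((p ^ x.1 - p⁻¹ ^ x.1) * ((p - p⁻¹) * p ^ x.2)) := fun x _ => by ring
        simp only
        rw [Finset.sum_congr rfl this, ← Finset.mul_sum, ih]
        push_cast
        ring
    rw [Finset.Nat.sum_antidiagonal_succ', gCoeff_zero, gCoeff_succ]
    simp only [gCoeff_succ]
    rw [key w]
    push_cast
    ring

/-- The parameter `v^{-b_{ij}}`. -/
def pq (i j : Fin N) : K := v ^ (-C.b i j)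

theorem pq_symm (i j : Fin N) : pq C i j = pq C j i := by rw [pq, pq, b_symm]

theorem v_zpow_ne_one {n : ℤ} (hn : n ≠ 0) : v ^ n ≠ 1 := by
  have key : ∀ m : ℕ, m ≠ 0 → v ^ m ≠ 1 := by
    intro m hm h
    have h2 : algebraMap (Polynomial ℂ) (RatFunc ℂ) (Polynomial.X ^ m) =
        algebraMap (Polynomial ℂ) (RatFunc ℂ) 1 := by
      rw [map_pow, RatFunc.algebraMap_X, map_one]; exact h
    have h3 := RatFunc.algebraMap_injective ℂ h2
    have := congrArg Polynomial.natDegree h3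
    rw [Polynomial.natDegree_X_pow, Polynomial.natDegree_one] at this
    exact hm this
  rcases Int.natAbs_eq n with h | h
  · rw [h, zpow_natCast]; exact key _ (by omega)
  · rw [h, zpow_neg, zpow_natCast]
    intro h'
    exact key n.natAbs (by omega) (inv_eq_one.1 h')

theorem v_inv_sub_ne_zero : v⁻¹ - v ≠ 0 := by
  intro h
  have h1 : v ^ (2 : ℤ) ≠ 1 := v_zpow_ne_one (by norm_num)
  apply h1
  have h2 := sub_eq_zero.1 h
  have : v * v⁻¹ = 1 := mul_inv_cancel₀ v_ne_zero
  rw [h2] at this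
  rw [zpow_two]; exact this

/-- The structure constant `[s b_{ij}] / s`. -/
def hE (i j : Fin N) (s : ℕ) : K := qInt v ((s : ℤ) * C.b i j) / (s : K)

theorem hE_symm (i j : Fin N) (s : ℕ) : hE C i j s = hE C j i s := by rw [hE, hE, b_symm]

/-- The quantum integer in the relation between H and E is, after rescaling, a coefficient of the
logarithmic derivative of g. This is why g governs the commutation of θ and E. -/
theorem smul_hE (i j : Fin N) (s : ℕ) :
    (s : K) * ((v⁻¹ - v) * hE C i j s) = pq C i j ^ s - (pq C i j)⁻¹ ^ s := by
  rcases Nat.eq_zero_or_pos s with rfl | hs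
  · simp
  · have hs' : (s : K) ≠ 0 := Nat.cast_ne_zero.2 hs.ne'
    have h := v_inv_sub_ne_zero
    rw [hE, qInt, pq, ← zpow_neg, neg_neg, ← zpow_natCast, ← zpow_natCast, ← zpow_mul, ← zpow_mul,
      show -((s : ℤ) * C.b i j) = -C.b i j * s by ring, mul_comm (s : ℤ) (C.b i j), mul_comm, mul_assoc, div_mul_cancel₀ _ hs',
      mul_div_cancel₀ _ h]

theorem hCoeff_mul_E (i j : Fin N) (s : ℕ) (n : ℤ) :
    hCoeff C i s * E C j n = E C j n * hCoeff C i s +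
      ((v⁻¹ - v) * hE C i j s) • E C j (n + s) := by
  rcases Nat.eq_zero_or_pos s with rfl | hs
  · simp [hCoeff_zero, hE]
  · lift s to ℕ+ using hs
    rw [hCoeff_pos, smul_mul_assoc, H_mul_E, smul_add, mul_smul_comm, smul_smul, add_comm n]
    rfl

/-- `θ_i(z) E_j(w) = g(z/w) E_j(w) θ_i(z)`, in components. -/
theorem theta_mul_E (i j : Fin N) (t : ℕ) (n : ℤ) :
    theta C i t * E C j n = ∑ x ∈ antidiagonal t,
      gCoeff (pq C i j) x.1 • (E C j (n + x.1) * theta C i x.2) := by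
  set Eh : PowerSeries (U C) :=
    PowerSeries.mk fun u => gCoeff (pq C i j) u • E C j (n + u) with hEh
  -- Commuting z h' past g(z/w) E_j(w) produces z d/dz of that series, by `smul_hE` and
  -- `gCoeff_rec`.
  have comm : eulerD (hSeries C i) * Eh = Eh * eulerD (hSeries C i) + eulerD Eh := by
    ext w
    rw [map_add, PowerSeries.coeff_mul, PowerSeries.coeff_mul, ← Finset.Nat.sum_antidiagonal_swap
      (f := fun p => PowerSeries.coeff p.1 Eh * PowerSeries.coeff p.2 (eulerD (hSeries C i))),
      coeff_eulerD, ← sub_eq_iff_eq_add', ← Finset.sum_sub_distrib]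
    have : ∀ x ∈ antidiagonal w,
        PowerSeries.coeff x.1 (eulerD (hSeries C i)) * PowerSeries.coeff x.2 Eh -
        PowerSeries.coeff x.swap.1 Eh * PowerSeries.coeff x.swap.2 (eulerD (hSeries C i)) =
        ((pq C i j ^ x.1 - (pq C i j)⁻¹ ^ x.1) * gCoeff (pq C i j) x.2) • E C j (n + w) := by
      intro x hx
      rw [coeff_eulerD, Prod.fst_swap, Prod.snd_swap, coeff_eulerD, hEh, PowerSeries.coeff_mk]
      change ((x.1 : K) • hCoeff C i x.1) * _ - _ * ((x.1 : K) • hCoeff C i x.1) = _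
      simp only [smul_mul_assoc, mul_smul_comm, hCoeff_mul_E, smul_add, smul_smul]
      rw [← smul_hE, ← mem_antidiagonal.1 hx]
      have e : n + (x.2 : ℤ) + x.1 = n + ((x.1 + x.2 : ℕ) : ℤ) := by push_cast; ring
      rw [e, mul_comm (x.1 : K) (gCoeff _ _), add_sub_cancel_left]
      congr 1; ring
    rw [Finset.sum_congr rfl this, ← Finset.sum_smul, gCoeff_rec (pq C i j), hEh,
      PowerSeries.coeff_mk, smul_smul]
  -- Both sides solve z f' = (z h') f and have constant term E_{j,n}.
  have main : thetaSeries C i * PowerSeries.C (E C j n) = Eh * thetaSeries C i := by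
    refine eulerD_unique (coeff_zero_eulerD_hSeries C i) ?_ ?_ ?_
    · rw [eulerD_mul, eulerD_C, mul_zero, add_zero, eulerD_thetaSeries, mul_assoc]
    · rw [eulerD_mul, eulerD_thetaSeries, ← mul_assoc, ← mul_assoc, comm, add_mul, add_comm]
    · simp [PowerSeries.coeff_mul, coeff_thetaSeries, theta_zero, hEh, gCoeff_zero]
  have h := congrArg (PowerSeries.coeff t) main
  rw [PowerSeries.coeff_mul_C, coeff_thetaSeries, PowerSeries.coeff_mul] at h
  rw [h]
  refine Finset.sum_congr rfl fun x _ => ?_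
  rw [hEh, PowerSeries.coeff_mk, coeff_thetaSeries, smul_mul_assoc]

/-- `θ_{i,t}` for an integer index, zero for `t < 0`. -/
def thetaZ (i : Fin N) (t : ℤ) : U C := if 0 ≤ t then theta C i t.toNat else 0

theorem thetaZ_natCast (i : Fin N) (t : ℕ) : thetaZ C i t = theta C i t := by simp [thetaZ]

theorem thetaZ_of_neg (i : Fin N) {t : ℤ} (h : t < 0) : thetaZ C i t = 0 := by
  simp [thetaZ, h]

theorem isHom_thetaZ (i : Fin N) (t : ℤ) : IsHom C 0 (thetaZ C i t) := by
  unfold thetaZ; split_ifs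
  exacts [isHom_theta C i _, isHom_zero C 0]

/-- The relation `(w - p z) θ_i(z) E_j(w) = (w - p⁻¹ z) E_j(w) θ_i(z)` with `p = v^{-b_{ij}}`. -/
theorem thetaZ_mul_E (i j : Fin N) (t n : ℤ) :
    thetaZ C i t * E C j n - pq C i j • (thetaZ C i (t - 1) * E C j (n + 1)) =
      E C j n * thetaZ C i t - (pq C i j)⁻¹ • (E C j (n + 1) * thetaZ C i (t - 1)) := by
  rcases lt_or_ge t 0 with h | h
  · rw [thetaZ_of_neg C i h, thetaZ_of_neg C i (by omega)]; simp
  obtain ⟨t, rfl⟩ := Int.eq_ofNat_of_zero_le h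
  cases t with
  | zero =>
    rw [thetaZ_of_neg C i (t := ((0 : ℕ) : ℤ) - 1) (by norm_num), thetaZ_natCast, theta_zero]
    simp
  | succ t =>
    rw [show ((t + 1 : ℕ) : ℤ) - 1 = t by push_cast; ring, thetaZ_natCast, thetaZ_natCast,
      theta_mul_E, theta_mul_E, Finset.Nat.sum_antidiagonal_succ]
    cases t with
    | zero =>
      simp only [Finset.HasAntidiagonal.antidiagonal_zero, Finset.sum_singleton, gCoeff_zero, theta_zero,
        gCoeff_succ]
      simp only [Nat.cast_zero, add_zero, one_smul, mul_one, zero_add, pow_zero, Nat.cast_one,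
        sub_smul]
      abel
    | succ t =>
      rw [Finset.Nat.sum_antidiagonal_succ]
      rw [Finset.Nat.sum_antidiagonal_succ (n := t)]
      simp only [gCoeff_zero, gCoeff_succ, Finset.smul_sum, smul_add, smul_smul, Nat.cast_zero,
        add_zero, one_smul, zero_add, Nat.cast_one]
      -- The coefficients of g are geometric with ratio p only from index 1 on. The tails cancel
      -- here, and the terms of index 0 and 1 give the right-hand side.
      have : ∀ x ∈ antidiagonal t,
          ((pq C i j - (pq C i j)⁻¹) * pq C i j ^ (x.1 + 1)) •
            (E C j (n + ((x.1 + 1 + 1 : ℕ) : ℤ)) * theta C i x.2) =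
          (pq C i j * ((pq C i j - (pq C i j)⁻¹) * pq C i j ^ x.1)) •
            (E C j (n + 1 + ((x.1 + 1 : ℕ) : ℤ)) * theta C i x.2) := by
        intro x _
        rw [show n + ((x.1 + 1 + 1 : ℕ) : ℤ) = n + 1 + ((x.1 + 1 : ℕ) : ℤ) by push_cast; ring]
        congr 1; ring
      rw [Finset.sum_congr rfl this]
      rw [pow_zero, mul_one, sub_smul]
      abel

end

/-! ### Ordered pair products along a list -/

section PairProd

variable {V O : Type*} [CommRing O]

/-- The product of `nb a b` over all pairs with `a` before `b` in the list. -/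
def pairProd (nb : V → V → O) : List V → O
  | [] => 1
  | a :: L => (L.map (nb a)).prod * pairProd nb L

theorem pairProd_append_cons (nb : V → V → O) (A B : List V) (w : V) :
    pairProd nb (A ++ w :: B) =
      pairProd nb (A ++ B) * ((A.map fun a => nb a w).prod * (B.map (nb w)).prod) := by
  induction A with
  | nil => simp [pairProd, mul_comm]
  | cons a A ih =>
    simp only [List.cons_append, pairProd, ih, List.map_append, List.map_cons, List.prod_append,
      List.prod_cons]
    ring

end PairProd

/-! ### Exchange at adjacent positions of a list -/

section SwapAt

variable {V : Type*}

/-- Exchange the entries at positions `k` and `k + 1`. -/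
def swapAt : ℕ → List V → List V
  | 0, x :: y :: B => y :: x :: B
  | k + 1, a :: L => a :: swapAt k L
  | _, L => L

theorem swapAt_append (A B : List V) (x y : V) :
    swapAt A.length (A ++ x :: y :: B) = A ++ y :: x :: B := by
  induction A with
  | nil => rfl
  | cons a A ih => simp [swapAt, ih]

theorem exists_split {k : ℕ} {L : List V} (h : k + 2 ≤ L.length) :
    ∃ A x y B, L = A ++ x :: y :: B ∧ A.length = k := by
  induction k generalizing L with
  | zero =>
    match L, h with
    | x :: y :: B, _ => exact ⟨[], x, y, B, rfl, rfl⟩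
  | succ k ih =>
    match L, h with
    | a :: L, h =>
      obtain ⟨A, x, y, B, rfl, hA⟩ := ih (L := L) (by simp at h; omega)
      exact ⟨a :: A, x, y, B, rfl, by simp [hA]⟩

end SwapAt

/-! ### The Serre identity for symmetrized products of linear forms -/

section Forms

variable {V O : Type*} [CommRing O]

/-- The product of the values of the linear forms `f.1 + f.2 z` along a list. -/
def evalForms (z : V → O) (F : List (O × O)) (L : List V) : O :=
  (List.zipWith (fun f x => f.1 + f.2 * z x) F L).prod

theorem evalForms_append (z : V → O) {F F' : List (O × O)} {L L' : List V}
    (h : F.length = L.length) :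
    evalForms z (F ++ F') (L ++ L') = evalForms z F L * evalForms z F' L' := by
  rw [evalForms, List.zipWith_append h, List.prod_append]; rfl

theorem evalForms_cons (z : V → O) (f : O × O) (F : List (O × O)) (x : V) (L : List V) :
    evalForms z (f :: F) (x :: L) = (f.1 + f.2 * z x) * evalForms z F L := by
  simp [evalForms]

theorem evalForms_replicate (z : V → O) (f : O × O) (L : List V) :
    evalForms z (List.replicate L.length f) L = (L.map fun x => f.1 + f.2 * z x).prod := by
  induction L with
  | nil => rfl
  | cons x L ih => rw [List.length_cons, List.replicate_succ, evalForms_cons, ih]; simp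

variable [DecidableEq V]

/-- The weighted symmetrization of a product of linear forms. -/
def symForms (nb : V → V → O) (z : V → O) (L₀ : List V) (F : List (O × O)) : O :=
  ∑ L ∈ L₀.permutations.toFinset, pairProd nb L * evalForms z F L

variable {nb : V → V → O} {z : V → O} {L₀ : List V}

theorem symForms_linear (P S : List (O × O)) (α β : O) (f g : O × O) (hP : P.length < L₀.length) :
    symForms nb z L₀ (P ++ (α • f + β • g) :: S) =
      α * symForms nb z L₀ (P ++ f :: S) + β * symForms nb z L₀ (P ++ g :: S) := by
  unfold symForms
  rw [Finset.mul_sum, Finset.mul_sum, ← Finset.sum_add_distrib]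
  refine Finset.sum_congr rfl fun L hL => ?_
  have hlen : L.length = L₀.length := by
    simp only [List.mem_toFinset, List.mem_permutations] at hL
    exact hL.length_eq
  have hsplit : ∃ A x B, L = A ++ x :: B ∧ P.length = A.length := by
    refine ⟨L.take P.length, L[P.length], L.drop (P.length + 1), ?_, ?_⟩
    · simp
    · rw [List.length_take]; omega
  obtain ⟨A, x, B, rfl, hA⟩ := hsplit
  simp only [evalForms_append z hA, evalForms_cons, Prod.fst_add, Prod.snd_add, Prod.smul_fst,
    Prod.smul_snd, smul_eq_mul]
  ring

/-- Exchanging the letters at the two positions concerned is a fixed-point-free involution on the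
orderings. The difference of the two sums carries the factor `pairProd` times q²y - x, which by
`hnb` changes sign under this involution, so the terms cancel in pairs. -/
theorem symForms_exchange {q2 : O} (hL₀ : L₀.Nodup)
    (hnb : ∀ a b, a ≠ b → nb a b * (q2 * z b - z a) + nb b a * (q2 * z a - z b) = 0)
    (P S : List (O × O)) (f₁ f₂ g₁ g₂ : O × O) (c : O) (hP : P.length + 2 ≤ L₀.length)
    (h : ∀ x y : O, (f₁.1 + f₁.2 * x) * (f₂.1 + f₂.2 * y) - (g₁.1 + g₁.2 * x) * (g₂.1 + g₂.2 * y) =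
      c * (q2 * y - x)) :
    symForms nb z L₀ (P ++ f₁ :: f₂ :: S) = symForms nb z L₀ (P ++ g₁ :: g₂ :: S) := by
  rw [← sub_eq_zero]
  unfold symForms
  rw [← Finset.sum_sub_distrib]
  have hsp : ∀ L ∈ L₀.permutations.toFinset, ∃ A x y B, L = A ++ x :: y :: B ∧
      P.length = A.length ∧ x ≠ y ∧ (A ++ x :: y :: B).Perm L₀ := by
    intro L hL
    simp only [List.mem_toFinset, List.mem_permutations] at hL
    obtain ⟨A, x, y, B, rfl, hA⟩ := exists_split (k := P.length) (L := L)
      (by rw [hL.length_eq]; exact hP)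
    refine ⟨A, x, y, B, rfl, hA.symm, ?_, hL⟩
    rintro rfl
    have := hL.nodup_iff.2 hL₀
    simp [List.nodup_append] at this
  have hterm : ∀ A x y B, P.length = A.length →
      pairProd nb (A ++ x :: y :: B) * evalForms z (P ++ f₁ :: f₂ :: S) (A ++ x :: y :: B) -
      pairProd nb (A ++ x :: y :: B) * evalForms z (P ++ g₁ :: g₂ :: S) (A ++ x :: y :: B) =
      pairProd nb (A ++ x :: y :: B) * (q2 * z y - z x) * (c * evalForms z P A * evalForms z S B) := by
    intro A x y B hA
    simp only [evalForms_append z hA, evalForms_cons]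
    linear_combination (pairProd nb (A ++ x :: y :: B) * evalForms z P A * evalForms z S B) *
      h (z x) (z y)
  have hanti : ∀ A x y B, x ≠ y → pairProd nb (A ++ x :: y :: B) * (q2 * z y - z x) +
      pairProd nb (A ++ y :: x :: B) * (q2 * z x - z y) = 0 := by
    intro A x y B hxy
    have e : ∀ A : List V, ∃ t, pairProd nb (A ++ x :: y :: B) = t * nb x y ∧
        pairProd nb (A ++ y :: x :: B) = t * nb y x := by
      intro A
      induction A with
      | nil =>
        refine ⟨(B.map (nb x)).prod * ((B.map (nb y)).prod * pairProd nb B), ?_, ?_⟩ <;>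
          simp only [List.nil_append, pairProd, List.map_cons, List.prod_cons] <;> ring
      | cons a A ih =>
        obtain ⟨t, h1, h2⟩ := ih
        have h : ((A ++ x :: y :: B).map (nb a)).prod = ((A ++ y :: x :: B).map (nb a)).prod :=
          ((List.Perm.append_left A (List.Perm.swap y x B)).map _).prod_eq
        refine ⟨((A ++ y :: x :: B).map (nb a)).prod * t, ?_, ?_⟩
        · simp only [List.cons_append, pairProd, h, h1]; ring
        · simp only [List.cons_append, pairProd, h2]; ring
    obtain ⟨t, h1, h2⟩ := e A
    rw [h1, h2]
    linear_combination t * hnb x y hxy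
  refine Finset.sum_involution (fun L _ => swapAt P.length L) ?_ ?_ ?_ ?_
  · intro L hL
    obtain ⟨A, x, y, B, rfl, hA, hxy, hp⟩ := hsp L hL
    simp only [hA, swapAt_append]
    rw [hterm A x y B hA, hterm A y x B hA]
    linear_combination (c * evalForms z P A * evalForms z S B) * hanti A x y B hxy
  · intro L hL _ heq
    obtain ⟨A, x, y, B, rfl, hA, hxy, hp⟩ := hsp L hL
    simp only [hA, swapAt_append] at heq
    have := List.append_cancel_left heq
    simp only [List.cons.injEq] at this
    exact hxy this.2.1
  · intro L hL
    obtain ⟨A, x, y, B, rfl, hA, hxy, hp⟩ := hsp L hL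
    simp only [hA, swapAt_append, List.mem_toFinset, List.mem_permutations]
    exact (List.Perm.append_left A (List.Perm.swap x y B)).trans hp
  · intro L hL
    obtain ⟨A, x, y, B, rfl, hA, hxy, hp⟩ := hsp L hL
    simp only [hA, swapAt_append]

theorem symForms_replicate_smul (P S : List (O × O)) (α : O) (f : O × O) (n : ℕ)
    (hP : P.length + n ≤ L₀.length) :
    symForms nb z L₀ (P ++ (List.replicate n (α • f) ++ S)) =
      α ^ n * symForms nb z L₀ (P ++ (List.replicate n f ++ S)) := by
  induction n generalizing P with
  | zero => simp
  | succ n ih =>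
    rw [List.replicate_succ, List.cons_append]
    have h := symForms_linear (nb := nb) (z := z) (L₀ := L₀) P
      (List.replicate n (α • f) ++ S) α 0 f f (by omega)
    rw [zero_smul, add_zero, zero_mul, add_zero] at h
    have h2 := ih (P ++ [f]) (by simp; omega)
    rw [List.append_assoc, List.append_assoc] at h2
    simp only [List.singleton_append] at h2
    rw [h, h2, List.replicate_succ, List.cons_append]
    ring

variable [Algebra K O]

/-- The form `w - c z`. -/
def linForm (w : O) (c : K) : O × O := (w, algebraMap K O (-c))

/-- Under the symmetrization, (w - cx)(w - q^{-2n}cy) may be replaced by (w - q^{-2n-2}cx)(w -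
q²cy), since the difference is w(c - q^{-2n-2}c)(q²y - x). Repeating this pushes a distinguished
factor to the front of a power, at the cost of rescaling the others by q². -/
theorem symForms_pow {q : K} (hq : q ≠ 0) (hL₀ : L₀.Nodup)
    (hnb : ∀ a b, a ≠ b → nb a b * (algebraMap K O (q ^ 2) * z b - z a) +
      nb b a * (algebraMap K O (q ^ 2) * z a - z b) = 0)
    (w : O) (P S : List (O × O)) (c : K) (n : ℕ) (hP : P.length + (n + 1) ≤ L₀.length) :
    symForms nb z L₀ (P ++ (List.replicate (n + 1) (linForm w c) ++ S)) =
      symForms nb z L₀ (P ++ linForm w (q⁻¹ ^ (2 * n) * c) ::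
        (List.replicate n (linForm w (q ^ 2 * c)) ++ S)) := by
  induction n generalizing P with
  | zero => simp
  | succ n ih =>
    have h1 := ih (P ++ [linForm w c]) (by simp; omega)
    rw [List.append_assoc, List.append_assoc] at h1
    simp only [List.singleton_append] at h1
    rw [List.replicate_succ, List.cons_append, h1, List.replicate_succ (n := n), List.cons_append]
    refine symForms_exchange hL₀ hnb P _ _ _ _ _ (w * algebraMap K O (c - q⁻¹ ^ (2 * n + 2) * c))
      (by omega) ?_
    intro x y
    have hq' : algebraMap K O q * algebraMap K O q⁻¹ = 1 := by
      rw [← map_mul, mul_inv_cancel₀ hq, map_one]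
    simp only [linForm, map_neg, map_mul, map_pow, map_sub]
    have e : algebraMap K O q⁻¹ ^ (2 * n + 2) * algebraMap K O q ^ 2 =
        algebraMap K O q⁻¹ ^ (2 * n) := by
      rw [pow_add, mul_assoc, ← mul_pow, mul_comm (algebraMap K O q⁻¹), hq', one_pow, mul_one]
    rw [show 2 * (n + 1) = 2 * n + 2 by ring]
    linear_combination (w * algebraMap K O c * y - algebraMap K O c ^ 2 * x * y) * e

theorem qFact_succ (q : K) (m : ℕ) : qFact q (m + 1) = qFact q m * qInt q ((m : ℤ) + 1) := by
  rw [qFact, Finset.prod_range_succ]; rfl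

theorem qInt_ne_zero {q : K} (hq : ∀ n : ℤ, n ≠ 0 → q ^ n ≠ 1) (hq0 : q ≠ 0) {m : ℤ} (hm : m ≠ 0) :
    q ^ (-m) - q ^ m ≠ 0 := by
  intro h
  refine hq (m + m) (by omega) ?_
  rw [zpow_add₀ hq0]
  nth_rewrite 1 [← sub_eq_zero.1 h]
  rw [← zpow_add₀ hq0]; simp

theorem qFact_ne_zero {q : K} (hq : ∀ n : ℤ, n ≠ 0 → q ^ n ≠ 1) (hq0 : q ≠ 0) (m : ℕ) :
    qFact q m ≠ 0 := by
  refine Finset.prod_ne_zero_iff.2 fun k _ => ?_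
  refine div_ne_zero (qInt_ne_zero hq hq0 (by omega)) ?_
  simpa using qInt_ne_zero hq hq0 (m := 1) (by norm_num)

theorem qBinom_zero_right {q : K} (hq : ∀ n : ℤ, n ≠ 0 → q ^ n ≠ 1) (hq0 : q ≠ 0) (r : ℕ) :
    qBinom q r 0 = 1 := by
  have := qFact_ne_zero hq hq0 r
  rw [qBinom, Nat.sub_zero, show qFact q 0 = 1 from rfl, one_mul, div_self this]

theorem qBinom_self {q : K} (hq : ∀ n : ℤ, n ≠ 0 → q ^ n ≠ 1) (hq0 : q ≠ 0) (r : ℕ) :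
    qBinom q r r = 1 := by
  have := qFact_ne_zero hq hq0 r
  rw [qBinom, Nat.sub_self, show qFact q 0 = 1 from rfl, mul_one, div_self this]

theorem qBinom_succ {q : K} (hq : ∀ n : ℤ, n ≠ 0 → q ^ n ≠ 1) (hq0 : q ≠ 0) {r m : ℕ}
    (hm : m < r) : qBinom q r (m + 1) * (q ^ (-((m : ℤ) + 1)) - q ^ ((m : ℤ) + 1)) =
      qBinom q r m * (q ^ (-((r : ℤ) - m)) - q ^ ((r : ℤ) - m)) := by
  have h1 := qFact_ne_zero hq hq0 m
  have h2 := qFact_ne_zero hq hq0 (r - (m + 1))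
  have h3 := qInt_ne_zero hq hq0 (m := (m : ℤ) + 1) (by omega)
  have h4 := qInt_ne_zero hq hq0 (m := (r : ℤ) - m) (by omega)
  have h5 : q⁻¹ - q ≠ 0 := by simpa using qInt_ne_zero hq hq0 (m := 1) (by norm_num)
  have e : r - m = r - (m + 1) + 1 := by omega
  have e2 : ((r - (m + 1) : ℕ) : ℤ) + 1 = (r : ℤ) - m := by omega
  rw [qBinom, qBinom, e, qFact_succ, qFact_succ, e2, qInt, qInt]
  generalize q ^ (-((m : ℤ) + 1)) - q ^ ((m : ℤ) + 1) = a at *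
  generalize q ^ (-((r : ℤ) - m)) - q ^ ((r : ℤ) - m) = b at *
  generalize q⁻¹ - q = c at *
  field_simp

/-- The partial sums of the Serre identity. -/
theorem symForms_partial {q : K} (hq : ∀ n : ℤ, n ≠ 0 → q ^ n ≠ 1) (hq0 : q ≠ 0) (hL₀ : L₀.Nodup)
    (hnb : ∀ a b, a ≠ b → nb a b * (algebraMap K O (q ^ 2) * z b - z a) +
      nb b a * (algebraMap K O (q ^ 2) * z a - z b) = 0)
    (w : O) {r : ℕ} (hr : L₀.length = r) (m : ℕ) (hm : m < r) :
    ∑ k ∈ Finset.range (m + 1), algebraMap K O (qBinom q r k) *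
      symForms nb z L₀ (List.replicate k (-w, algebraMap K O (q ^ (1 - (r : ℤ)))) ++
        List.replicate (r - k) (algebraMap K O (q ^ (1 - (r : ℤ))) * w, -1)) =
    algebraMap K O (-(qBinom q r m * (q ^ (-((r : ℤ) - m)) - q ^ ((r : ℤ) - m)) /
        (q ^ (-(r : ℤ)) - q ^ (r : ℤ)) * q ^ (-(r : ℤ) * (r - 1 - m)))) *
      symForms nb z L₀ (List.replicate (m + 1) (-w, algebraMap K O (q ^ (1 - (r : ℤ)))) ++
        List.replicate (r - (m + 1)) (linForm w (q ^ 2 * q ^ ((r : ℤ) - 1)))) := by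
  set d : K := q ^ (1 - (r : ℤ)) with hd
  set a : O × O := (-w, algebraMap K O d) with ha
  set b : O × O := (algebraMap K O d * w, -1) with hb
  have hdd : d * q ^ ((r : ℤ) - 1) = 1 := by
    rw [hd, ← zpow_add₀ hq0]; simp
  have hb' : b = algebraMap K O d • linForm w (q ^ ((r : ℤ) - 1)) := by
    ext
    · simp only [hb, linForm, Prod.smul_fst, smul_eq_mul]
    · simp only [hb, linForm, Prod.smul_snd, smul_eq_mul, ← map_mul]
      rw [mul_neg, hdd]; simp
  -- The scalar comes from b = d(w - q^{r-1}z), and `symForms_pow` rewrites the remaining power so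
  -- that all factors but the first agree with those already present in the partial sum.
  have hterm : ∀ m < r, symForms nb z L₀ (List.replicate m a ++ List.replicate (r - m) b) =
      algebraMap K O (d ^ (r - m)) * symForms nb z L₀ (List.replicate m a ++
        linForm w (q⁻¹ ^ (2 * (r - (m + 1))) * q ^ ((r : ℤ) - 1)) ::
          List.replicate (r - (m + 1)) (linForm w (q ^ 2 * q ^ ((r : ℤ) - 1)))) := by
    intro m hm
    have h1 := symForms_replicate_smul (nb := nb) (z := z) (L₀ := L₀) (List.replicate m a) []
      (algebraMap K O d) (linForm w (q ^ ((r : ℤ) - 1))) (r - m) (by simp; omega)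
    rw [← hb', List.append_nil, List.append_nil] at h1
    rw [h1, map_pow]
    congr 1
    have h2 := symForms_pow hq0 hL₀ hnb w (List.replicate m a) [] (q ^ ((r : ℤ) - 1))
      (r - (m + 1)) (by simp; omega)
    rw [List.append_nil, List.append_nil, show r - (m + 1) + 1 = r - m by omega] at h2
    exact h2
  have hr0 : q ^ (-(r : ℤ)) - q ^ (r : ℤ) ≠ 0 := qInt_ne_zero hq hq0 (by omega)
  -- The old partial sum and the new term now differ in a single form, so they add by linearity. The
  -- hypotheses `e1` and `e2` are the coefficients of w and of z in the condition that this form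
  -- becomes c₁(-w + dz).
  have hcomb : ∀ (m : ℕ) (hm : m < r) (c₀ c₁ : K)
      (e1 : c₀ + qBinom q r m * d ^ (r - m) = -c₁)
      (e2 : c₀ * q ^ 2 + qBinom q r m * d ^ (r - m) * q⁻¹ ^ (2 * (r - (m + 1))) = -(c₁ * d ^ 2)),
      algebraMap K O c₀ * symForms nb z L₀ (List.replicate m a ++
        List.replicate (r - m) (linForm w (q ^ 2 * q ^ ((r : ℤ) - 1)))) +
      algebraMap K O (qBinom q r m) * symForms nb z L₀
        (List.replicate m a ++ List.replicate (r - m) b) =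
      algebraMap K O c₁ * symForms nb z L₀ (List.replicate (m + 1) a ++
        List.replicate (r - (m + 1)) (linForm w (q ^ 2 * q ^ ((r : ℤ) - 1)))) := by
    intro m hm c₀ c₁ e1 e2
    rw [hterm m hm, show r - m = r - (m + 1) + 1 by omega, List.replicate_succ, ← mul_assoc,
      ← map_mul, ← show r - m = r - (m + 1) + 1 by omega]
    rw [← symForms_linear (nb := nb) (z := z) (L₀ := L₀) (List.replicate m a) _
      (algebraMap K O c₀) (algebraMap K O (qBinom q r m * d ^ (r - m))) _ _ (by simp; omega)]
    rw [List.replicate_succ', List.append_assoc, List.singleton_append]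
    have h := symForms_linear (nb := nb) (z := z) (L₀ := L₀) (List.replicate m a)
      (List.replicate (r - (m + 1)) (linForm w (q ^ 2 * q ^ ((r : ℤ) - 1))))
      (algebraMap K O c₁) 0 a a (by simp; omega)
    rw [zero_smul, add_zero, zero_mul, add_zero] at h
    rw [← h]
    congr 3
    ext
    · simp only [linForm, ha, Prod.fst_add, Prod.smul_fst, smul_eq_mul]
      have := congrArg (algebraMap K O) e1
      rw [map_add, map_neg] at this
      linear_combination w * this
    · simp only [linForm, ha, Prod.snd_add, Prod.smul_snd, smul_eq_mul, ← map_mul, ← map_add]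
      congr 1
      linear_combination (-q ^ ((r : ℤ) - 1)) * e2 + (c₁ * d) * hdd
  have hQ : ∀ n : ℕ, (q : K) ^ n ≠ 0 := fun n => pow_ne_zero n hq0
  induction m with
  | zero =>
    have h := hcomb 0 hm 0 (-(d ^ r)) (by simp [qBinom_zero_right hq hq0])
      (by
        rw [qBinom_zero_right hq hq0, Nat.sub_zero]
        have : q⁻¹ ^ (2 * (r - (0 + 1))) = d ^ 2 := by
          rw [hd, ← zpow_natCast, ← zpow_natCast, inv_zpow', ← zpow_mul]
          congr 1
          push_cast [Nat.cast_sub (show 1 ≤ r by omega)]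
          ring
        rw [this]; ring)
    rw [map_zero, zero_mul, zero_add] at h
    rw [zero_add, Finset.sum_range_one, h]
    congr 2
    rw [qBinom_zero_right hq hq0, Nat.cast_zero, sub_zero, sub_zero, one_mul, div_self hr0, one_mul,
      hd, ← zpow_natCast, ← zpow_mul]
    congr 2; ring
  | succ m ih =>
    rw [Finset.sum_range_succ, ih (by omega)]
    have hbin := qBinom_succ hq hq0 (show m < r by omega)
    rw [← hbin]
    -- With this substitution all powers are monomials in q, A = q^{m+1}, B = q^{n+1} and T =
    -- (AB)^n, so the two coefficient conditions become identities of rational functions.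
    obtain ⟨n, rfl⟩ : ∃ n, r = m + 1 + (n + 1) := ⟨r - (m + 2), by omega⟩
    have hA := hQ (m + 1)
    have hB := hQ (n + 1)
    have z1 : q ^ ((m : ℤ) + 1) = q ^ (m + 1) := by norm_cast
    have z2 : q ^ (((m + 1 + (n + 1) : ℕ) : ℤ) - ((m + 1 : ℕ) : ℤ)) = q ^ (n + 1) := by
      rw [← zpow_natCast]; congr 1; push_cast; ring
    have z3 : q ^ ((m + 1 + (n + 1) : ℕ) : ℤ) = q ^ (m + 1) * q ^ (n + 1) := by
      rw [zpow_natCast, pow_add]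
    have z4 : q ^ (-((m + 1 + (n + 1) : ℕ) : ℤ) * (((m + 1 + (n + 1) : ℕ) : ℤ) - 1 - (m : ℤ))) =
        ((q ^ (m + 1) * q ^ (n + 1)) ^ (n + 1))⁻¹ := by
      rw [← pow_add, ← pow_mul, ← zpow_natCast, ← zpow_neg]; congr 1; push_cast; ring
    have z5 : q ^ (-((m + 1 + (n + 1) : ℕ) : ℤ) *
        (((m + 1 + (n + 1) : ℕ) : ℤ) - 1 - ((m + 1 : ℕ) : ℤ))) =
        ((q ^ (m + 1) * q ^ (n + 1)) ^ n)⁻¹ := by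
      rw [← pow_add, ← pow_mul, ← zpow_natCast, ← zpow_neg]; congr 1; push_cast; ring
    have z6 : d = q * (q ^ (m + 1) * q ^ (n + 1))⁻¹ := by
      rw [hd, zpow_sub₀ hq0, zpow_one, z3, div_eq_mul_inv]
    have z7 : d ^ (n + 1) = q ^ (n + 1) * ((q ^ (m + 1) * q ^ (n + 1)) ^ (n + 1))⁻¹ := by
      rw [z6, mul_pow, inv_pow]
    have z8 : q⁻¹ ^ (2 * n) = q ^ 2 * (q ^ (n + 1) * q ^ (n + 1))⁻¹ := by
      rw [← pow_add, inv_pow, show n + 1 + (n + 1) = 2 * n + 2 by ring, pow_add]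
      have := hQ (2 * n)
      field_simp
    have hr1 := hr0
    rw [zpow_neg, z3] at hr1
    have hAB : (q ^ (m + 1) * q ^ (n + 1)) ^ n ≠ 0 := pow_ne_zero _ (mul_ne_zero hA hB)
    have hq2 : q ^ 2 ≠ 0 := hQ 2
    rw [zpow_neg, zpow_neg, zpow_neg q (((m + 1 + (n + 1) : ℕ) : ℤ) - ((m + 1 : ℕ) : ℤ)),
      z1, z2, z3, z4, z5]
    refine hcomb (m + 1) hm _ _ ?_ ?_
    · rw [show m + 1 + (n + 1) - (m + 1) = n + 1 by omega, z7]
      generalize qBinom q (m + 1 + (n + 1)) (m + 1) = β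
      rw [pow_succ (q ^ (m + 1) * q ^ (n + 1)) n]
      generalize (q ^ (m + 1) * q ^ (n + 1)) ^ n = T at *
      generalize q ^ (m + 1) = A at *
      generalize q ^ (n + 1) = B at *
      have hr2 : 1 - A ^ 2 * B ^ 2 ≠ 0 := by
        intro h
        apply hr1
        have hAB' := mul_ne_zero hA hB
        field_simp
        linear_combination h
      have e : (A * B)⁻¹ - A * B = (1 - A ^ 2 * B ^ 2) / (A * B) := by field_simp
      rw [e]
      field_simp
      ring
    · rw [show m + 1 + (n + 1) - (m + 1) = n + 1 by omega, z7,
        show m + 1 + (n + 1) - (m + 1 + 1) = n by omega, z8, z6]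
      generalize qBinom q (m + 1 + (n + 1)) (m + 1) = β
      rw [pow_succ (q ^ (m + 1) * q ^ (n + 1)) n]
      generalize (q ^ (m + 1) * q ^ (n + 1)) ^ n = T at *
      generalize q ^ (m + 1) = A at *
      generalize q ^ (n + 1) = B at *
      have hr2 : 1 - A ^ 2 * B ^ 2 ≠ 0 := by
        intro h
        apply hr1
        have hAB' := mul_ne_zero hA hB
        field_simp
        linear_combination h
      have e : (A * B)⁻¹ - A * B = (1 - A ^ 2 * B ^ 2) / (A * B) := by field_simp
      rw [e]
      field_simp
      ring

/-- The Serre identity for symmetrized products of linear forms. -/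
theorem symForms_serre {q : K} (hq : ∀ n : ℤ, n ≠ 0 → q ^ n ≠ 1) (hq0 : q ≠ 0) (hL₀ : L₀.Nodup)
    (hnb : ∀ a b, a ≠ b → nb a b * (algebraMap K O (q ^ 2) * z b - z a) +
      nb b a * (algebraMap K O (q ^ 2) * z a - z b) = 0)
    (w : O) {r : ℕ} (hr : L₀.length = r) (hr0 : 0 < r) :
    ∑ k ∈ Finset.range (r + 1), algebraMap K O (qBinom q r k) *
      symForms nb z L₀ (List.replicate k (-w, algebraMap K O (q ^ (1 - (r : ℤ)))) ++
        List.replicate (r - k) (algebraMap K O (q ^ (1 - (r : ℤ))) * w, -1)) = 0 := by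
  obtain ⟨r, rfl⟩ : ∃ r', r = r' + 1 := ⟨r - 1, by omega⟩
  -- The partial sum over k < r is exactly minus the term k = r: the quotient of quantum integers in
  -- its coefficient is 1 and its power of q has exponent 0.
  rw [Finset.sum_range_succ, symForms_partial hq hq0 hL₀ hnb w hr r (by omega),
    qBinom_self hq hq0]
  have hb := qBinom_succ hq hq0 (show r < r + 1 by omega)
  rw [qBinom_self hq hq0, one_mul] at hb
  have h := qInt_ne_zero hq hq0 (m := ((r + 1 : ℕ) : ℤ)) (by omega)
  rw [← hb, Nat.cast_succ, div_self (by exact_mod_cast h), show (r : ℤ) + 1 - 1 - r = 0 by ring]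
  simp

end Forms

/-! ### A vanishing criterion -/

section Vanishing

variable {r : ℕ} (q : K)

/-- The exchange parameters between the letters: `none` stands for the letter `j`, the others are
copies of the letter `i`. -/
def dPar : Option (Fin r) → Option (Fin r) → K
  | some _, some _ => q ^ 2
  | _, _ => q ^ (1 - (r : ℤ))

theorem dPar_symm (a b : Option (Fin r)) : dPar q a b = dPar q b a := by
  cases a <;> cases b <;> rfl

variable {O M : Type*} [CommRing O] [AddCommGroup M] [Module O M]

theorem pairProd_smul_ne_zero {V : Type*} (n : V → V → O) {m : M} (hm : m ≠ 0)
    (L : List V) (h : L.Pairwise fun a b => ∀ p : O, p • m ≠ 0 → n a b • p • m ≠ 0) :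
    pairProd n L • m ≠ 0 := by
  have key : ∀ (a : V) (L : List V) (p : O), p • m ≠ 0 →
      (∀ b ∈ L, ∀ p : O, p • m ≠ 0 → n a b • p • m ≠ 0) → ((L.map (n a)).prod * p) • m ≠ 0 := by
    intro a L p hp hL
    induction L with
    | nil => simpa using hp
    | cons b L ih =>
      rw [List.map_cons, List.prod_cons, mul_assoc, mul_smul]
      exact hL b List.mem_cons_self _ (ih fun c hc => hL c (List.mem_cons_of_mem _ hc))
  induction L with
  | nil => simpa [pairProd] using hm
  | cons a L ih =>
    rw [List.pairwise_cons] at h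
    exact key a L _ (ih h.2) h.1

/-- Passing to a multiple can only enlarge the finite set of pairs whose factor kills the element. A
nonzero multiple for which as few factors as possible are nonkilling gains no further killing factor
on any nonzero multiple. -/
theorem exists_maximal_multiple (n : Option (Fin r) → Option (Fin r) → O) {m : M} (hm : m ≠ 0) :
    ∃ p : O, p • m ≠ 0 ∧ ∀ p' : O, p' • p • m ≠ 0 → ∀ a b, n a b • p' • p • m = 0 →
      n a b • p • m = 0 := by
  classical
  let f : O → ℕ := fun p =>
    (Finset.univ.filter fun e : Option (Fin r) × Option (Fin r) => n e.1 e.2 • p • m ≠ 0).card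
  obtain ⟨p, hp, hmin⟩ := (measure f).wf.has_min {p : O | p • m ≠ 0} ⟨1, by simpa using hm⟩
  refine ⟨p, hp, fun p' hp' a b hab => ?_⟩
  by_contra hne
  have hlt : f (p' * p) < f p := by
    refine Finset.card_lt_card ⟨fun e he => ?_, fun hsub => ?_⟩
    · simp only [Finset.mem_filter, Finset.mem_univ, true_and] at he ⊢
      intro h0
      apply he
      rw [mul_smul, smul_comm, h0, smul_zero]
    · have : (a, b) ∈ Finset.univ.filter
          fun e : Option (Fin r) × Option (Fin r) => n e.1 e.2 • p • m ≠ 0 := by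
        simpa using hne
      have := hsub this
      simp only [Finset.mem_filter, Finset.mem_univ, true_and] at this
      exact this (by rw [mul_smul]; exact hab)
  exact hmin (p' * p) (by simpa [mul_smul] using hp') hlt

variable [Algebra K O] [Module K M]

/-- The exchange factors `d_{ab} z_a - z_b`. -/
def exFactor (z : Option (Fin r) → O) (a b : Option (Fin r)) : O := dPar q a b • z a - z b

variable {q} {z : Option (Fin r) → O}

theorem zpow_smul_inj (hq : ∀ n : ℤ, n ≠ 0 → q ^ n ≠ 1) (hq0 : q ≠ 0) {x : M} (hx : x ≠ 0)
    {k l : ℤ} (h : q ^ k • x = q ^ l • x) : k = l := by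
  by_contra hne
  have h1 : q ^ k = q ^ l := smul_left_injective K hx h
  refine hq (k - l) (by omega) ?_
  rw [zpow_sub₀ hq0, h1, div_self (zpow_ne_zero _ hq0)]

variable [IsScalarTower K O M]

/-- The relation `n_{ab} m = 0` on a nonzero `m` has no cycles, if fewer than `r` letters are on
the same side as `none`. -/
theorem exFactor_acyclic (hq : ∀ n : ℤ, n ≠ 0 → q ^ n ≠ 1) (hq0 : q ≠ 0) {m : M}
    (hz : ∀ a, z a • m ≠ 0)
    (side : Option (Fin r) → Bool)
    (hside : ∀ a b, side a = true → side b = false → exFactor q z a b • m ≠ 0)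
    (hcount : (Finset.univ.filter fun i : Fin r => side (some i) = side none).card < r)
    (a : Option (Fin r)) :
    ¬ Relation.TransGen (fun a b => a ≠ b ∧ exFactor q z a b • m = 0) a a := by
  set E : Option (Fin r) → Option (Fin r) → Prop :=
    fun a b => a ≠ b ∧ exFactor q z a b • m = 0 with hE
  have edge : ∀ a b, E a b → z b • m = dPar q a b • z a • m := by
    intro a b h
    have := h.2
    rw [exFactor, sub_smul, smul_assoc, sub_eq_zero] at this
    exact this.symm
  have hsd : ∀ a b, E a b → side a = true → side b = true := by
    intro a b h ha
    by_contra hb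
    exact hside a b ha (by simpa using hb) h.2
  -- A path from `none` either has stayed on the side of `none`, and then its t + 1 steps multiply
  -- by q^{1-r+2t} with every smaller exponent realised by some letter of that side, or it has
  -- crossed from `false` to `true` and cannot return.
  have c1 : ∀ b, Relation.TransGen E none b → ∃ i, b = some i ∧
      ((side (some i) = side none ∧ ∃ t : ℕ,
        z (some i) • m = q ^ (1 - (r : ℤ) + 2 * t) • z none • m ∧
        ∀ t' ≤ t, ∃ i', side (some i') = side none ∧
          z (some i') • m = q ^ (1 - (r : ℤ) + 2 * t') • z none • m) ∨
      (side none = false ∧ side (some i) = true)) := by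
    intro b hb
    induction hb with
    | @single b h =>
      cases b with
      | none => exact absurd rfl h.1
      | some i =>
        refine ⟨i, rfl, ?_⟩
        have e := edge _ _ h
        by_cases hs : side (some i) = side none
        · left
          have e' : z (some i) • m = q ^ (1 - (r : ℤ) + 2 * (0 : ℕ)) • z none • m := by
            simpa [dPar] using e
          refine ⟨hs, 0, e', fun t' ht' => ⟨i, hs, ?_⟩⟩
          obtain rfl : t' = 0 := by omega
          exact e'
        · right
          have := hsd _ _ h
          revert hs this
          cases side (some i) <;> cases side none <;> simp
    | @tail b c _ h ih =>
      obtain ⟨i, rfl, ih⟩ := ih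
      have e := edge _ _ h
      cases c with
      | none =>
        exfalso
        rcases ih with ⟨hs, t, ht, hall⟩ | ⟨h1, h2⟩
        -- Closing the cycle gives the scalar q^{2(1-r)+2t}, which must be 1, so t = r - 1. The r
        -- distinct scalars met on the way belong to r distinct letters on the side of `none`,
        -- against `hcount`.
        · have e2 : z none • m = q ^ ((1 - (r : ℤ)) + (1 - (r : ℤ) + 2 * t)) • z none • m := by
            rw [ht, smul_smul, show dPar q (some i) none = q ^ (1 - (r : ℤ)) from rfl,
              ← zpow_add₀ hq0] at e
            exact e
          have e3 := zpow_smul_inj hq hq0 (hz none) (k := 0) ((by simpa using e2))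
          have : Nonempty (Fin r) := ⟨i⟩
          choose! g hg1 hg2 using hall
          have hinj : Set.InjOn g (↑(Finset.range r) : Set ℕ) := by
            intro t1 h1 t2 h2 h12
            simp only [Finset.coe_range, Set.mem_Iio] at h1 h2
            have a1 := hg2 t1 (by omega)
            have a2 := hg2 t2 (by omega)
            rw [h12, a2] at a1
            have := zpow_smul_inj hq hq0 (hz none) a1
            omega
          have := Finset.card_le_card_of_injOn (s := Finset.range r)
            (t := Finset.univ.filter fun i : Fin r => side (some i) = side none) g
            (fun t ht => by
              simp only [Finset.coe_range, Set.mem_Iio] at ht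
              simpa using hg1 t (by omega)) hinj
          rw [Finset.card_range] at this
          omega
        · have := hsd _ _ h h2
          rw [h1] at this
          exact absurd this (by simp)
      | some j =>
        refine ⟨j, rfl, ?_⟩
        rcases ih with ⟨hs, t, ht, hall⟩ | ⟨h1, h2⟩
        · by_cases hs' : side (some j) = side none
          · left
            have e2 : z (some j) • m = q ^ (1 - (r : ℤ) + 2 * (t + 1 : ℕ)) • z none • m := by
              rw [e, ht, smul_smul, show dPar q (some i) (some j) = q ^ (2 : ℤ) from rfl,
                ← zpow_add₀ hq0]
              congr 2; push_cast; ring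
            refine ⟨hs', t + 1, e2, fun t' ht' => ?_⟩
            rcases Nat.lt_or_ge t t' with h' | h'
            · obtain rfl : t' = t + 1 := by omega
              exact ⟨j, hs', e2⟩
            · exact hall t' h'
          · right
            have := hsd _ _ h
            revert hs hs' this
            cases side (some i) <;> cases side (some j) <;> cases side none <;> simp
        · exact Or.inr ⟨h1, hsd _ _ h h2⟩
  have c2 : ¬ Relation.TransGen E none none := fun h => by
    obtain ⟨i, hi, _⟩ := c1 _ h
    cases hi
  cases a with
  | none => exact c2
  | some i =>
    intro h
    -- A cycle that avoids `none` multiplies by q^{2(n+1)}, which is not 1; one through `none` is a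
    -- cycle at `none`, already excluded.
    have c3 : ∀ b, Relation.TransGen E (some i) b →
        (Relation.TransGen E (some i) none ∧ (b = none ∨ Relation.TransGen E none b)) ∨
        ∃ j, b = some j ∧ ∃ n : ℕ, z (some j) • m = q ^ (2 * ((n : ℤ) + 1)) • z (some i) • m := by
      intro b hb
      induction hb with
      | @single b h =>
        cases b with
        | none => exact Or.inl ⟨.single h, Or.inl rfl⟩
        | some j =>
          refine Or.inr ⟨j, rfl, 0, ?_⟩
          rw [edge _ _ h]; rfl
      | @tail b c hb h ih =>
        rcases ih with ⟨h1, h2⟩ | ⟨j, rfl, n, hn⟩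
        · refine Or.inl ⟨h1, Or.inr ?_⟩
          rcases h2 with rfl | h2
          · exact .single h
          · exact .tail h2 h
        · cases c with
          | none => exact Or.inl ⟨.tail hb h, Or.inl rfl⟩
          | some k =>
            refine Or.inr ⟨k, rfl, n + 1, ?_⟩
            rw [edge _ _ h, hn, smul_smul, show dPar q (some j) (some k) = q ^ (2 : ℤ) from rfl,
              ← zpow_add₀ hq0]
            congr 2; push_cast; ring
    rcases c3 _ h with ⟨h1, h2⟩ | ⟨j, hj, n, hn⟩
    · rcases h2 with h2 | h2
      · cases h2
      · exact c2 (h2.trans h1)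
    · cases hj
      have := zpow_smul_inj hq hq0 (hz (some i)) (k := 0) (by simpa using hn)
      omega

/-- If `m` is killed by the product of exchange factors for every ordering of the letters, exchange
factors between the two sides are injective, and fewer than `r` letters are on the side of `none`,
then `m = 0`. -/
theorem eq_zero_of_orderings (hq : ∀ n : ℤ, n ≠ 0 → q ^ n ≠ 1) (hq0 : q ≠ 0) (m : M)
    (hz : ∀ a, IsUnit (z a)) (side : Option (Fin r) → Bool)
    (hside : ∀ a b, side a = true → side b = false → ∀ p : O, p • m ≠ 0 →
      exFactor q z a b • p • m ≠ 0)
    (hcount : (Finset.univ.filter fun i : Fin r => side (some i) = side none).card < r)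
    (hm : ∀ L : List (Option (Fin r)), L.Perm Finset.univ.toList →
      pairProd (exFactor q z) L • m = 0) : m = 0 := by
  classical
  by_contra hne
  obtain ⟨p, hp, hmax⟩ := exists_maximal_multiple (exFactor q z) hne
  set E : Option (Fin r) → Option (Fin r) → Prop :=
    fun a b => a ≠ b ∧ exFactor q z a b • p • m = 0 with hE
  have hac := exFactor_acyclic hq hq0 (z := z) (m := p • m)
    (fun a h => hp (by
      obtain ⟨u, hu⟩ := hz a
      rw [← hu] at h
      have := congrArg (fun x => (↑u⁻¹ : O) • x) h
      simpa [smul_smul] using this)) side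
    (fun a b ha hb => hside a b ha hb p hp) hcount
  -- The number of letters reachable from a; by acyclicity it drops strictly along each edge.
  let ρ : Option (Fin r) → ℕ := fun a =>
    (Finset.univ.filter fun b => Relation.TransGen E a b).card
  have hρ : ∀ a b, E a b → ρ b < ρ a := by
    intro a b h
    refine Finset.card_lt_card ⟨fun c hc => ?_, fun hsub => ?_⟩
    · simp only [Finset.mem_filter, Finset.mem_univ, true_and] at hc ⊢
      exact .head h hc
    · have : b ∈ Finset.univ.filter fun b => Relation.TransGen E a b := by
        simpa using Relation.TransGen.single h
      have := hsub this
      simp only [Finset.mem_filter, Finset.mem_univ, true_and] at this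
      exact hac b this
  -- In increasing order of ρ no edge leads from an earlier letter to a later one, so every factor
  -- of `pairProd` along `L` is injective on the nonzero multiples of p • m.
  let L := (Finset.univ : Finset (Option (Fin r))).toList.insertionSort (fun a b => ρ a ≤ ρ b)
  have hLp : L.Perm Finset.univ.toList := List.perm_insertionSort _ _
  have hnd : L.Nodup := hLp.nodup_iff.2 (Finset.nodup_toList _)
  have : Std.Total (fun a b : Option (Fin r) => ρ a ≤ ρ b) := ⟨fun a b => le_total _ _⟩
  have : IsTrans (Option (Fin r)) (fun a b => ρ a ≤ ρ b) := ⟨fun a b c => le_trans⟩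
  have hsort : L.Pairwise fun a b => ρ a ≤ ρ b := List.pairwise_insertionSort _ _
  refine pairProd_smul_ne_zero (exFactor q z) hp L ?_ ?_
  · refine (hsort.and hnd).imp fun {a b} hab p' hp' h0 => ?_
    exact absurd (hρ a b ⟨hab.2, hmax p' hp' a b h0⟩) (not_lt.2 hab.1)
  · rw [smul_comm, hm L hLp, smul_zero]

end Vanishing

/-! ### Families indexed by exponents, as a module over Laurent polynomials -/

/-- Families of elements indexed by `V → ℤ` (formal distributions in variables `z_a`). -/
def Dist (V R : Type*) : Type _ := (V → ℤ) → R

section Dist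

theorem map_shift_of_notMem {V R : Type*} [DecidableEq V] (X : V → ℤ → R) {L : List V} {a : V}
    (h : a ∉ L) (l : V → ℤ) :
    (L.map fun b => X b ((l - Pi.single a 1 : V → ℤ) b)) = L.map fun b => X b (l b) := by
  refine List.map_congr_left fun b hb => ?_
  have : b ≠ a := fun e => h (e ▸ hb)
  simp [this]

variable {V R : Type*} [Ring R]

instance : AddCommGroup (Dist V R) := inferInstanceAs (AddCommGroup ((V → ℤ) → R))

theorem Dist.sub_apply (F G : Dist V R) (l : V → ℤ) : (F - G) l = F l - G l := rfl

theorem Dist.neg_apply (F : Dist V R) (l : V → ℤ) : (-F) l = -F l := rfl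

theorem Dist.zero_apply (l : V → ℤ) : (0 : Dist V R) l = 0 := rfl

theorem Dist.sum_apply {ι : Type*} (s : Finset ι) (F : ι → Dist V R) (l : V → ℤ) :
    (∑ a ∈ s, F a) l = ∑ a ∈ s, F a l := Finset.sum_apply l s F

variable [Algebra K R]

instance : Module K (Dist V R) := inferInstanceAs (Module K ((V → ℤ) → R))

/-- Multiplication by the monomial `z^g`. -/
def Dist.shift : Multiplicative (V → ℤ) →* Module.End K (Dist V R) where
  toFun g :=
    { toFun := fun F l => F (l - g.toAdd)
      map_add' := fun _ _ => rfl
      map_smul' := fun _ _ => rfl }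
  map_one' := by ext F; funext l; exact congrArg F (sub_zero l)
  map_mul' g h := by ext F; funext l; exact congrArg F (by simp [sub_sub])

/-- Laurent polynomials in the variables `z_a`. -/
abbrev LPoly (V : Type*) : Type _ := AddMonoidAlgebra K (V → ℤ)

instance : Module (LPoly V) (Dist V R) :=
  Module.compHom _ (AddMonoidAlgebra.lift K (Module.End K (Dist V R)) (V → ℤ) Dist.shift).toRingHom

theorem Dist.smul_def (p : LPoly V) (F : Dist V R) :
    p • F = AddMonoidAlgebra.lift K (Module.End K (Dist V R)) (V → ℤ) Dist.shift p F := rfl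

theorem Dist.single_smul (g : V → ℤ) (c : K) (F : Dist V R) :
    (AddMonoidAlgebra.single g c : LPoly V) • F = fun l => c • F (l - g) := by
  rw [Dist.smul_def, AddMonoidAlgebra.lift_single]; rfl

instance : IsScalarTower K (LPoly V) (Dist V R) where
  smul_assoc c p F := by rw [Dist.smul_def, map_smul]; rfl

theorem Dist.smul_apply (c : K) (F : Dist V R) (l : V → ℤ) : (c • F) l = c • F l := rfl

theorem Dist.algebraMap_smul (c : K) (F : Dist V R) :
    (algebraMap K (LPoly V) c) • F = c • F := by
  rw [Algebra.algebraMap_eq_smul_one, smul_assoc, one_smul]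

variable [DecidableEq V]

/-- The variable `z_a`. -/
def zVar (a : V) : LPoly V := AddMonoidAlgebra.single (Pi.single a 1) 1

theorem isUnit_zVar (a : V) : IsUnit (zVar a) := by
  refine IsUnit.of_mul_eq_one (AddMonoidAlgebra.single (-Pi.single a 1) 1) ?_
  rw [zVar, AddMonoidAlgebra.single_mul_single, add_neg_cancel, one_mul]; rfl

theorem zVar_smul (a : V) (F : Dist V R) (l : V → ℤ) :
    (zVar a • F : Dist V R) l = F (l - Pi.single a 1) := by
  rw [zVar, Dist.single_smul]
  exact one_smul K _

/-- The product of the currents `X_a(z_a)`, in the order given by the list. -/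
def word (X : V → ℤ → R) (L : List V) : Dist V R := fun l => (L.map fun a => X a (l a)).prod

end Dist

/-! ### Reordering words of currents by exchange factors. -/

section Words

variable {r : ℕ} {q : K} {R : Type*} [Ring R] [Algebra K R]

/-- The exchange relations between currents. -/
def Exchange (q : K) (X : Option (Fin r) → ℤ → R) : Prop :=
  ∀ a b, a ≠ b → ∀ m n : ℤ, dPar q a b • (X a m * X b (n - 1)) - X b (n - 1) * X a m =
    X a (m - 1) * X b n - dPar q a b • (X b n * X a (m - 1))

/-- The exchange relation multiplied on both sides by the remaining currents. As the letters are
distinct, the shifts coming from z_a and z_b do not touch these. -/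
theorem exFactor_smul_word {X : Option (Fin r) → ℤ → R} (hX : Exchange q X)
    {P S : List (Option (Fin r))} {a b : Option (Fin r)} (h : (P ++ b :: a :: S).Nodup) :
    exFactor q zVar a b • word X (P ++ b :: a :: S) =
      -(exFactor q zVar b a • word X (P ++ a :: b :: S)) := by
  have hab : a ≠ b := by rintro rfl; simp [List.nodup_append] at h
  have haP : a ∉ P := fun h' => by simp [List.nodup_append] at h; exact (h.2.2 a h').2.1 rfl
  have hbP : b ∉ P := fun h' => by simp [List.nodup_append] at h; exact (h.2.2 b h').1 rfl
  have haS : a ∉ S := fun h' => by simp [List.nodup_append] at h; exact h.2.1.2.1 h'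
  have hbS : b ∉ S := fun h' => by simp [List.nodup_append] at h; exact h.2.1.1.2 h'
  funext l
  simp only [exFactor, sub_smul, smul_assoc, Dist.sub_apply, Dist.smul_apply, zVar_smul,
    Dist.neg_apply, word, List.map_append, List.map_cons, List.prod_append, List.prod_cons]
  rw [map_shift_of_notMem X haP, map_shift_of_notMem X hbP, map_shift_of_notMem X haS,
    map_shift_of_notMem X hbS]
  have e := hX a b hab (l a) (l b)
  simp only [Pi.sub_apply, Pi.single_eq_same, Pi.single_eq_of_ne hab, Pi.single_eq_of_ne hab.symm,
    sub_zero, dPar_symm q b a]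
  set u := (P.map fun a => X a (l a)).prod
  set w := (S.map fun a => X a (l a)).prod
  have := congrArg (fun x => u * x * w) e
  simp only [mul_sub, sub_mul, mul_smul_comm, smul_mul_assoc] at this
  simp only [mul_assoc] at this ⊢
  rw [sub_eq_iff_eq_add] at this
  rw [this]
  abel

/-- Signs recording the relative position of two letters. -/
def sgn : Option (Fin r) → Option (Fin r) → ℤ
  | none, _ => 1
  | some _, none => -1
  | some i, some j => if i < j then 1 else -1

theorem sgn_swap {a b : Option (Fin r)} (h : a ≠ b) : sgn b a = -sgn a b := by
  cases a with
  | none => cases b with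
    | none => exact absurd rfl h
    | some j => rfl
  | some i => cases b with
    | none => rfl
    | some j =>
      have hij : i ≠ j := fun e => h (e ▸ rfl)
      rcases lt_or_gt_of_ne hij with h' | h'
      · simp [sgn, h', h'.le]
      · simp [sgn, h', not_lt.2 h'.le]

theorem sgn_mul_self (a b : Option (Fin r)) : sgn a b * sgn a b = 1 := by
  cases a <;> cases b <;> simp [sgn]
  split_ifs <;> simp

/-- The signed exchange factors. -/
def exSigned (q : K) (a b : Option (Fin r)) : LPoly (Option (Fin r)) :=
  (sgn a b : LPoly (Option (Fin r))) * exFactor q zVar a b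

theorem pairProd_mul {V O : Type*} [CommRing O] (s n : V → V → O) (L : List V) :
    pairProd (fun a b => s a b * n a b) L = pairProd s L * pairProd n L := by
  induction L with
  | nil => simp [pairProd]
  | cons a L ih => rw [pairProd, pairProd, pairProd, ih, List.prod_map_mul]; ring

theorem pairProd_one {V O : Type*} [CommRing O] (L : List V) :
    pairProd (fun _ _ => (1 : O)) L = 1 := by
  induction L with
  | nil => rfl
  | cons a L ih => rw [pairProd, ih]; simp

theorem pairProd_exFactor (q : K) (L : List (Option (Fin r))) :
    ∃ c : LPoly (Option (Fin r)), pairProd (exFactor q zVar) L = c * pairProd (exSigned q) L := by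
  refine ⟨pairProd (fun a b => (sgn a b : LPoly (Option (Fin r)))) L, ?_⟩
  have : (exSigned q : Option (Fin r) → _ → _) = fun a b =>
      (sgn a b : LPoly (Option (Fin r))) * exFactor q zVar a b := rfl
  rw [this, pairProd_mul, ← mul_assoc, ← pairProd_mul]
  have e : (fun a b : Option (Fin r) => (sgn a b : LPoly (Option (Fin r))) * (sgn a b)) =
      fun _ _ => 1 := by
    funext a b
    rw [← Int.cast_mul, sgn_mul_self, Int.cast_one]
  rw [e, pairProd_one, one_mul]

theorem exSigned_smul_word {X : Option (Fin r) → ℤ → R} (hX : Exchange q X)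
    {P S : List (Option (Fin r))} {a b : Option (Fin r)} (h : (P ++ b :: a :: S).Nodup) :
    exSigned q a b • word X (P ++ b :: a :: S) = exSigned q b a • word X (P ++ a :: b :: S) := by
  have hab : a ≠ b := by rintro rfl; simp [List.nodup_append] at h
  rw [exSigned, exSigned, mul_smul, exFactor_smul_word hX h, sgn_swap hab, mul_smul]
  simp

theorem move_front {X : Option (Fin r) → ℤ → R} (hX : Exchange q X) (a : Option (Fin r))
    (A P S : List (Option (Fin r))) (h : (P ++ (A ++ a :: S)).Nodup) :
    (A.map (exSigned q a)).prod • word X (P ++ (A ++ a :: S)) =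
      (A.map fun x => exSigned q x a).prod • word X (P ++ a :: (A ++ S)) := by
  induction A generalizing P with
  | nil => simp
  | cons b A ih =>
    have e : P ++ (b :: A ++ a :: S) = (P ++ [b]) ++ (A ++ a :: S) := by simp
    rw [List.map_cons, List.prod_cons, mul_smul, e, ih _ (e ▸ h), smul_comm]
    have e2 : P ++ [b] ++ a :: (A ++ S) = P ++ b :: a :: (A ++ S) := by simp
    have hn : (P ++ b :: a :: (A ++ S)).Nodup := by
      refine (List.Perm.nodup_iff ?_).1 h
      refine List.Perm.append_left P ?_
      simp only [List.cons_append]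
      exact List.Perm.cons b List.perm_middle
    rw [e2, exSigned_smul_word hX hn, List.map_cons, List.prod_cons, mul_smul, smul_comm,
      List.cons_append]

/-- Sorting by insertion: the first letter of `L'` is carried to the front by `move_front`, the
tails are compared by induction, and the pairs whose order does not change contribute the same
factor to both sides. -/
theorem pairProd_smul_word {X : Option (Fin r) → ℤ → R} (hX : Exchange q X)
    (L' : List (Option (Fin r))) (P L : List (Option (Fin r))) (hp : L.Perm L')
    (h : (P ++ L).Nodup) :
    pairProd (exSigned q) L' • word X (P ++ L) = pairProd (exSigned q) L • word X (P ++ L') := by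
  induction L' generalizing P L with
  | nil => rw [hp.eq_nil]
  | cons a T ih =>
    obtain ⟨A, B, rfl⟩ := List.append_of_mem (hp.mem_iff.2 List.mem_cons_self)
    have hT : (A ++ B).Perm T := (List.perm_middle.symm.trans hp).cons_inv
    have hn : (P ++ [a] ++ (A ++ B)).Nodup := by
      refine (List.Perm.nodup_iff ?_).1 h
      rw [List.append_assoc]
      exact List.Perm.append_left P List.perm_middle
    have ih' := ih (P ++ [a]) (A ++ B) hT hn
    have e1 : P ++ [a] ++ (A ++ B) = P ++ a :: (A ++ B) := by simp
    have e2 : P ++ [a] ++ T = P ++ a :: T := by simp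
    rw [e1, e2] at ih'
    have e3 : (T.map (exSigned q a)).prod =
        (A.map (exSigned q a)).prod * (B.map (exSigned q a)).prod := by
      rw [← List.prod_append, ← List.map_append]
      exact ((hT.map _).prod_eq).symm
    rw [pairProd, pairProd_append_cons, e3]
    calc _ = ((B.map (exSigned q a)).prod * pairProd (exSigned q) T) •
          (A.map (exSigned q a)).prod • word X (P ++ (A ++ a :: B)) := by
          rw [smul_smul]; congr 1; ring
      _ = ((B.map (exSigned q a)).prod * (A.map fun x => exSigned q x a).prod) •
          pairProd (exSigned q) T • word X (P ++ a :: (A ++ B)) := by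
          rw [move_front hX a A P B h, smul_smul, smul_smul]; congr 1; ring
      _ = _ := by rw [ih', smul_smul]; congr 1; ring

/-- The word with the letter `none` inserted at position `k`. -/
def serreWord (L : List (Fin r)) (k : ℕ) : List (Option (Fin r)) :=
  (L.take k).map some ++ none :: (L.drop k).map some

theorem serreWord_perm {L : List (Fin r)} (hL : L.Perm (List.finRange r)) (k : ℕ) :
    (serreWord L k).Perm Finset.univ.toList := by
  have hnd : (serreWord L k).Nodup := by
    have : (serreWord L k).Perm (none :: L.map some) := by
      refine List.perm_middle.trans (List.Perm.cons _ ?_)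
      rw [← List.map_append, List.take_append_drop]
    rw [this.nodup_iff, List.nodup_cons]
    refine ⟨by simp, (hL.nodup_iff.2 (List.nodup_finRange r)).map (Option.some_injective _)⟩
  refine (List.perm_ext_iff_of_nodup hnd (Finset.nodup_toList _)).2 fun a => ?_
  simp only [Finset.mem_toList, Finset.mem_univ, iff_true]
  cases a with
  | none => simp [serreWord]
  | some i =>
    have : i ∈ L.take k ++ L.drop k := by
      rw [List.take_append_drop, hL.mem_iff]; exact List.mem_finRange i
    rw [List.mem_append] at this
    rw [serreWord, List.mem_append, List.mem_cons]
    rcases this with h | h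
    · exact Or.inl (List.mem_map_of_mem h)
    · exact Or.inr (Or.inr (List.mem_map_of_mem h))

/-- The Serre combination of the words of currents. -/
def serreDist (q : K) (X : Option (Fin r) → ℤ → R) : Dist (Option (Fin r)) R :=
  ∑ L ∈ (List.finRange r).permutations.toFinset, ∑ k ∈ Finset.range (r + 1),
    ((-1) ^ k * qBinom q r k) • word X (serreWord L k)

theorem sum_perm_eq {A : Type*} [AddCommMonoid A] (f : List (Fin r) → A) :
    ∑ σ : Equiv.Perm (Fin r), f (List.ofFn σ) =
      ∑ L ∈ (List.finRange r).permutations.toFinset, f L := by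
  refine Finset.sum_bij (fun σ _ => List.ofFn σ) (fun σ _ => ?_) (fun σ _ τ _ h => ?_)
    (fun L hL => ?_) (fun _ _ => rfl)
  · rw [List.mem_toFinset, List.mem_permutations]
    refine (List.perm_ext_iff_of_nodup (List.nodup_ofFn.2 σ.injective)
      (List.nodup_finRange r)).2 fun a => ?_
    simp only [List.mem_ofFn, List.mem_finRange, iff_true]
    exact σ.surjective a
  · exact Equiv.coe_fn_injective (List.ofFn_injective h)
  · rw [List.mem_toFinset, List.mem_permutations] at hL
    have hlen : L.length = r := by rw [hL.length_eq, List.length_finRange]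
    have hinj : Function.Injective fun i : Fin r => L.get (i.cast hlen.symm) :=
      (List.nodup_iff_injective_get.1 (hL.nodup_iff.2 (List.nodup_finRange _))).comp
        (Fin.cast_injective _)
    refine ⟨Equiv.ofBijective _ (Finite.injective_iff_bijective.1 hinj), Finset.mem_univ _, ?_⟩
    refine List.ext_get (by simp [hlen]) fun n h1 h2 => ?_
    simp

theorem serreDist_apply (X : Option (Fin r) → ℤ → R) (l : Option (Fin r) → ℤ) :
    serreDist q X l =
      serreSum q r (fun i => X (some i) (l (some i))) (X none (l none)) := by
  rw [serreDist, Dist.sum_apply, serreSum, ← sum_perm_eq]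
  refine Finset.sum_congr rfl fun σ _ => ?_
  rw [Dist.sum_apply]
  refine Finset.sum_congr rfl fun k _ => ?_
  rw [Dist.smul_apply, word, serreWord]
  have e : (List.ofFn fun a => X (some (σ a)) (l (some (σ a)))) =
      (List.ofFn σ).map fun i => X (some i) (l (some i)) := by
    rw [List.map_ofFn]; rfl
  rw [e, ← List.map_take, ← List.map_drop]
  simp only [List.map_append, List.map_cons, List.map_map, List.prod_append, List.prod_cons,
    mul_assoc]
  rfl

theorem pairProd_map {V V' O : Type*} [CommRing O] (n : V' → V' → O) (f : V → V') (L : List V) :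
    pairProd n (L.map f) = pairProd (fun a b => n (f a) (f b)) L := by
  induction L with
  | nil => rfl
  | cons a L ih => rw [List.map_cons, pairProd, pairProd, ih, List.map_map]; rfl

/-- The pairs containing `none` give the linear forms: letters before it contribute -w + q^{1-r}z up
to a sign, letters after it q^{1-r}w - z. The signs in `exSigned` absorb the (-1)^k of the Serre
relation, so what remains is a term of `symForms`. -/
theorem pairProd_serreWord (q : K) (L : List (Fin r)) (hL : L.length = r) {k : ℕ} (hk : k ≤ r) :
    (-1) ^ k * pairProd (exSigned q) (serreWord L k) =
      pairProd (fun i j => exSigned q (some i) (some j)) L *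
      evalForms (fun i => zVar (some i)) (List.replicate k (-zVar none,
          algebraMap K (LPoly (Option (Fin r))) (q ^ (1 - (r : ℤ)))) ++
        List.replicate (r - k)
          (algebraMap K (LPoly (Option (Fin r))) (q ^ (1 - (r : ℤ))) * zVar none, -1)) L := by
  have h1 : (L.take k).length = k := by simp [hL, hk]
  have h2 : (L.drop k).length = r - k := by simp [hL]
  rw [serreWord, pairProd_append_cons, ← List.map_append, List.take_append_drop, pairProd_map]
  conv_rhs => rw [← List.take_append_drop k L]
  have hev : ∀ (f : LPoly (Option (Fin r)) × LPoly (Option (Fin r))) (n : ℕ) (L : List (Fin r)),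
      L.length = n → evalForms (fun i => zVar (some i)) (List.replicate n f) L =
        (L.map fun x => f.1 + f.2 * zVar (some x)).prod := by
    rintro f _ L rfl
    exact evalForms_replicate _ f L
  rw [evalForms_append _ (by simp [h1]), hev _ _ _ h1, hev _ _ _ h2, List.take_append_drop,
    List.map_map, List.map_map]
  have e1 : ((L.take k).map ((fun a => exSigned q a none) ∘ some)).prod = (-1) ^ k *
      ((L.take k).map fun x => -zVar none + algebraMap K (LPoly (Option (Fin r)))
        (q ^ (1 - (r : ℤ))) * zVar (some x)).prod := by
    have : ((fun a => exSigned q a none) ∘ some) = fun x : Fin r => (-1) * (-zVar none +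
        algebraMap K (LPoly (Option (Fin r))) (q ^ (1 - (r : ℤ))) * zVar (some x)) := by
      funext x
      simp only [Function.comp, exSigned, sgn, exFactor, dPar, Algebra.smul_def]
      push_cast; ring
    rw [this, List.prod_map_mul, List.map_const', List.prod_replicate, h1]
  have e2 : ((exSigned q none) ∘ some) = fun x : Fin r =>
      algebraMap K (LPoly (Option (Fin r))) (q ^ (1 - (r : ℤ))) * zVar none +
        (-1) * zVar (some x) := by
    funext x
    simp only [Function.comp, exSigned, sgn, exFactor, dPar, Algebra.smul_def]
    push_cast; ring
  rw [e1, e2]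
  have : ((-1 : LPoly (Option (Fin r))) ^ k) * (-1) ^ k = 1 := by
    rw [← mul_pow]; simp
  linear_combination (pairProd (fun i j => exSigned q (some i) (some j)) L *
    ((L.take k).map fun x => -zVar none + algebraMap K (LPoly (Option (Fin r)))
        (q ^ (1 - (r : ℤ))) * zVar (some x)).prod * ((L.drop k).map fun x : Fin r =>
      algebraMap K (LPoly (Option (Fin r))) (q ^ (1 - (r : ℤ))) * zVar none +
        (-1) * zVar (some x)).prod) * this

/-- After multiplication every word is a multiple of the one word `L'`, and the sum of the
coefficients is the left-hand side of `symForms_serre`. -/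
theorem pairProd_smul_serreDist {X : Option (Fin r) → ℤ → R} (hX : Exchange q X)
    (hq : ∀ n : ℤ, n ≠ 0 → q ^ n ≠ 1) (hq0 : q ≠ 0) (hr : 0 < r)
    (L' : List (Option (Fin r))) (hL' : L'.Perm Finset.univ.toList) :
    pairProd (exFactor q zVar) L' • serreDist q X = 0 := by
  obtain ⟨c, hc⟩ := pairProd_exFactor q L'
  rw [hc, mul_smul]
  have key : pairProd (exSigned q) L' • serreDist q X =
      (∑ L ∈ (List.finRange r).permutations.toFinset, ∑ k ∈ Finset.range (r + 1),
        algebraMap K (LPoly (Option (Fin r))) (qBinom q r k) *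
          ((-1) ^ k * pairProd (exSigned q) (serreWord L k))) • word X L' := by
    rw [serreDist, Finset.smul_sum, Finset.sum_smul]
    refine Finset.sum_congr rfl fun L hL => ?_
    rw [List.mem_toFinset, List.mem_permutations] at hL
    rw [Finset.smul_sum, Finset.sum_smul]
    refine Finset.sum_congr rfl fun k _ => ?_
    have hp := serreWord_perm hL k
    have := pairProd_smul_word hX L' [] (serreWord L k) (hp.trans hL'.symm)
      (hp.nodup_iff.2 (Finset.nodup_toList _))
    rw [List.nil_append, List.nil_append] at this
    rw [← Dist.algebraMap_smul, smul_comm, this, smul_smul, map_mul, map_pow, map_neg, map_one]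
    congr 1
    ring
  rw [key, Finset.sum_comm]
  have e : ∑ k ∈ Finset.range (r + 1), ∑ L ∈ (List.finRange r).permutations.toFinset,
        algebraMap K (LPoly (Option (Fin r))) (qBinom q r k) *
          ((-1) ^ k * pairProd (exSigned q) (serreWord L k)) = 0 := by
    rw [← symForms_serre (nb := fun i j => exSigned q (some i) (some j))
      (z := fun i => zVar (some i)) (L₀ := List.finRange r) hq hq0 (List.nodup_finRange r)
      (fun a b hab => ?_) (zVar none) (List.length_finRange) hr]
    · refine Finset.sum_congr rfl fun k hk => ?_
      rw [symForms, Finset.mul_sum]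
      refine Finset.sum_congr rfl fun L hL => ?_
      rw [List.mem_toFinset, List.mem_permutations] at hL
      rw [pairProd_serreWord q L (by rw [hL.length_eq, List.length_finRange])
        (Nat.lt_succ_iff.1 (Finset.mem_range.1 hk))]
    · have hab' : (some a : Option (Fin r)) ≠ some b := fun e => hab (Option.some_injective _ e)
      simp only [exSigned, sgn_swap hab', exFactor, dPar, Algebra.smul_def]
      push_cast; ring
  rw [e, zero_smul, smul_zero]

end Words

/-! ### Degree bounds and the vanishing of mixed Serre terms. -/

section Hahn

variable {T : Type*} [Ring T]

/-- All coefficients below `n` vanish. -/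
def LowerBdd (x : HahnSeries ℤ T) (n : ℤ) : Prop := ∀ k < n, x.coeff k = 0

theorem LowerBdd.mono {x : HahnSeries ℤ T} {m n : ℤ} (h : LowerBdd x n) (hmn : m ≤ n) :
    LowerBdd x m := fun k hk => h k (lt_of_lt_of_le hk hmn)

theorem LowerBdd.add {x y : HahnSeries ℤ T} {n : ℤ} (hx : LowerBdd x n) (hy : LowerBdd y n) :
    LowerBdd (x + y) n := fun k hk => by
  rw [HahnSeries.coeff_add, hx k hk, hy k hk, add_zero]

theorem lowerBdd_zero (n : ℤ) : LowerBdd (0 : HahnSeries ℤ T) n := fun _ _ => rfl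

theorem LowerBdd.sum {ι : Type*} {s : Finset ι} {f : ι → HahnSeries ℤ T} {n : ℤ}
    (h : ∀ a ∈ s, LowerBdd (f a) n) : LowerBdd (∑ a ∈ s, f a) n := by
  classical
  induction s using Finset.induction_on with
  | empty => simpa using lowerBdd_zero n
  | insert a s ha ih =>
    rw [Finset.sum_insert ha]
    exact (h a (Finset.mem_insert_self a s)).add (ih fun b hb => h b (Finset.mem_insert_of_mem hb))

theorem LowerBdd.smul [Algebra K T] {x : HahnSeries ℤ T} {n : ℤ} (hx : LowerBdd x n) (c : K) :
    LowerBdd (c • x) n := fun k hk => by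
  rw [HahnSeries.coeff_smul, hx k hk, smul_zero]

/-- Explicit lower bounds replace the index set of a Hahn product, which depends on the supports, by
an interval of integers that several products can share. -/
theorem coeff_mul_Icc {x y : HahnSeries ℤ T} {m n : ℤ} (hx : LowerBdd x m) (hy : LowerBdd y n)
    (k : ℤ) : (x * y).coeff k = ∑ s ∈ Finset.Icc m (k - n), x.coeff s * y.coeff (k - s) := by
  rw [HahnSeries.coeff_mul]
  refine Finset.sum_of_injOn Prod.fst (fun a ha b hb h => ?_) (fun p hp => ?_) (fun s _ hs => ?_)
    (fun p hp => ?_)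
  · have ha' := (Finset.mem_antidiagonal.1 ha).2.2
    have hb' := (Finset.mem_antidiagonal.1 hb).2.2
    exact Prod.ext h (by omega)
  · obtain ⟨h1, h2, h3⟩ := Finset.mem_antidiagonal.1 hp
    have a1 : m ≤ p.1 := by by_contra hc; exact h1 (hx _ (by omega))
    have a2 : n ≤ p.2 := by by_contra hc; exact h2 (hy _ (by omega))
    simp only [Finset.coe_Icc, Set.mem_Icc]
    omega
  · by_contra hne
    refine hs ⟨(s, k - s), ?_, rfl⟩
    refine Finset.mem_coe.2 (Finset.mem_antidiagonal.2 ⟨fun h => hne ?_, fun h => hne ?_, by simp⟩)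
    · simp [h]
    · simp only at h; simp [h]
  · have := (Finset.mem_antidiagonal.1 hp).2.2
    rw [← this]; simp

theorem LowerBdd.mul {x y : HahnSeries ℤ T} {m n : ℤ} (hx : LowerBdd x m) (hy : LowerBdd y n) :
    LowerBdd (x * y) (m + n) := fun k hk => by
  rw [coeff_mul_Icc hx hy, Finset.Icc_eq_empty (by omega), Finset.sum_empty]

theorem lowerBdd_one : LowerBdd (1 : HahnSeries ℤ T) 0 := fun k hk => by
  rw [HahnSeries.coeff_one, if_neg (by omega)]

theorem lowerBdd_list_prod {V : Type*} (X : V → HahnSeries ℤ T) (n : V → ℤ) (L : List V)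
    (h : ∀ a, LowerBdd (X a) (n a)) : LowerBdd (L.map X).prod (L.map n).sum := by
  induction L with
  | nil => exact lowerBdd_one
  | cons a L ih =>
    rw [List.map_cons, List.prod_cons, List.map_cons, List.sum_cons]
    exact (h a).mul ih

variable [Algebra K T] {r : ℕ} {q : K}

/-- A monomial only shifts the bound by a constant independent of l. The vanishing criterion tests
all multiples of a distribution, so the bound has to survive arbitrary Laurent polynomials. -/
theorem exists_lowerBdd_smul {V : Type*} [Fintype V] [DecidableEq V] (side : V → Bool)
    {F : Dist V (HahnSeries ℤ T)}
    (hF : ∃ c : ℤ, ∀ l, LowerBdd (F l) ((∑ a, if side a then l a else 0) - c)) (p : LPoly V) :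
    ∃ c : ℤ, ∀ l, LowerBdd ((p • F : Dist V (HahnSeries ℤ T)) l)
      ((∑ a, if side a then l a else 0) - c) := by
  induction p using AddMonoidAlgebra.induction_linear with
  | zero => exact ⟨0, fun l => by rw [zero_smul]; exact lowerBdd_zero _⟩
  | add p p' h h' =>
    obtain ⟨c, hc⟩ := h
    obtain ⟨c', hc'⟩ := h'
    refine ⟨max c c', fun l => ?_⟩
    rw [add_smul]
    exact ((hc l).mono (by have := le_max_left c c'; omega)).add
      ((hc' l).mono (by have := le_max_right c c'; omega))
  | single g x =>
    obtain ⟨c, hc⟩ := hF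
    refine ⟨c + ∑ a, if side a then g a else 0, fun l => ?_⟩
    rw [Dist.single_smul]
    refine ((hc (l - g)).smul x).mono (le_of_eq ?_)
    have : (∑ a, if side a then (l - g) a else 0) =
        (∑ a, if side a then l a else 0) - ∑ a, if side a then g a else 0 := by
      rw [← Finset.sum_sub_distrib]
      refine Finset.sum_congr rfl fun a _ => ?_
      split_ifs <;> simp
    rw [this]; ring

/-- If the factor killed F, then F(l) would be a scalar times F(l + e_a - e_b). Since a is counted
in the lower bound and b is not, each iteration raises the bound by one, so every coefficient of F
would vanish. -/
theorem exFactor_smul_ne_zero (hq0 : q ≠ 0) (side : Option (Fin r) → Bool)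
    {F : Dist (Option (Fin r)) (HahnSeries ℤ T)}
    (hF : ∃ c : ℤ, ∀ l, LowerBdd (F l) ((∑ a, if side a then l a else 0) - c))
    {a b : Option (Fin r)} (ha : side a = true) (hb : side b = false) (hne : F ≠ 0) :
    exFactor q zVar a b • F ≠ 0 := by
  intro h0
  obtain ⟨c, hc⟩ := hF
  have hd : dPar q a b ≠ 0 := by
    cases a <;> cases b <;> simp only [dPar] <;>
      first | exact pow_ne_zero _ hq0 | exact zpow_ne_zero _ hq0
  have hstep : ∀ l, F l = (dPar q a b)⁻¹ • F (l + Pi.single a 1 - Pi.single b 1) := by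
    intro l
    have := congrFun h0 (l + Pi.single a 1)
    simp only [exFactor, sub_smul, smul_assoc, Dist.sub_apply, Dist.smul_apply, zVar_smul,
      Dist.zero_apply, add_sub_cancel_right, sub_eq_zero] at this
    rw [← this, smul_smul, inv_mul_cancel₀ hd, one_smul]
  have hab : b ≠ a := by rintro rfl; rw [ha] at hb; cases hb
  refine hne (funext fun l => HahnSeries.ext (funext fun k => ?_))
  have key : ∀ n : ℕ, ∀ l, k < (∑ a, if side a then l a else 0) - c + n → (F l).coeff k = 0 := by
    intro n
    induction n with
    | zero => intro l hl; exact hc l k (by simpa using hl)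
    | succ n ih =>
      intro l hl
      rw [hstep, HahnSeries.coeff_smul, ih, smul_zero]
      have : (∑ x, if side x then (l + Pi.single a 1 - Pi.single b 1 : Option (Fin r) → ℤ) x
          else 0) = (∑ x, if side x then l x else 0) + 1 := by
        have h1 : ∀ x, (if side x then (l + Pi.single a 1 - Pi.single b 1 : Option (Fin r) → ℤ) x
          else 0) = (if side x then l x else 0) + if x = a then 1 else 0 := by
          intro x
          by_cases hxa : x = a
          · subst hxa; simp [ha, Pi.single_eq_of_ne hab.symm]
          · by_cases hxb : x = b
            · subst hxb; simp [hb, hxa]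
            · simp [hxa, hxb]
        rw [Finset.sum_congr rfl fun x _ => h1 x, Finset.sum_add_distrib]
        simp
      rw [this]; push_cast at hl; omega
  obtain ⟨n, hn⟩ : ∃ n : ℕ, k - ((∑ a, if side a then l a else 0) - c) < n :=
    ⟨(k - ((∑ a, if side a then l a else 0) - c) + 1).toNat, by omega⟩
  exact key n l (by omega)

/-- The Serre combination of currents of two kinds vanishes if both kinds occur. -/
theorem serreSum_mixed {X : Option (Fin r) → ℤ → HahnSeries ℤ T} (hX : Exchange q X)
    (hq : ∀ n : ℤ, n ≠ 0 → q ^ n ≠ 1) (hq0 : q ≠ 0) (hr : 0 < r) (side : Option (Fin r) → Bool)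
    (hcount : (Finset.univ.filter fun i : Fin r => side (some i) = side none).card < r)
    (hb : ∀ a n, LowerBdd (X a n) (if side a then n else 0)) (l : Option (Fin r) → ℤ) :
    serreSum q r (fun i => X (some i) (l (some i))) (X none (l none)) = 0 := by
  rw [← serreDist_apply X l]
  have hF : ∃ c : ℤ, ∀ l, LowerBdd (serreDist q X l) ((∑ a, if side a then l a else 0) - c) := by
    refine ⟨0, fun l => ?_⟩
    rw [serreDist, Dist.sum_apply]
    refine LowerBdd.sum fun L hL => ?_
    rw [List.mem_toFinset, List.mem_permutations] at hL
    rw [Dist.sum_apply]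
    refine LowerBdd.sum fun k _ => LowerBdd.smul ?_ _
    have := lowerBdd_list_prod (fun a => X a (l a)) (fun a => if side a then l a else 0)
      (serreWord L k) (fun a => hb a (l a))
    rw [((serreWord_perm hL k).map _).sum_eq, Finset.sum_map_toList] at this
    rwa [sub_zero]
  have := eq_zero_of_orderings (z := zVar) hq hq0 (serreDist q X) isUnit_zVar side
    (fun a b ha hb p hp => exFactor_smul_ne_zero hq0 side (exists_lowerBdd_smul side hF p) ha hb hp)
    hcount (fun L hL => pairProd_smul_serreDist hX hq hq0 hr L hL)
  rw [this]; rfl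

end Hahn

/-! ### Multilinearity of the Serre combination. -/

section Multilinear

variable {r : ℕ} {R : Type*} [Ring R]

theorem exists_prod_update {V : Type*} [DecidableEq V] {L : List V} (hL : L.Nodup) {a : V}
    (ha : a ∈ L) (x : V → R) :
    ∃ u w : R, ∀ y, (L.map (Function.update x a y)).prod = u * y * w := by
  obtain ⟨A, B, rfl⟩ := List.append_of_mem ha
  have h := List.nodup_append.1 hL
  have hA : a ∉ A := fun h' => h.2.2 a h' a List.mem_cons_self rfl
  have hB : a ∉ B := (List.nodup_cons.1 h.2.1).1
  refine ⟨(A.map x).prod, (B.map x).prod, fun y => ?_⟩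
  have e : ∀ L : List V, a ∉ L → L.map (Function.update x a y) = L.map x := fun L h =>
    List.map_congr_left fun b hb => Function.update_of_ne (fun e : b = a => h (e ▸ hb)) _ _
  rw [List.map_append, List.map_cons, e A hA, e B hB, List.prod_append, List.prod_cons,
    Function.update_self, mul_assoc]

variable [Algebra K R]

/-- The Serre combination as a multilinear map. -/
def serreMap (q : K) (r : ℕ) (R : Type*) [Ring R] [Algebra K R] :
    MultilinearMap K (fun _ : Option (Fin r) => R) R where
  toFun x := ∑ L ∈ (List.finRange r).permutations.toFinset, ∑ k ∈ Finset.range (r + 1),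
    ((-1) ^ k * qBinom q r k) • ((serreWord L k).map x).prod
  map_update_add' x a y y' := by
    rw [← Finset.sum_add_distrib]
    refine Finset.sum_congr rfl fun L hL => ?_
    rw [List.mem_toFinset, List.mem_permutations] at hL
    rw [← Finset.sum_add_distrib]
    refine Finset.sum_congr rfl fun k _ => ?_
    obtain ⟨u, w, h⟩ := exists_prod_update
      ((serreWord_perm hL k).nodup_iff.2 (Finset.nodup_toList _))
      ((serreWord_perm hL k).mem_iff.2 (Finset.mem_toList.2 (Finset.mem_univ a))) x
    rw [h, h, h, mul_add, add_mul, smul_add]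
  map_update_smul' x a c y := by
    rw [Finset.smul_sum]
    refine Finset.sum_congr rfl fun L hL => ?_
    rw [List.mem_toFinset, List.mem_permutations] at hL
    rw [Finset.smul_sum]
    refine Finset.sum_congr rfl fun k _ => ?_
    obtain ⟨u, w, h⟩ := exists_prod_update
      ((serreWord_perm hL k).nodup_iff.2 (Finset.nodup_toList _))
      ((serreWord_perm hL k).mem_iff.2 (Finset.mem_toList.2 (Finset.mem_univ a))) x
    rw [h, h, mul_smul_comm, smul_mul_assoc, smul_comm]

theorem serreMap_apply (q : K) (x : Option (Fin r) → R) :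
    serreMap q r R x = ∑ L ∈ (List.finRange r).permutations.toFinset, ∑ k ∈ Finset.range (r + 1),
      ((-1) ^ k * qBinom q r k) • ((serreWord L k).map x).prod := rfl

theorem serreMap_eq (q : K) (x : Option (Fin r) → R) :
    serreMap q r R x = serreSum q r (fun i => x (some i)) (x none) := by
  rw [← serreDist_apply (fun a _ => x a) 0, serreDist, Dist.sum_apply, serreMap_apply]
  refine Finset.sum_congr rfl fun L _ => ?_
  rw [Dist.sum_apply]
  rfl

end Multilinear

section

variable {N : ℕ} (C : CartanDatum N)

/-! ### The currents of the coproduct -/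

theorem tmul_mul_zero (a : U C) {b : U C} (hb : IsHom C 0 b) (x y : U C) :
    tmul C a b * tmul C x y = tmul C (a * x) (b * y) := by
  rw [tmul_mul_tmul_of_isHom C a hb, tau_zero]

theorem tmul_mul_theta (a b : U C) {x : U C} (hx : IsHom C 0 x) {β : Fin N → ℤ} (hb : IsHom C β b)
    (y : U C) : tmul C a b * tmul C x y = tmul C (a * x) (b * y) := by
  rw [tmul_mul_tmul_of_isHom C a hb, hx.tau, form_zero_right]; simp

theorem smul_single (c : K) (n : ℤ) (x : Tw C) :
    c • (HahnSeries.single n x : CTw C) = HahnSeries.single n (c • x) :=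
  (map_smul (HahnSeries.single.linearMap (R := K) (V := Tw C) n) c x).symm

/-- The summand `E_{i,n} ⊗ 1` of `Δ(E_{i,n})`. -/
def curA (i : Fin N) (n : ℤ) : CTw C := HahnSeries.single n (tmul C (E C i n) 1)

/-- The summand `∑_t θ_{i,t} ⊗ E_{i,n-t}` of `Δ(E_{i,n})`. -/
def curB (i : Fin N) (n : ℤ) : CTw C :=
  HahnSeries.ofSuppBddBelow (fun t => tmul C (thetaZ C i t) (E C i (n - t))) ⟨0, fun t ht => by
    by_contra h
    exact ht (by simp only [thetaZ_of_neg C i (not_le.1 h), zero_tmul])⟩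

theorem coeff_curB (i : Fin N) (n t : ℤ) :
    (curB C i n).coeff t = tmul C (thetaZ C i t) (E C i (n - t)) := by
  rfl

theorem lowerBdd_curA (i : Fin N) (n : ℤ) : LowerBdd (curA C i n) n := fun k hk =>
  HahnSeries.coeff_single_of_ne (by omega)

theorem lowerBdd_curB (i : Fin N) (n : ℤ) : LowerBdd (curB C i n) 0 := fun k hk => by
  rw [coeff_curB, thetaZ_of_neg C i hk, zero_tmul]

/-- The exchange relation between two currents. -/
def ExRel {R : Type*} [Ring R] [Algebra K R] (d : K) (X Y : ℤ → R) : Prop :=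
  ∀ m n, d • (X m * Y (n - 1)) - Y (n - 1) * X m = X (m - 1) * Y n - d • (Y n * X (m - 1))

theorem ExRel.symm {R : Type*} [Ring R] [Algebra K R] {d : K} {X Y : ℤ → R} (h : ExRel d X Y) :
    ExRel d Y X := fun m n => by
  have := h n m
  rw [sub_eq_iff_eq_add] at this
  rw [this]; abel

theorem exRel_E (i j : Fin N) : ExRel (v ^ C.b i j) (E C i) (E C j) := fun m n => by
  have := E_quadratic C i j (m - 1) (n - 1)
  simpa only [sub_add_cancel] using this

theorem exRel_curA (i j : Fin N) : ExRel (v ^ C.b i j) (curA C i) (curA C j) := fun m n => by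
  simp only [curA, HahnSeries.single_mul_single, tmul_mul_tmul_of_isHom C _ (isHom_one C),
    tau_zero, mul_one, smul_single, ← smul_tmul]
  rw [show n - 1 + m = m + (n - 1) by ring, show m - 1 + n = m + (n - 1) by ring,
    show n + (m - 1) = m + (n - 1) by ring, ← HahnSeries.single_sub, ← HahnSeries.single_sub]
  congr 1
  have := exRel_E C i j m n
  have h2 : ∀ x y : U C, tmul C x 1 - tmul C y 1 = tmul C (x - y) 1 := fun x y =>
    (TensorProduct.sub_tmul x y 1).symm
  rw [h2, h2, this]

theorem curB_mul_curB (i j : Fin N) (m n k : ℤ) : (curB C i m * curB C j n).coeff k =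
    ∑ s ∈ Finset.Icc 0 k, tmul C (thetaZ C i s * thetaZ C j (k - s))
      (E C i (m - s) * E C j (n - (k - s))) := by
  rw [coeff_mul_Icc (lowerBdd_curB C i m) (lowerBdd_curB C j n), sub_zero]
  refine Finset.sum_congr rfl fun s _ => ?_
  rw [coeff_curB, coeff_curB, tmul_mul_theta C _ _ (isHom_thetaZ C j _) (isHom_E C i _)]

theorem thetaZ_commute (i j : Fin N) (s t : ℤ) : Commute (thetaZ C i s) (thetaZ C j t) := by
  unfold thetaZ
  split_ifs
  · exact theta_commute_theta C i j _ _
  · exact Commute.zero_right _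
  · exact Commute.zero_left _
  · exact Commute.zero_left _

theorem sum_Icc_reflect {A : Type*} [AddCommMonoid A] (f : ℤ → A) (k : ℤ) :
    ∑ s ∈ Finset.Icc 0 k, f (k - s) = ∑ s ∈ Finset.Icc 0 k, f s := by
  refine Finset.sum_nbij' (fun s => k - s) (fun s => k - s) ?_ ?_ ?_ ?_ ?_ <;>
    simp only [Finset.mem_Icc] <;> intros <;> first | trivial | omega

/-- For each splitting of the degree of the first factor between the two θ's, these commute and can
be put in a fixed order. The relation is then that of the E in the second factor. -/
theorem exRel_curB (i j : Fin N) : ExRel (v ^ C.b i j) (curB C i) (curB C j) := fun m n => by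
  have hrev : ∀ m n k, (curB C j n * curB C i m).coeff k =
      ∑ s ∈ Finset.Icc 0 k, tmul C (thetaZ C i s * thetaZ C j (k - s))
        (E C j (n - (k - s)) * E C i (m - s)) := by
    intro m n k
    rw [curB_mul_curB, ← sum_Icc_reflect]
    refine Finset.sum_congr rfl fun s _ => ?_
    rw [sub_sub_cancel, (thetaZ_commute C i j s (k - s)).eq]
  ext k
  rw [HahnSeries.coeff_sub, HahnSeries.coeff_sub, HahnSeries.coeff_smul, HahnSeries.coeff_smul,
    hrev, hrev, curB_mul_curB C i j, curB_mul_curB C i j, Finset.smul_sum, Finset.smul_sum,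
    ← Finset.sum_sub_distrib, ← Finset.sum_sub_distrib]
  refine Finset.sum_congr rfl fun s _ => ?_
  have h2 : ∀ z x y : U C, tmul C z x - tmul C z y = tmul C z (x - y) := fun z x y =>
    (TensorProduct.tmul_sub z x y).symm
  rw [← tmul_smul, ← tmul_smul, h2, h2]
  have := exRel_E C i j (m - s) (n - (k - s))
  rw [show m - s - 1 = m - 1 - s by ring, show n - (k - s) - 1 = n - 1 - (k - s) by ring] at this
  rw [this]

theorem curB_mul_curA (i j : Fin N) (m n k : ℤ) : (curB C i m * curA C j n).coeff k =
    pq C i j • tmul C (thetaZ C i (k - n) * E C j n) (E C i (m - (k - n))) := by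
  rw [curA, HahnSeries.coeff_mul_single, coeff_curB, tmul_mul_tmul_of_isHom C _ (isHom_E C i _),
    tau_E, form_root, mul_smul_comm, smul_tmul, mul_one]; rfl

theorem curA_mul_curB (i j : Fin N) (m n k : ℤ) : (curA C j n * curB C i m).coeff k =
    tmul C (E C j n * thetaZ C i (k - n)) (E C i (m - (k - n))) := by
  rw [curA, HahnSeries.coeff_single_mul, coeff_curB, tmul_mul_zero C _ (isHom_one C), one_mul]

/-- In B A, moving E_i of the second factor past E_j of the first produces v^{-b_ij}, which cancels
the parameter v^{b_ij} of the exchange relation. What is left in the first factor is `thetaZ_mul_E`.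
-/
theorem exRel_curB_curA (i j : Fin N) : ExRel (v ^ C.b i j) (curB C i) (curA C j) := fun m n => by
  ext k
  rw [HahnSeries.coeff_sub, HahnSeries.coeff_sub, HahnSeries.coeff_smul, HahnSeries.coeff_smul,
    curB_mul_curA, curB_mul_curA, curA_mul_curB, curA_mul_curB]
  rw [show m - (k - (n - 1)) = m - 1 - (k - n) by ring, smul_smul,
    show v ^ C.b i j * pq C i j = 1 by rw [pq, ← zpow_add₀ v_ne_zero]; simp, one_smul,
    ← smul_tmul, ← smul_tmul]
  have h2 : ∀ z x y : U C, tmul C x z - tmul C y z = tmul C (x - y) z := fun z x y =>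
    (TensorProduct.sub_tmul x y z).symm
  rw [h2, h2]
  congr 1
  have := thetaZ_mul_E C i j (k - (n - 1)) (n - 1)
  rw [sub_add_cancel, show k - (n - 1) - 1 = k - n by ring,
    show (pq C i j)⁻¹ = v ^ C.b i j by rw [pq, zpow_neg, inv_inv], sub_eq_iff_eq_add] at this
  rw [this]; abel

/-! ### The loop Serre relations for the coproduct -/

section Serre

variable {r : ℕ}

/-- The letter `j` for `none`, and `i` otherwise. -/
def letter (i j : Fin N) : Option (Fin r) → Fin N
  | none => j
  | some _ => i

theorem serreMap_curA (i j : Fin N) (q : K) (l : Option (Fin r) → ℤ) :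
    serreMap q r (CTw C) (fun a => curA C (letter i j a) (l a)) = HahnSeries.single (∑ a, l a)
      (tmul C (serreMap q r (U C) fun a => E C (letter i j a) (l a)) 1) := by
  have key : ∀ L : List (Option (Fin r)), (L.map fun a => curA C (letter i j a) (l a)).prod =
      HahnSeries.single (L.map l).sum
        (tmul C (L.map fun a => E C (letter i j a) (l a)).prod 1) := by
    intro L
    induction L with
    | nil => rfl
    | cons a L ih =>
      rw [List.map_cons, List.prod_cons, ih, curA, HahnSeries.single_mul_single,
        tmul_mul_zero C _ (isHom_one C), mul_one, List.map_cons, List.sum_cons, List.map_cons,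
        List.prod_cons]
  let S : U C →ₗ[K] CTw C :=
    { toFun := fun x => HahnSeries.single (∑ a, l a) (tmul C x 1)
      map_add' := fun x y => by rw [add_tmul, HahnSeries.single_add]
      map_smul' := fun c x => by rw [smul_tmul, ← smul_single]; rfl }
  have hS : ∀ x, HahnSeries.single (∑ a, l a) (tmul C x 1) = S x := fun _ => rfl
  rw [hS, serreMap_apply, serreMap_apply, map_sum]
  refine Finset.sum_congr rfl fun L hL => ?_
  rw [List.mem_toFinset, List.mem_permutations] at hL
  rw [map_sum]
  refine Finset.sum_congr rfl fun k _ => ?_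
  rw [map_smul, ← hS, key, ((serreWord_perm hL k).map l).sum_eq, Finset.sum_map_toList]

/-- The θ's have weight zero, so no twist appears and the first tensor factors collect into a
product of θ's, separate from the product of E's. -/
theorem coeff_prod_curB {V : Type*} [DecidableEq V] (f : V → Fin N) (l : V → ℤ) (L : List V)
    (hL : L.Nodup) (k : ℕ) :
    (L.map fun a => curB C (f a) (l a)).prod.coeff k =
      ∑ t ∈ Finset.piAntidiag L.toFinset k,
        tmul C (L.map fun a => theta C (f a) (t a)).prod
          (L.map fun a => E C (f a) (l a - t a)).prod := by
  induction L generalizing k with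
  | nil =>
    rw [List.map_nil, List.prod_nil, HahnSeries.coeff_one, List.toFinset_nil,
      Finset.piAntidiag_empty]
    rcases Nat.eq_zero_or_pos k with rfl | hk
    · simp [Tw_one]
    · rw [if_neg (by exact_mod_cast hk.ne'), if_neg hk.ne', Finset.sum_empty]
  | cons a L ih =>
    obtain ⟨ha, hL⟩ := List.nodup_cons.1 hL
    have ha' : a ∉ L.toFinset := by simpa using ha
    have hb : LowerBdd (L.map fun a => curB C (f a) (l a)).prod 0 := by
      have := lowerBdd_list_prod (fun a => curB C (f a) (l a)) (fun _ => 0) L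
        (fun a => lowerBdd_curB C (f a) (l a))
      simpa using this
    rw [List.map_cons, List.prod_cons, coeff_mul_Icc (lowerBdd_curB C _ _) hb, sub_zero]
    have e : (a :: L).toFinset = Finset.cons a L.toFinset ha' := by
      rw [List.toFinset_cons, Finset.cons_eq_insert]
    rw [e, Finset.piAntidiag_cons, Finset.sum_disjiUnion]
    symm
    refine Finset.sum_bij (fun p _ => (p.1 : ℤ)) (fun p hp => ?_) (fun p hp p' hp' h => ?_)
      (fun s hs => ?_) (fun p hp => ?_)
    · rw [mem_antidiagonal] at hp
      rw [Finset.mem_Icc]; omega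
    · rw [mem_antidiagonal] at hp hp'
      have : p.1 = p'.1 := by exact_mod_cast h
      exact Prod.ext this (by omega)
    · rw [Finset.mem_Icc] at hs
      exact ⟨(s.toNat, k - s.toNat), by rw [mem_antidiagonal]; omega, by
        simp only [Int.ofNat_toNat]; omega⟩
    · rw [mem_antidiagonal] at hp
      rw [show (k : ℤ) - p.1 = (p.2 : ℕ) by omega, ih hL, Finset.mul_sum, Finset.sum_map]
      refine Finset.sum_congr rfl fun t ht => ?_
      have h0 : t a = 0 := by
        by_contra h
        exact ha' ((Finset.mem_piAntidiag.1 ht).2 a h)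
      have hne : ∀ b ∈ L, b ≠ a := fun b hb e => ha (e ▸ hb)
      rw [coeff_curB, thetaZ_natCast]
      have hh : IsHom C (root (f a)) (E C (f a) (l a - p.1)) := isHom_E C _ _
      have ht0 : IsHom C 0 (L.map fun a => theta C (f a) (t a)).prod := by
        clear * -
        induction L with
        | nil => exact isHom_one C
        | cons b L ih =>
          rw [List.map_cons, List.prod_cons]
          simpa using (isHom_theta C (f b) (t b)).mul ih
      rw [tmul_mul_theta C _ _ ht0 hh]
      simp only [addRightEmbedding_apply, List.map_cons, List.prod_cons, Pi.add_apply, if_true, h0,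
        zero_add]
      congr 2
      · refine congrArg List.prod (List.map_congr_left fun b hb => ?_)
        rw [if_neg (hne b hb), add_zero]
      · refine congrArg List.prod (List.map_congr_left fun b hb => ?_)
        rw [if_neg (hne b hb), add_zero]

/-- For a fixed distribution t of the degree, the first tensor factor does not depend on the
ordering because the θ's commute; the second factors add up to the Serre combination with the
indices shifted to l - t. -/
theorem serreMap_curB (i j : Fin N) (q : K)
    (h : ∀ l : Option (Fin r) → ℤ, serreMap q r (U C) (fun a => E C (letter i j a) (l a)) = 0)
    (l : Option (Fin r) → ℤ) :
    serreMap q r (CTw C) (fun a => curB C (letter i j a) (l a)) = 0 := by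
  ext k
  have hk : k < 0 ∨ 0 ≤ k := lt_or_ge k 0
  have hsum : ∀ {ι : Type} (s : Finset ι) (g : ι → CTw C) (k : ℤ),
      (∑ a ∈ s, g a).coeff k = ∑ a ∈ s, (g a).coeff k := fun s g k =>
    map_sum (HahnSeries.coeff.addMonoidHom k) g s
  rw [serreMap_apply, hsum, HahnSeries.coeff_zero]
  rcases hk with hk | hk
  · refine Finset.sum_eq_zero fun L _ => ?_
    rw [hsum]
    refine Finset.sum_eq_zero fun m _ => ?_
    have := lowerBdd_list_prod (fun a => curB C (letter i j a) (l a)) (fun _ => 0) (serreWord L m)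
        (fun a => lowerBdd_curB C (letter i j a) (l a))
    rw [HahnSeries.coeff_smul, this k (by simpa using hk), smul_zero]
  · lift k to ℕ using hk
    have key : ∀ L ∈ (List.finRange r).permutations.toFinset, ∀ m,
        ((serreWord L m).map fun a => curB C (letter i j a) (l a)).prod.coeff (k : ℤ) =
        ∑ t ∈ Finset.piAntidiag (Finset.univ : Finset (Option (Fin r))) k,
          tmul C (Finset.univ.toList.map fun a => theta C (letter i j a) (t a)).prod
            ((serreWord L m).map fun a => E C (letter i j a) (l a - t a)).prod := by
      intro L hL m
      rw [List.mem_toFinset, List.mem_permutations] at hL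
      have hp := serreWord_perm hL m
      rw [coeff_prod_curB C (letter i j) l (serreWord L m)
        (hp.nodup_iff.2 (Finset.nodup_toList _)), List.toFinset_eq_of_perm _ _ hp,
        Finset.toList_toFinset]
      refine Finset.sum_congr rfl fun t _ => ?_
      congr 1
      refine (hp.map _).prod_eq' (List.pairwise_map.2 (List.pairwise_of_forall fun a b => ?_))
      exact theta_commute_theta C _ _ _ _
    have : ∀ L ∈ (List.finRange r).permutations.toFinset,
        (∑ m ∈ Finset.range (r + 1), ((-1) ^ m * qBinom q r m) •
          ((serreWord L m).map fun a => curB C (letter i j a) (l a)).prod).coeff (k : ℤ) =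
        ∑ m ∈ Finset.range (r + 1),
        ∑ t ∈ Finset.piAntidiag (Finset.univ : Finset (Option (Fin r))) k,
          tmul C (Finset.univ.toList.map fun a => theta C (letter i j a) (t a)).prod
            (((-1) ^ m * qBinom q r m) •
              ((serreWord L m).map fun a => E C (letter i j a) (l a - t a)).prod) := by
      intro L hL
      rw [hsum]
      refine Finset.sum_congr rfl fun m _ => ?_
      rw [HahnSeries.coeff_smul, key L hL m, Finset.smul_sum]
      refine Finset.sum_congr rfl fun t _ => ?_
      rw [tmul_smul]
    rw [Finset.sum_congr rfl this]
    have : ∀ L ∈ (List.finRange r).permutations.toFinset, (∑ m ∈ Finset.range (r + 1),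
        ∑ t ∈ Finset.piAntidiag (Finset.univ : Finset (Option (Fin r))) k,
          tmul C (Finset.univ.toList.map fun a => theta C (letter i j a) (t a)).prod
            (((-1) ^ m * qBinom q r m) •
              ((serreWord L m).map fun a => E C (letter i j a) (l a - t a)).prod)) =
        ∑ t ∈ Finset.piAntidiag (Finset.univ : Finset (Option (Fin r))) k,
          tmul C (Finset.univ.toList.map fun a => theta C (letter i j a) (t a)).prod
          (∑ m ∈ Finset.range (r + 1), (((-1) ^ m * qBinom q r m) •
              ((serreWord L m).map fun a => E C (letter i j a) (l a - t a)).prod)) := by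
      intro L _
      rw [Finset.sum_comm]
      exact Finset.sum_congr rfl fun t _ => (tmul_sum C _ _ _).symm
    rw [Finset.sum_congr rfl this, Finset.sum_comm]
    refine Finset.sum_eq_zero fun t _ => ?_
    rw [← tmul_sum, ← serreMap_apply, h fun a => l a - t a, tmul_zero]

/-- The expansion runs over the sets s of letters that choose `curA`. Full and empty s reduce to the
Serre relation of `U`; every other s is a mixed term, handled by `serreSum_mixed`. -/
theorem serreMap_cur (i j : Fin N) (hij : i ≠ j) (l : Option (Fin (1 - C.a i j).toNat) → ℤ) :
    serreMap (v ^ C.r i) (1 - C.a i j).toNat (CTw C)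
      (fun a => curA C (letter i j a) (l a) + curB C (letter i j a) (l a)) = 0 := by
  have ha := C.offDiag i j hij
  have hr1 : (((1 - C.a i j).toNat : ℕ) : ℤ) = 1 - C.a i j := by omega
  have hr : 0 < (1 - C.a i j).toNat := by omega
  have hE : ∀ l : Option (Fin (1 - C.a i j).toNat) → ℤ, serreMap (v ^ C.r i) (1 - C.a i j).toNat
      (U C) (fun a => E C (letter i j a) (l a)) = 0 := by
    intro l
    rw [serreMap_eq]
    exact E_serre C i j hij (fun a => l (some a)) (l none)
  have hq0 : v ^ C.r i ≠ 0 := pow_ne_zero _ v_ne_zero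
  have hq : ∀ n : ℤ, n ≠ 0 → (v ^ C.r i) ^ n ≠ 1 := by
    intro n hn
    rw [← zpow_natCast, ← zpow_mul]
    exact v_zpow_ne_one (mul_ne_zero (by exact_mod_cast (C.r_pos i).ne') hn)
  -- The parameters agree because v_i^{1-r} = v_i^{a_ij} = v^{b_ij} and v_i² = v^{b_ii}.
  have hd : ∀ a b : Option (Fin (1 - C.a i j).toNat), a ≠ b →
      dPar (v ^ C.r i) a b = v ^ C.b (letter i j a) (letter i j b) := by
    have h2 : (v ^ C.r i) ^ (1 - (((1 - C.a i j).toNat : ℕ) : ℤ)) = v ^ C.b i j := by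
      rw [hr1, ← zpow_natCast, ← zpow_mul, CartanDatum.b]
      congr 1; ring
    intro a b hab
    cases a with
    | none => cases b with
      | none => exact absurd rfl hab
      | some b => exact h2.trans (by rw [b_symm]; rfl)
    | some a => cases b with
      | none => exact h2
      | some b =>
        change (v ^ C.r i) ^ 2 = v ^ C.b i i
        rw [CartanDatum.b, C.diag, zpow_mul, zpow_natCast]; rfl
  have hsplit := (serreMap (v ^ C.r i) (1 - C.a i j).toNat (CTw C)).map_add_univ
    (fun a => curA C (letter i j a) (l a)) (fun a => curB C (letter i j a) (l a))
  refine Eq.trans hsplit (Finset.sum_eq_zero fun s _ => ?_)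
  by_cases hs1 : s = Finset.univ
  · subst hs1
    rw [Finset.piecewise_univ, serreMap_curA, hE, zero_tmul, HahnSeries.single_eq_zero]
  by_cases hs2 : s = ∅
  · subst hs2
    rw [Finset.piecewise_empty]
    exact serreMap_curB C i j _ hE l
  let X : Option (Fin (1 - C.a i j).toNat) → ℤ → CTw C := fun a =>
    if a ∈ s then curA C (letter i j a) else curB C (letter i j a)
  have hpw : s.piecewise (fun a => curA C (letter i j a) (l a))
      (fun a => curB C (letter i j a) (l a)) = fun a => X a (l a) := by
    funext a
    simp only [Finset.piecewise, X]
    split_ifs <;> rfl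
  rw [hpw, serreMap_eq]
  refine serreSum_mixed (X := X) ?_ hq hq0 hr (fun a => decide (a ∈ s)) ?_ ?_ l
  · intro a b hab m n
    rw [hd a b hab]
    simp only [X]
    split_ifs
    · exact exRel_curA C _ _ m n
    · rw [b_symm]
      exact (exRel_curB_curA C _ _).symm m n
    · exact exRel_curB_curA C _ _ m n
    · exact exRel_curB C _ _ m n
  -- If the count were r, all copies of i would lie on the side of j, so s would be full or empty.
  · by_contra hcard
    have hfull : (Finset.univ.filter fun i' : Fin (1 - C.a i j).toNat =>
        decide ((some i' : Option (Fin (1 - C.a i j).toNat)) ∈ s) = decide (none ∈ s)) =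
        Finset.univ := by
      refine Finset.eq_univ_of_card _ (le_antisymm (Finset.card_le_univ _) ?_)
      rw [Fintype.card_fin]
      exact not_lt.1 hcard
    have hall : ∀ i' : Fin (1 - C.a i j).toNat, (some i' ∈ s ↔ none ∈ s) := by
      intro i'
      have := Finset.mem_univ i'
      rw [← hfull] at this
      simpa using this
    by_cases hn : none ∈ s
    · refine hs1 (Finset.eq_univ_of_forall fun a => ?_)
      cases a with
      | none => exact hn
      | some i' => exact (hall i').2 hn
    · refine hs2 (Finset.eq_empty_of_forall_notMem fun a => ?_)
      cases a with
      | none => exact hn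
      | some i' => exact fun h => hn ((hall i').1 h)
  · intro a n
    by_cases ha : a ∈ s
    · simp only [X, ha, if_true, decide_true]
      exact lowerBdd_curA C _ n
    · simp only [X, ha, if_false, decide_false]
      exact lowerBdd_curB C _ n

end Serre

end

section

variable {N : ℕ} (C : CartanDatum N)

/-! ### The coproduct -/

theorem CTw_smul_mul (c : K) (x y : CTw C) : (c • x) * y = c • (x * y) :=
  Algebra.smul_mul_assoc c x y

theorem CTw_mul_smul (c : K) (x y : CTw C) : x * (c • y) = c • (x * y) :=
  Algebra.mul_smul_comm c x y

theorem CTw_single_sum {ι : Type*} (s : Finset ι) (n : ℤ) (f : ι → Tw C) :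
    (HahnSeries.single n (∑ a ∈ s, f a) : CTw C) = ∑ a ∈ s, HahnSeries.single n (f a) :=
  map_sum (HahnSeries.single.addMonoidHom n) f s

/-- The images of the generators under the coproduct. -/
def deltaGen : Gen N → CTw C
  | Gen.E i n => curA C i n + curB C i n
  | Gen.H i s => HahnSeries.single (s : ℤ) (tmul C (H C i s) 1) +
      HahnSeries.single 0 (tmul C 1 (H C i s))

theorem delta_rel : ∀ x y, Rel C x y →
    FreeAlgebra.lift K (deltaGen C) x = FreeAlgebra.lift K (deltaGen C) y := by
  refine lift_rel C (fun i n => deltaGen C (Gen.E i n)) (fun i s => deltaGen C (Gen.H i s))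
    (deltaGen C) (fun _ _ => rfl) (fun _ _ => rfl) (fun i j s t => ?_) (fun i j s l => ?_)
    (fun i j l m => ?_) (fun i j hij l l' => ?_)
  · simp only [deltaGen, mul_add, add_mul, HahnSeries.single_mul_single,
      tmul_mul_zero C _ (isHom_one C), tmul_mul_zero C _ (isHom_H C _ _), mul_one, one_mul,
      H_mul_H C i j, add_zero, zero_add, add_comm (s : ℤ)]
    abel
  · have hA : HahnSeries.single (s : ℤ) (tmul C (H C i s) 1) * curA C j l =
        curA C j l * HahnSeries.single (s : ℤ) (tmul C (H C i s) 1) +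
          (qInt v ((s : ℤ) * C.b i j) / ((s : ℕ) : K)) • curA C j (s + l) := by
      simp only [curA, HahnSeries.single_mul_single, tmul_mul_zero C _ (isHom_one C), mul_one,
        H_mul_E, add_tmul, smul_tmul, HahnSeries.single_add, smul_single, add_comm (l : ℤ)]
    have hA' : HahnSeries.single 0 (tmul C 1 (H C i s)) * curA C j l =
        curA C j l * HahnSeries.single 0 (tmul C 1 (H C i s)) := by
      simp only [curA, HahnSeries.single_mul_single, tmul_mul_zero C _ (isHom_one C), mul_one,
        one_mul, tmul_mul_zero C _ (isHom_H C _ _), zero_add, add_zero]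
    have hB : HahnSeries.single (s : ℤ) (tmul C (H C i s) 1) * curB C j l =
        curB C j l * HahnSeries.single (s : ℤ) (tmul C (H C i s) 1) := by
      ext k
      rw [HahnSeries.coeff_single_mul, HahnSeries.coeff_mul_single, coeff_curB,
        tmul_mul_zero C _ (isHom_one C), tmul_mul_theta C _ _ (isHom_H C i s) (isHom_E C j _),
        one_mul, mul_one]
      congr 1
      unfold thetaZ
      split_ifs
      · exact H_commute_theta C i j s _
      · simp
    have hB' : HahnSeries.single 0 (tmul C 1 (H C i s)) * curB C j l =
        curB C j l * HahnSeries.single 0 (tmul C 1 (H C i s)) +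
          (qInt v ((s : ℤ) * C.b i j) / ((s : ℕ) : K)) • curB C j (s + l) := by
      ext k
      rw [HahnSeries.coeff_single_mul, HahnSeries.coeff_add, HahnSeries.coeff_mul_single,
        HahnSeries.coeff_smul, coeff_curB, coeff_curB, sub_zero,
        tmul_mul_zero C _ (isHom_H C i s), tmul_mul_theta C _ _ (isHom_one C) (isHom_E C j _),
        one_mul, mul_one, H_mul_E, tmul_add, tmul_smul, add_sub_assoc]
    simp only [deltaGen, mul_add, add_mul, hA, hA', hB, hB', smul_add]
    abel
  · have hAA := exRel_curA C i j (l + 1) (m + 1)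
    have hBB := exRel_curB C i j (l + 1) (m + 1)
    have hBA := exRel_curB_curA C i j (l + 1) (m + 1)
    have hAB := (exRel_curB_curA C j i).symm (l + 1) (m + 1)
    rw [b_symm C j i] at hAB
    simp only [add_sub_cancel_right] at hAA hBB hBA hAB
    simp only [deltaGen, mul_add, add_mul, smul_add]
    rw [sub_eq_iff_eq_add] at hAA hBB hBA hAB
    rw [hAA, hBB, hBA, hAB]
    abel
  · have := serreMap_cur C i j hij fun a => a.elim l' l
    rw [serreMap_eq] at this
    exact this

/-- The coproduct, as a homomorphism of algebras. -/
def deltaHom : U C →ₐ[K] CTw C := lift C (deltaGen C) (delta_rel C)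

theorem deltaHom_E (i : Fin N) (n : ℤ) : deltaHom C (E C i n) = curA C i n + curB C i n :=
  lift_gen C (deltaGen C) (delta_rel C) (Gen.E i n)

theorem deltaHom_H (i : Fin N) (s : ℕ+) : deltaHom C (H C i s) =
    HahnSeries.single (s : ℤ) (tmul C (H C i s) 1) + HahnSeries.single 0 (tmul C 1 (H C i s)) :=
  lift_gen C (deltaGen C) (delta_rel C) (Gen.H i s)

theorem deltaHom_hCoeff (i : Fin N) (s : ℕ) : deltaHom C (hCoeff C i s) =
    HahnSeries.single (s : ℤ) (tmul C (hCoeff C i s) 1) +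
      HahnSeries.single 0 (tmul C 1 (hCoeff C i s)) := by
  rcases Nat.eq_zero_or_pos s with rfl | hs
  · simp [hCoeff_zero, zero_tmul, tmul_zero]
  · lift s to ℕ+ using hs
    rw [hCoeff_pos, map_smul, deltaHom_H, smul_add, smul_single, smul_single, smul_tmul, tmul_smul]

/-- H is primitive, so Δ'(θ(z)) and (θ ⊗ 1)(1 ⊗ θ) satisfy the same Euler equation with constant
term 1. The product rule applies since elements of the form x ⊗ 1 and 1 ⊗ y commute when y has
weight zero. -/
theorem deltaHom_theta (i : Fin N) (m : ℕ) : deltaHom C (theta C i m) =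
    ∑ p ∈ antidiagonal m,
      HahnSeries.single (p.1 : ℤ) (tmul C (theta C i p.1) (theta C i p.2)) := by
  let P : PowerSeries (CTw C) :=
    PowerSeries.mk fun m => HahnSeries.single (m : ℤ) (tmul C (theta C i m) 1)
  let Q : PowerSeries (CTw C) :=
    PowerSeries.mk fun m => HahnSeries.single (0 : ℤ) (tmul C 1 (theta C i m))
  let P' : PowerSeries (CTw C) :=
    PowerSeries.mk fun m => (m : K) • HahnSeries.single (m : ℤ) (tmul C (hCoeff C i m) 1)
  let Q' : PowerSeries (CTw C) :=
    PowerSeries.mk fun m => (m : K) • HahnSeries.single (0 : ℤ) (tmul C 1 (hCoeff C i m))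
  let F : PowerSeries (CTw C) := PowerSeries.mk fun m => deltaHom C (theta C i m)
  have hP : eulerD P = P' * P := by
    ext1 m
    rw [coeff_eulerD, PowerSeries.coeff_mul]
    simp only [P, P', PowerSeries.coeff_mk]
    rw [smul_single, ← smul_tmul, theta_rec, sum_tmul]
    rw [CTw_single_sum]
    refine Finset.sum_congr rfl fun p hp => ?_
    rw [mem_antidiagonal] at hp
    rw [smul_single, HahnSeries.single_mul_single, Tw_smul_mul, tmul_mul_zero C _ (isHom_one C),
      mul_one, ← hp, smul_tmul]
    push_cast
    rfl
  have hQ : eulerD Q = Q' * Q := by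
    ext1 m
    rw [coeff_eulerD, PowerSeries.coeff_mul]
    simp only [Q, Q', PowerSeries.coeff_mk]
    rw [smul_single, ← tmul_smul, theta_rec, tmul_sum]
    rw [CTw_single_sum]
    refine Finset.sum_congr rfl fun p hp => ?_
    rw [smul_single, HahnSeries.single_mul_single, Tw_smul_mul,
      tmul_mul_zero C _ (isHom_hCoeff C i _), mul_one, tmul_smul]
    rfl
  have hPQ : P * Q' = Q' * P := by
    ext1 m
    rw [PowerSeries.coeff_mul, PowerSeries.coeff_mul, ← Finset.Nat.sum_antidiagonal_swap]
    refine Finset.sum_congr rfl fun p _ => ?_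
    simp only [P, Q', PowerSeries.coeff_mk, Prod.fst_swap, Prod.snd_swap]
    rw [CTw_mul_smul, CTw_smul_mul, HahnSeries.single_mul_single, HahnSeries.single_mul_single,
      tmul_mul_zero C _ (isHom_one C), tmul_mul_zero C _ (isHom_hCoeff C i _), add_comm]
    simp
  have hF : eulerD F = (P' + Q') * F := by
    ext1 m
    rw [coeff_eulerD, PowerSeries.coeff_mul]
    simp only [F, PowerSeries.coeff_mk]
    rw [← map_smul, theta_rec, map_sum]
    refine Finset.sum_congr rfl fun p hp => ?_
    rw [map_smul, map_mul, deltaHom_hCoeff, ← CTw_smul_mul, smul_add]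
    simp only [P', Q', map_add, PowerSeries.coeff_mk]
  have hPQF : eulerD (P * Q) = (P' + Q') * (P * Q) := by
    rw [eulerD_mul, hP, hQ, ← mul_assoc P, hPQ]
    simp only [mul_assoc, add_mul]
  have h0 : PowerSeries.coeff 0 (P' + Q') = 0 := by
    simp [P', Q']
  have := eulerD_unique h0 hF hPQF (by
    rw [PowerSeries.coeff_mul]
    rw [show antidiagonal 0 = {(0, 0)} from rfl, Finset.sum_singleton]
    simp only [F, P, Q, PowerSeries.coeff_mk, theta_zero, map_one]
    rw [HahnSeries.single_mul_single, tmul_mul_zero C _ (isHom_one C)]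
    simp [← Tw_one])
  have := congrArg (PowerSeries.coeff m) this
  rw [PowerSeries.coeff_mul] at this
  simp only [F, P, Q, PowerSeries.coeff_mk] at this
  rw [this]
  refine Finset.sum_congr rfl fun p _ => ?_
  rw [HahnSeries.single_mul_single, tmul_mul_zero C _ (isHom_one C)]
  simp

theorem isCoproduct_deltaHom : IsCoproduct C (deltaHom C).toLinearMap where
  map_one := map_one (deltaHom C)
  map_mul x y := map_mul (deltaHom C) x y
  map_E i n k := by
    rw [AlgHom.toLinearMap_apply, deltaHom_E, HahnSeries.coeff_add, coeff_curB, curA,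
      HahnSeries.coeff_single, thetaZ]
    split_ifs <;> simp [zero_tmul]
  map_theta i m := by
    rw [AlgHom.toLinearMap_apply, deltaHom_theta, ← Finset.Nat.sum_antidiagonal_swap,
      Finset.Nat.sum_antidiagonal_eq_sum_range_succ_mk]
    rfl

variable {C}

/-- The coproduct is prescribed on E and θ, not on H. In the recursion `theta_rec` the pair (s, 0)
contributes s times `hCoeff C i s` and all other terms involve smaller indices, so the values on H
follow by induction. -/
theorem IsCoproduct.eq_deltaHom {Δ : U C →ₗ[K] CTw C} (h : IsCoproduct C Δ) :
    Δ = (deltaHom C).toLinearMap := by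
  have h' := isCoproduct_deltaHom C
  have hE : ∀ i n, Δ (E C i n) = deltaHom C (E C i n) := fun i n => by
    ext k
    exact (h.map_E i n k).trans (h'.map_E i n k).symm
  have hθ : ∀ i m, Δ (theta C i m) = deltaHom C (theta C i m) := fun i m =>
    (h.map_theta i m).trans (h'.map_theta i m).symm
  have hh : ∀ i s, Δ (hCoeff C i s) = deltaHom C (hCoeff C i s) := by
    intro i s
    induction s using Nat.strong_induction_on with
    | _ s ih =>
      rcases Nat.eq_zero_or_pos s with rfl | hs
      · rw [hCoeff_zero, map_zero, map_zero]
      have h1 := congrArg Δ (theta_rec C i s)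
      have h2 := congrArg (deltaHom C) (theta_rec C i s)
      rw [map_sum, ← Finset.sum_erase_add _ _ (show (s, 0) ∈ antidiagonal s by simp)] at h1 h2
      have hs' : (s : K) ≠ 0 := Nat.cast_ne_zero.2 hs.ne'
      simp only [map_smul, theta_zero, mul_one] at h1 h2
      have h3 : ∑ p ∈ (antidiagonal s).erase (s, 0), (p.1 : K) • Δ (hCoeff C i p.1 * theta C i p.2) =
          ∑ p ∈ (antidiagonal s).erase (s, 0),
            (p.1 : K) • deltaHom C (hCoeff C i p.1 * theta C i p.2) := by
        refine Finset.sum_congr rfl fun p hp => ?_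
        rw [Finset.mem_erase, mem_antidiagonal] at hp
        have hlt : p.1 < s := by
          rcases Nat.lt_or_ge p.1 s with h | h
          · exact h
          · exact absurd (Prod.ext (by omega) (by omega)) hp.1
        rw [h.map_mul, ih _ hlt, hθ]
        exact congrArg _ (h'.map_mul _ _).symm
      rw [h3, hθ] at h1
      have := h1.symm.trans h2
      exact smul_right_injective _ hs' (add_left_cancel this)
  have hH : ∀ i s, Δ (H C i s) = deltaHom C (H C i s) := by
    intro i s
    have := hh i s
    rw [hCoeff_pos, map_smul, map_smul] at this
    exact smul_right_injective _ v_inv_sub_ne_zero this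
  refine LinearMap.ext fun x => ?_
  induction x using U_induction with
  | one => exact h.map_one.trans h'.map_one.symm
  | add x y hx hy => rw [map_add, map_add, hx, hy]
  | smul c x hx => rw [map_smul, map_smul, hx]
  | E_mul i l x hx => rw [h.map_mul, h'.map_mul, hE, hx]; rfl
  | H_mul i s x hx => rw [h.map_mul, h'.map_mul, hH, hx]; rfl

end

section

variable {N : ℕ} (C : CartanDatum N)

/-! ### Linear forms attached to the generators -/

theorem serreSum_eq_zero_left {R : Type*} [Ring R] [Algebra K R] (q : K) {r : ℕ} (hr : 0 < r)
    (y : R) : serreSum q r (fun _ => (0 : R)) y = 0 := by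
  have h : serreMap q r R (fun a => a.elim y fun _ => 0) = serreSum q r (fun _ => (0 : R)) y :=
    serreMap_eq q _
  rw [← h]
  exact (serreMap q r R).map_coord_zero (some ⟨0, hr⟩) rfl

theorem serreSum_eq_zero_right {R : Type*} [Ring R] [Algebra K R] (q : K) {r : ℕ}
    (x : Fin r → R) : serreSum q r x 0 = 0 := by
  have h : serreMap q r R (fun a => a.elim 0 x) = serreSum q r x 0 := serreMap_eq q _
  rw [← h]
  exact (serreMap q r R).map_coord_zero none rfl

theorem toNat_pos {i j : Fin N} (hij : i ≠ j) : 0 < (1 - C.a i j).toNat := by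
  have := C.offDiag i j hij
  omega

/-- The counit. -/
def eps : U C →ₐ[K] K := lift C (fun _ => 0) (lift_rel C (fun _ _ => 0) (fun _ _ => 0) _
  (fun _ _ => rfl) (fun _ _ => rfl) (by simp) (by simp) (by simp)
  (fun i j hij _ _ => serreSum_eq_zero_left _ (toNat_pos C hij) _))

theorem eps_E (i : Fin N) (n : ℤ) : eps C (E C i n) = 0 := lift_gen C _ _ (Gen.E i n)

theorem eps_H (i : Fin N) (s : ℕ+) : eps C (H C i s) = 0 := lift_gen C _ _ (Gen.H i s)

theorem eps_hCoeff (i : Fin N) (s : ℕ) : eps C (hCoeff C i s) = 0 :=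
  hCoeff_cases C i (P := fun x => eps C x = 0) (map_zero _)
    (fun s => by rw [map_smul, eps_H, smul_zero]) s

theorem eps_theta (i : Fin N) (m : ℕ) : eps C (theta C i m) = if m = 0 then 1 else 0 := by
  refine theta_induction C i (P := fun m x => eps C x = if m = 0 then 1 else 0) (by simp)
    (fun m hm _ => ?_) m
  rw [if_neg hm.ne', map_smul, map_sum, Finset.sum_eq_zero, smul_zero]
  intro p _
  rw [map_smul, map_mul, eps_hCoeff, zero_mul, smul_zero]

theorem eps_tau (β : Fin N → ℤ) (x : U C) : eps C (tau C β x) = eps C x := by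
  induction x using U_induction with
  | one => simp
  | add x y hx hy => simp only [map_add, hx, hy]
  | smul c x hx => simp only [map_smul, hx]
  | E_mul i l x hx => rw [map_mul, map_mul, map_mul, tau_E, map_smul, eps_E]; simp
  | H_mul i s x hx => rw [map_mul, map_mul, map_mul, tau_H, hx]

/-! ### Linear forms from triangular representations. -/

section Rep

variable {L : Type*} [CommRing L] [Algebra K L] (a b : Fin N → ℕ+ → L) (e : Fin N → ℤ → L)

/-- The images of the generators in a triangular representation. -/
def repGen : Gen N → Matrix (Fin 2) (Fin 2) L
  | Gen.E i n => !![0, e i n; 0, 0]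
  | Gen.H i s => !![a i s, b i s; 0, 0]

variable {C a b e}

/-- Products of two images of E vanish, so the quadratic relation is trivial; `h1` and `h2` are what
the relations involving H require, and by `h3` one of the two kinds of letters in a Serre relation
is zero. In such a representation the entry (1,1) is the counit, and the entry (0,1) is the linear
form sought. -/
theorem repGen_rel (h1 : ∀ i j s t, a i s * b j t = a j t * b i s)
    (h2 : ∀ i j s l, a i s * e j l = hE C i j s • e j (s + l))
    (h3 : ∀ i j, i ≠ j → (∀ l, e i l = 0) ∨ ∀ l, e j l = 0) :
    ∀ x y, Rel C x y →
      FreeAlgebra.lift K (repGen a b e) x = FreeAlgebra.lift K (repGen a b e) y := by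
  refine lift_rel C (fun i n => repGen a b e (Gen.E i n)) (fun i s => repGen a b e (Gen.H i s))
    _ (fun _ _ => rfl) (fun _ _ => rfl) (fun i j s t => ?_) (fun i j s l => ?_)
    (fun i j l m => ?_) (fun i j hij l l' => ?_)
  · simp only [repGen, Matrix.mul_fin_two, h1 i j s t, mul_comm (a i s) (a j t)]
    simp
  · simp only [repGen, Matrix.mul_fin_two, mul_zero, zero_mul, add_zero, h2]
    ext x y
    fin_cases x <;> fin_cases y <;> simp [hE]
  · simp [repGen]
  · have h0 : (!![0, 0; 0, 0] : Matrix (Fin 2) (Fin 2) L) = 0 := by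
      ext x y; fin_cases x <;> fin_cases y <;> rfl
    rcases h3 i j hij with h | h
    · simp only [repGen, h, h0]
      exact serreSum_eq_zero_left _ (toNat_pos C hij) _
    · simp only [repGen, h, h0]
      exact serreSum_eq_zero_right _ _

/-- A triangular representation. -/
def rep (h1 : ∀ i j s t, a i s * b j t = a j t * b i s)
    (h2 : ∀ i j s l, a i s * e j l = hE C i j s • e j (s + l))
    (h3 : ∀ i j, i ≠ j → (∀ l, e i l = 0) ∨ ∀ l, e j l = 0) :
    U C →ₐ[K] Matrix (Fin 2) (Fin 2) L := lift C (repGen a b e) (repGen_rel h1 h2 h3)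

variable (h1 : ∀ i j s t, a i s * b j t = a j t * b i s)
    (h2 : ∀ i j s l, a i s * e j l = hE C i j s • e j (s + l))
    (h3 : ∀ i j, i ≠ j → (∀ l, e i l = 0) ∨ ∀ l, e j l = 0)

theorem rep_E (i : Fin N) (n : ℤ) : rep h1 h2 h3 (E C i n) = !![0, e i n; 0, 0] :=
  lift_gen C (repGen a b e) _ (Gen.E i n)

theorem rep_H (i : Fin N) (s : ℕ+) : rep h1 h2 h3 (H C i s) = !![a i s, b i s; 0, 0] :=
  lift_gen C (repGen a b e) _ (Gen.H i s)

theorem rep_one_one (x : U C) : rep h1 h2 h3 x 1 1 = algebraMap K L (eps C x) := by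
  induction x using U_induction with
  | one => simp
  | add x y hx hy => rw [map_add, map_add, map_add, Matrix.add_apply, hx, hy]
  | smul c x hx =>
    rw [map_smul, map_smul, Matrix.smul_apply, hx, smul_eq_mul, map_mul, Algebra.smul_def]
  | E_mul i l x hx => rw [map_mul, map_mul, rep_E, eps_E, Matrix.mul_apply]; simp
  | H_mul i s x hx => rw [map_mul, map_mul, rep_H, eps_H, Matrix.mul_apply]; simp

theorem rep_E_mul (i : Fin N) (n : ℤ) (x : U C) :
    rep h1 h2 h3 (E C i n * x) 0 1 = eps C x • e i n := by
  rw [map_mul, rep_E, Matrix.mul_apply]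
  simp [rep_one_one, Algebra.smul_def, mul_comm]

theorem rep_H_mul (i : Fin N) (s : ℕ+) (x : U C) :
    rep h1 h2 h3 (H C i s * x) 0 1 = a i s * rep h1 h2 h3 x 0 1 + eps C x • b i s := by
  rw [map_mul, rep_H, Matrix.mul_apply]
  simp [rep_one_one, Algebra.smul_def, mul_comm]

end Rep

/-- The constant `(E_{i,n}, E_{i,n})`. -/
def cE : K := 1 / (v ^ (-2 : ℤ) - 1)

/-- The generating series of the linear forms `(E_{i,n}, -)`, as a representation. -/
def psiRep (i : Fin N) : U C →ₐ[K] Matrix (Fin 2) (Fin 2) (AddMonoidAlgebra K ℤ) :=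
  rep (C := C) (a := fun j s => AddMonoidAlgebra.single (s : ℤ) (hE C i j s)) (b := fun _ _ => 0)
    (e := fun j l => if i = j then AddMonoidAlgebra.single l cE else 0)
    (fun _ _ _ _ => by simp)
    (fun j j' s l => by
      split_ifs with h
      · subst h
        rw [AddMonoidAlgebra.single_mul_single, hE_symm, AddMonoidAlgebra.smul_single, smul_eq_mul]
      · simp)
    (fun j j' hjj' => by
      by_cases h : i = j
      · right; intro l; rw [if_neg]; rintro rfl; exact hjj' h.symm
      · left; intro l; rw [if_neg h])

/-- The linear form `(E_{i,n}, -)`. -/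
def psi (i : Fin N) (n : ℤ) : U C →ₗ[K] K where
  toFun x := (psiRep C i x 0 1).coeff n
  map_add' x y := by rw [map_add]; rfl
  map_smul' c x := by rw [map_smul]; rfl

theorem psi_one (i : Fin N) (n : ℤ) : psi C i n 1 = 0 := by
  change (psiRep C i 1 0 1).coeff n = 0
  rw [map_one]; simp

theorem psi_E_mul (i j : Fin N) (n m : ℤ) (x : U C) :
    psi C i m (E C j n * x) = if i = j ∧ n = m then cE * eps C x else 0 := by
  change (psiRep C i (E C j n * x) 0 1).coeff m = _
  rw [psiRep, rep_E_mul, AddMonoidAlgebra.coeff_smul_apply]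
  by_cases h : i = j
  · rw [if_pos h, AddMonoidAlgebra.coeff_single, Finsupp.single_apply]
    by_cases h' : n = m
    · subst h'; rw [if_pos rfl, if_pos ⟨h, rfl⟩, smul_eq_mul, mul_comm]
    · rw [if_neg h', if_neg (fun h2 => h' h2.2), smul_zero]
  · rw [if_neg h, if_neg (fun h2 => h h2.1)]; simp

theorem psi_H_mul (i j : Fin N) (s : ℕ+) (m : ℤ) (x : U C) :
    psi C i m (H C j s * x) = hE C i j s * psi C i (m - s) x := by
  change (psiRep C i (H C j s * x) 0 1).coeff m = _
  rw [psiRep, rep_H_mul, smul_zero, add_zero,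
    AddMonoidAlgebra.coeff_single_mul_eq_mul_coeff (m₂ := m - s) (fun _ _ => by omega)]
  rfl

theorem psi_hCoeff_mul (i j : Fin N) (s : ℕ) (m : ℤ) (x : U C) :
    psi C i m (hCoeff C j s * x) = (v⁻¹ - v) * hE C i j s * psi C i (m - s) x := by
  rcases Nat.eq_zero_or_pos s with rfl | hs
  · simp [hCoeff_zero, hE]
  · lift s to ℕ+ using hs
    rw [hCoeff_pos, smul_mul_assoc, map_smul, psi_H_mul, smul_eq_mul, mul_assoc]

/-- The recursion for θ and the recursion `gCoeff_rec` for the coefficients of g coincide once H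
acts through `psi_hCoeff_mul`. -/
theorem psi_theta_mul (i j : Fin N) (t : ℕ) (m : ℤ) (x : U C) :
    psi C i m (theta C j t * x) = gCoeff (pq C i j) t * psi C i (m - t) x := by
  refine theta_induction C j (P := fun t y => ∀ m x, psi C i m (y * x) =
    gCoeff (pq C i j) t * psi C i (m - t) x) (fun m x => by simp [gCoeff_zero])
    (fun t ht ih m x => ?_) t m x
  have ht' : (t : K) ≠ 0 := Nat.cast_ne_zero.2 ht.ne'
  rw [smul_mul_assoc, map_smul, smul_eq_mul, inv_mul_eq_iff_eq_mul₀ ht', Finset.sum_mul, map_sum,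
    ← mul_assoc, ← gCoeff_rec, Finset.sum_mul]
  refine Finset.sum_congr rfl fun p hp => ?_
  rw [mem_antidiagonal] at hp
  rw [smul_mul_assoc, mul_assoc, map_smul, psi_hCoeff_mul, smul_eq_mul]
  rcases Nat.eq_zero_or_pos p.1 with h0 | h0
  · rw [h0]; simp
  · rw [ih p.2 (by omega), ← smul_hE, show m - (p.1 : ℤ) - (p.2 : ℤ) = m - t by omega]
    ring

/-- The form `psi C i m` sees only the component of weight αᵢ, where `tau` is this scalar. -/
theorem psi_tau (i : Fin N) (β : Fin N → ℤ) (m : ℤ) (x : U C) :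
    psi C i m (tau C β x) = v ^ (-C.form β (root i)) * psi C i m x := by
  induction x using U_induction generalizing m with
  | one => rw [map_one, psi_one, mul_zero]
  | add x y hx hy => simp only [map_add, hx, hy, mul_add]
  | smul c x hx => simp only [map_smul, hx, smul_eq_mul]; ring
  | E_mul j l x hx =>
    rw [map_mul, tau_E, smul_mul_assoc, map_smul, psi_E_mul, psi_E_mul, eps_tau, smul_eq_mul]
    by_cases h : i = j
    · rw [h]
    · rw [if_neg (fun h2 => h h2.1), mul_zero, mul_zero]
  | H_mul j s x hx => rw [map_mul, tau_H, psi_H_mul, psi_H_mul, hx]; ring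

theorem psi_theta_tau (i j : Fin N) (t : ℕ) (m : ℤ) (x : U C) :
    psi C i m (theta C j t * tau C (root j) x) =
      pq C i j * gCoeff (pq C i j) t * psi C i (m - t) x := by
  rw [psi_theta_mul, psi_tau, form_root, b_symm]
  change gCoeff _ _ * (pq C i j * _) = _
  ring

/-- The constant `(H_{i,s}, H_{j,s})`. -/
def cH (i j : Fin N) (s : ℕ) : K := qInt v ((s : ℤ) * C.b i j) / ((s : K) * (v⁻¹ - v))

theorem cH_symm (i j : Fin N) (s : ℕ) : cH C i j s = cH C j i s := by rw [cH, cH, b_symm]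

theorem smul_cH (i j : Fin N) (s : ℕ) : (v⁻¹ - v) * cH C i j s = hE C i j s := by
  have := v_inv_sub_ne_zero
  rw [cH, hE]
  rcases Nat.eq_zero_or_pos s with rfl | hs
  · simp
  · have hs' : (s : K) ≠ 0 := Nat.cast_ne_zero.2 hs.ne'
    rw [mul_comm, div_mul_eq_mul_div, mul_comm (s : K), mul_comm (qInt _ _),
      mul_div_mul_left _ _ this]

/-- The linear form `(H_{i,s}, -)`, as a representation. -/
def psiHRep (i : Fin N) (s : ℕ+) : U C →ₐ[K] Matrix (Fin 2) (Fin 2) K :=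
  rep (C := C) (a := fun _ _ => 0) (b := fun j t => if s = t then cH C i j s else 0)
    (e := fun _ _ => 0) (by simp) (by simp) (by simp)

/-- The linear form `(H_{i,s}, -)`. -/
def psiH (i : Fin N) (s : ℕ+) : U C →ₗ[K] K where
  toFun x := psiHRep C i s x 0 1
  map_add' x y := by rw [map_add, Matrix.add_apply]
  map_smul' c x := by rw [map_smul, Matrix.smul_apply]; rfl

theorem psiH_one (i : Fin N) (s : ℕ+) : psiH C i s 1 = 0 := by
  change psiHRep C i s 1 0 1 = 0
  rw [map_one]; simp

theorem psiH_E_mul (i j : Fin N) (s : ℕ+) (n : ℤ) (x : U C) : psiH C i s (E C j n * x) = 0 := by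
  change psiHRep C i s (E C j n * x) 0 1 = 0
  rw [psiHRep, rep_E_mul, smul_zero]

theorem psiH_H_mul (i j : Fin N) (s t : ℕ+) (x : U C) :
    psiH C i s (H C j t * x) = if s = t then cH C i j s * eps C x else 0 := by
  change psiHRep C i s (H C j t * x) 0 1 = _
  rw [psiHRep, rep_H_mul, zero_mul, zero_add]
  split_ifs
  · rw [smul_eq_mul, mul_comm]
  · rw [smul_zero]

theorem psiH_hCoeff_mul (i j : Fin N) (s : ℕ+) (t : ℕ) (x : U C) :
    psiH C i s (hCoeff C j t * x) = if t = s then hE C i j s * eps C x else 0 := by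
  rcases Nat.eq_zero_or_pos t with rfl | ht
  · rw [hCoeff_zero, zero_mul, map_zero, if_neg s.pos.ne]
  · lift t to ℕ+ using ht
    rw [hCoeff_pos, smul_mul_assoc, map_smul, psiH_H_mul]
    by_cases h : s = t
    · rw [if_pos h, if_pos (by rw [h]), smul_eq_mul, ← mul_assoc, smul_cH]
    · rw [if_neg h, if_neg (fun h' => h (PNat.coe_injective h'.symm)), smul_zero]

theorem psiH_theta_mul (i j : Fin N) (s : ℕ+) (t : ℕ) (x : U C) :
    psiH C i s (theta C j t * x) = (if t = s then hE C i j s * eps C x else 0) +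
      if t = 0 then psiH C i s x else 0 := by
  rcases Nat.eq_zero_or_pos t with rfl | ht
  · rw [theta_zero, one_mul, if_neg s.pos.ne, if_pos rfl, zero_add]
  have ht' : (t : K) ≠ 0 := Nat.cast_ne_zero.2 ht.ne'
  have := congrArg (fun y => psiH C i s (y * x)) (theta_rec C j t)
  simp only [smul_mul_assoc, map_smul, Finset.sum_mul, map_sum, mul_assoc, psiH_hCoeff_mul,
    map_mul, eps_theta] at this
  rw [if_neg ht.ne', add_zero]
  refine smul_right_injective K ht' (this.trans ?_)
  -- The counit kills θ of positive index, so only the term with the full H remains.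
  rw [Finset.sum_eq_single (t, 0)]
  · simp
  · intro p hp hne
    rw [mem_antidiagonal] at hp
    rw [if_neg (fun h => hne (Prod.ext (by simp only; omega) h) : ¬ p.2 = 0)]
    simp
  · intro h; exact absurd (mem_antidiagonal.2 (add_zero t)) h

theorem psiH_tau (i : Fin N) (s : ℕ+) (β : Fin N → ℤ) (x : U C) :
    psiH C i s (tau C β x) = psiH C i s x := by
  induction x using U_induction with
  | one => rw [map_one]
  | add x y hx hy => simp only [map_add, hx, hy]
  | smul c x hx => simp only [map_smul, hx]
  | E_mul j l x hx =>
    rw [map_mul, tau_E, smul_mul_assoc, map_smul, psiH_E_mul, psiH_E_mul, smul_zero]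
  | H_mul j t x hx => rw [map_mul, tau_H, psiH_H_mul, psiH_H_mul, eps_tau]

end

section

variable {N : ℕ} (C : CartanDatum N)

/-! ### Components of the coproduct -/

theorem exists_lowerBdd {T : Type*} [Ring T] (x : HahnSeries ℤ T) : ∃ n, LowerBdd x n :=
  ⟨x.order, fun _ hk => HahnSeries.coeff_eq_zero_of_lt_order hk⟩

/-- The component of the coproduct whose first factor has degree `k`. -/
def deltaC (k : ℤ) : U C →ₗ[K] Tw C where
  toFun x := (deltaHom C x).coeff k
  map_add' x y := by rw [map_add, HahnSeries.coeff_add]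
  map_smul' c x := by rw [map_smul]; rfl

theorem deltaC_one (k : ℤ) : deltaC C k 1 = if k = 0 then tmul C 1 1 else 0 := by
  change (deltaHom C 1).coeff k = _
  rw [map_one, HahnSeries.coeff_one, Tw_one]
  split_ifs <;> rfl

/-- Any sufficiently large number of terms is allowed, so that sums with different bounds can later
be taken over a common range. -/
theorem coeff_curB_mul (j : Fin N) (n k : ℤ) {x : CTw C} {n₀ : ℤ} (hx : LowerBdd x n₀) {M : ℕ}
    (hM : k - n₀ < M) : (curB C j n * x).coeff k =
      ∑ t ∈ Finset.range M, tmul C (theta C j t) (E C j (n - t)) * x.coeff (k - t) := by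
  rw [coeff_mul_Icc (lowerBdd_curB C j n) hx]
  refine Finset.sum_of_injOn Int.toNat (fun a ha b hb h => ?_) (fun a ha => ?_) (fun t _ ht => ?_)
    (fun s hs => ?_)
  · simp only [Finset.coe_Icc, Set.mem_Icc] at ha hb; omega
  · simp only [Finset.coe_Icc, Set.mem_Icc, Finset.coe_range, Set.mem_Iio] at ha ⊢; omega
  · have : k - n₀ < t := by
      by_contra h
      refine ht ⟨t, ?_, Int.toNat_natCast t⟩
      simp only [Finset.coe_Icc, Set.mem_Icc]; omega
    rw [hx (k - t) (by omega), mul_zero]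
  · rw [Finset.mem_Icc] at hs
    rw [coeff_curB, thetaZ, if_pos hs.1, Int.toNat_of_nonneg hs.1]

theorem deltaC_E_mul (j : Fin N) (n k : ℤ) {x : U C} {n₀ : ℤ} (hx : LowerBdd (deltaHom C x) n₀)
    {M : ℕ} (hM : k - n₀ < M) :
    deltaC C k (E C j n * x) = tmul C (E C j n) 1 * deltaC C (k - n) x +
      ∑ t ∈ Finset.range M, tmul C (theta C j t) (E C j (n - t)) * deltaC C (k - t) x := by
  change (deltaHom C (E C j n * x)).coeff k = _
  rw [map_mul, deltaHom_E, add_mul, HahnSeries.coeff_add, curA, HahnSeries.coeff_single_mul,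
    coeff_curB_mul C j n k hx hM]
  rfl

theorem deltaC_H_mul (j : Fin N) (s : ℕ+) (k : ℤ) (x : U C) :
    deltaC C k (H C j s * x) =
      tmul C (H C j s) 1 * deltaC C (k - s) x + tmul C 1 (H C j s) * deltaC C k x := by
  change (deltaHom C (H C j s * x)).coeff k = _
  rw [map_mul, deltaHom_H, add_mul, HahnSeries.coeff_add, HahnSeries.coeff_single_mul,
    HahnSeries.coeff_single_mul, sub_zero]
  rfl

theorem deltaC_theta_mul (j : Fin N) (m : ℕ) (k : ℤ) (x : U C) :
    deltaC C k (theta C j m * x) = ∑ p ∈ antidiagonal m,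
      tmul C (theta C j p.1) (theta C j p.2) * deltaC C (k - p.1) x := by
  change (deltaHom C (theta C j m * x)).coeff k = _
  rw [map_mul, deltaHom_theta, Finset.sum_mul, HahnSeries.coeff_sum]
  refine Finset.sum_congr rfl fun p _ => ?_
  rw [HahnSeries.coeff_single_mul]
  rfl

theorem twMap_tau_tmul_mul (β : Fin N → ℤ) (a : U C) {b : U C} {γ : Fin N → ℤ} (hb : IsHom C γ b)
    (Y : Tw C) :
    twMap C (tau C β).toLinearMap (tau C β).toLinearMap (tmul C a b * Y) =
      tmul C (tau C β a) (tau C β b) *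
        twMap C (tau C β).toLinearMap (tau C β).toLinearMap Y := by
  induction Y using Tw_induction with
  | zero => simp only [mul_zero, map_zero]
  | add X Y hX hY => simp only [mul_add, map_add, hX, hY]
  | tm x y =>
    rw [tmul_mul_tmul_of_isHom C a hb, twMap_tmul, twMap_tmul, hb.tau, tmul_smul,
      Tw_smul_mul, tmul_mul_tmul_of_isHom C _ hb, ← tmul_smul]
    simp only [AlgHom.toLinearMap_apply, map_mul, hb.tau, ← tau_add, add_comm β γ, smul_mul_assoc]

/-- The coproduct preserves total weight. Coassociativity needs this, because an operator obtained
by contraction has to be moved past the twist. -/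
theorem deltaC_tau (β : Fin N → ℤ) (k : ℤ) (x : U C) : deltaC C k (tau C β x) =
    twMap C (tau C β).toLinearMap (tau C β).toLinearMap (deltaC C k x) := by
  induction x using U_induction generalizing k with
  | one =>
    rw [map_one, deltaC_one]
    split_ifs
    · rw [twMap_tmul]; simp
    · rw [map_zero]
  | add x y hx hy => simp only [map_add, hx, hy]
  | smul c x hx => simp only [map_smul, hx]
  | E_mul j n x hx =>
    obtain ⟨n₀, h₀⟩ := exists_lowerBdd (deltaHom C x)
    have h₁ : LowerBdd (deltaHom C (tau C β x)) n₀ := fun k hk => by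
      refine (hx k).trans ?_
      rw [show deltaC C k x = 0 from h₀ k hk, map_zero]
    have hM : k - n₀ < ((k - n₀ + 1).toNat : ℕ) := by omega
    rw [map_mul, tau_E, smul_mul_assoc, map_smul, deltaC_E_mul C j n k h₁ hM,
      deltaC_E_mul C j n k h₀ hM, map_add, map_sum, twMap_tau_tmul_mul C β _ (isHom_one C), map_one,
      tau_E, smul_add, smul_tmul, Tw_smul_mul, hx, Finset.smul_sum]
    congr 1
    refine Finset.sum_congr rfl fun t _ => ?_
    rw [twMap_tau_tmul_mul C β _ (isHom_E C j _), tau_E, tmul_smul, Tw_smul_mul, hx,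
      (isHom_theta C j t).tau, form_zero_right]
    simp
  | H_mul j s x hx =>
    rw [map_mul, tau_H, deltaC_H_mul, deltaC_H_mul, map_add,
      twMap_tau_tmul_mul C β _ (isHom_one C), twMap_tau_tmul_mul C β _ (isHom_H C j s), hx, hx,
      map_one, tau_H]

/-- The contraction `x ⊗ y ↦ ψ(x) y`. -/
def contr (ψ : U C →ₗ[K] K) : Tw C →ₗ[K] U C :=
  TensorProduct.lift (LinearMap.lsmul K (U C) ∘ₗ ψ)

theorem contr_tmul (ψ : U C →ₗ[K] K) (x y : U C) : contr C ψ (tmul C x y) = ψ x • y :=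
  TensorProduct.lift.tmul x y

/-- Left multiplication before contraction becomes left multiplication by b after it, with ψ
replaced by x ↦ ψ(a τ_β(x)). The product formulas for `res` all come from this. -/
theorem contr_tmul_mul (ψ : U C →ₗ[K] K) (a : U C) {b : U C} {β : Fin N → ℤ} (hb : IsHom C β b)
    (Y : Tw C) : contr C ψ (tmul C a b * Y) =
      b * contr C (ψ ∘ₗ LinearMap.mulLeft K a ∘ₗ (tau C β).toLinearMap) Y := by
  induction Y using Tw_induction with
  | zero => simp only [mul_zero, map_zero]
  | add X Y hX hY => simp only [mul_add, map_add, hX, hY]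
  | tm x y =>
    rw [tmul_mul_tmul_of_isHom C a hb, contr_tmul, contr_tmul, mul_smul_comm]
    rfl

theorem contr_tmul_mul_zero (ψ : U C →ₗ[K] K) (a : U C) {b : U C} (hb : IsHom C 0 b)
    (Y : Tw C) : contr C ψ (tmul C a b * Y) = b * contr C (ψ ∘ₗ LinearMap.mulLeft K a) Y := by
  rw [contr_tmul_mul C ψ a hb]
  have : LinearMap.mulLeft K a ∘ₗ (tau C 0).toLinearMap = LinearMap.mulLeft K a :=
    LinearMap.ext fun x => congrArg (a * ·) (tau_zero C x)
  rw [this]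

/-- The operator `x ↦ ∑ ψ(x₍₁₎) x₍₂₎`, the sum being over the terms with `deg x₍₁₎ = k`. -/
def res (ψ : U C →ₗ[K] K) (k : ℤ) : U C →ₗ[K] U C := contr C ψ ∘ₗ deltaC C k

theorem res_apply (ψ : U C →ₗ[K] K) (k : ℤ) (x : U C) :
    res C ψ k x = contr C ψ (deltaC C k x) := rfl

theorem contr_add (ψ φ : U C →ₗ[K] K) (Y : Tw C) :
    contr C (ψ + φ) Y = contr C ψ Y + contr C φ Y := by
  induction Y using Tw_induction with
  | zero => simp only [map_zero, add_zero]
  | add X Y hX hY => simp only [map_add, hX, hY]; abel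
  | tm x y => rw [contr_tmul, contr_tmul, contr_tmul, LinearMap.add_apply, add_smul]

theorem contr_smul (c : K) (ψ : U C →ₗ[K] K) (Y : Tw C) :
    contr C (c • ψ) Y = c • contr C ψ Y := by
  induction Y using Tw_induction with
  | zero => simp only [map_zero, smul_zero]
  | add X Y hX hY => simp only [map_add, hX, hY, smul_add]
  | tm x y => rw [contr_tmul, contr_tmul, LinearMap.smul_apply, smul_assoc]

theorem res_add (ψ φ : U C →ₗ[K] K) (k : ℤ) (x : U C) :
    res C (ψ + φ) k x = res C ψ k x + res C φ k x := contr_add C ψ φ _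

theorem res_smul (c : K) (ψ : U C →ₗ[K] K) (k : ℤ) (x : U C) :
    res C (c • ψ) k x = c • res C ψ k x := contr_smul C c ψ _

theorem res_zero (k : ℤ) (x : U C) : res C 0 k x = 0 := by
  have := res_smul C 0 0 k x
  rwa [zero_smul, zero_smul] at this

theorem res_one (ψ : U C →ₗ[K] K) (k : ℤ) :
    res C ψ k 1 = if k = 0 then ψ 1 • 1 else 0 := by
  rw [res_apply, deltaC_one]
  split_ifs
  · rw [contr_tmul]
  · rw [map_zero]

theorem res_E_mul (ψ : U C →ₗ[K] K) (j : Fin N) (n k : ℤ) {x : U C} {n₀ : ℤ}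
    (hx : LowerBdd (deltaHom C x) n₀) {M : ℕ} (hM : k - n₀ < M) :
    res C ψ k (E C j n * x) = res C (ψ ∘ₗ LinearMap.mulLeft K (E C j n)) (k - n) x +
      ∑ t ∈ Finset.range M, E C j (n - t) *
        res C (ψ ∘ₗ LinearMap.mulLeft K (theta C j t) ∘ₗ (tau C (root j)).toLinearMap) (k - t) x := by
  rw [res_apply, deltaC_E_mul C j n k hx hM, map_add, map_sum,
    contr_tmul_mul_zero C ψ _ (isHom_one C), one_mul]
  congr 1
  exact Finset.sum_congr rfl fun t _ => contr_tmul_mul C ψ _ (isHom_E C j _) _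

theorem res_H_mul (ψ : U C →ₗ[K] K) (j : Fin N) (s : ℕ+) (k : ℤ) (x : U C) :
    res C ψ k (H C j s * x) =
      res C (ψ ∘ₗ LinearMap.mulLeft K (H C j s)) (k - s) x + H C j s * res C ψ k x := by
  rw [res_apply, deltaC_H_mul, map_add, contr_tmul_mul_zero C ψ _ (isHom_one C), one_mul,
    contr_tmul_mul_zero C ψ _ (isHom_H C j s), LinearMap.mulLeft_one]
  rfl

theorem res_theta_mul (ψ : U C →ₗ[K] K) (j : Fin N) (m : ℕ) (k : ℤ) (x : U C) :
    res C ψ k (theta C j m * x) = ∑ p ∈ antidiagonal m, theta C j p.2 *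
      res C (ψ ∘ₗ LinearMap.mulLeft K (theta C j p.1)) (k - p.1) x := by
  rw [res_apply, deltaC_theta_mul, map_sum]
  exact Finset.sum_congr rfl fun p _ => contr_tmul_mul_zero C ψ _ (isHom_theta C j _) _

theorem res_tau (ψ : U C →ₗ[K] K) (β : Fin N → ℤ) (k : ℤ) (x : U C) :
    res C ψ k (tau C β x) = tau C β (res C (ψ ∘ₗ (tau C β).toLinearMap) k x) := by
  rw [res_apply, deltaC_tau, res_apply]
  induction deltaC C k x using Tw_induction with
  | zero => simp only [map_zero]
  | add X Y hX hY => simp only [map_add, hX, hY]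
  | tm x y => rw [twMap_tmul, contr_tmul, contr_tmul, map_smul]; rfl

/-! ### Coassociativity -/

theorem sum_range_antidiagonal {A : Type*} [AddCommMonoid A] (M : ℕ) (T : ℕ → ℕ → A)
    (h : ∀ t u, M ≤ t + u → T t u = 0) :
    ∑ t ∈ Finset.range M, ∑ u ∈ Finset.range M, T t u =
      ∑ s ∈ Finset.range M, ∑ p ∈ antidiagonal s, T p.1 p.2 := by
  rw [← Finset.sum_product']
  have h1 : ∑ x ∈ Finset.range M ×ˢ Finset.range M, T x.1 x.2 =
      ∑ x ∈ (Finset.range M ×ˢ Finset.range M).filter fun x => x.1 + x.2 < M, T x.1 x.2 := by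
    rw [Finset.sum_filter]
    refine Finset.sum_congr rfl fun x _ => ?_
    split_ifs with hx
    · rfl
    · exact h _ _ (not_lt.1 hx)
  rw [h1, ← Finset.sum_fiberwise_of_maps_to
    (s := (Finset.range M ×ˢ Finset.range M).filter fun x => x.1 + x.2 < M)
    (t := Finset.range M) (g := fun x => x.1 + x.2)
    (fun x hx => Finset.mem_range.2 (Finset.mem_filter.1 hx).2)]
  refine Finset.sum_congr rfl fun s hs => Finset.sum_congr ?_ fun _ _ => rfl
  rw [Finset.mem_range] at hs
  ext x
  simp only [Finset.mem_filter, Finset.mem_product, Finset.mem_range, mem_antidiagonal]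
  omega

/-- The bound M₀ depends on Y: it is the maximum over the pure tensors of which Y is a finite sum,
each having its own lower bound. -/
theorem twMap_res_E (ψ : U C →ₗ[K] K) (j : Fin N) (n k : ℤ) (Y : Tw C) :
    ∃ M₀ : ℕ, ∀ M ≥ M₀, twMap C (res C ψ k) LinearMap.id (tmul C (E C j n) 1 * Y) =
      twMap C (res C (ψ ∘ₗ LinearMap.mulLeft K (E C j n)) (k - n)) LinearMap.id Y +
      ∑ t ∈ Finset.range M, tmul C (E C j (n - t)) 1 *
        twMap C (res C (ψ ∘ₗ LinearMap.mulLeft K (theta C j t) ∘ₗ (tau C (root j)).toLinearMap)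
          (k - t)) LinearMap.id Y := by
  induction Y using Tw_induction with
  | zero => exact ⟨0, fun M _ => by simp⟩
  | add X Y hX hY =>
    obtain ⟨M₁, h₁⟩ := hX
    obtain ⟨M₂, h₂⟩ := hY
    refine ⟨max M₁ M₂, fun M hM => ?_⟩
    rw [mul_add, map_add, h₁ M (le_trans (le_max_left _ _) hM),
      h₂ M (le_trans (le_max_right _ _) hM)]
    simp only [map_add, mul_add, Finset.sum_add_distrib]
    abel
  | tm a b =>
    obtain ⟨n₀, h₀⟩ := exists_lowerBdd (deltaHom C a)
    refine ⟨(k - n₀ + 1).toNat, fun M hM => ?_⟩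
    rw [tmul_mul_zero C _ (isHom_one C), twMap_tmul, res_E_mul C ψ j n k h₀ (M := M) (by omega),
      add_tmul, sum_tmul, one_mul, twMap_tmul]
    congr 1
    refine Finset.sum_congr rfl fun t _ => ?_
    rw [twMap_tmul, tmul_mul_zero C _ (isHom_one C), one_mul]

theorem twMap_res_theta (ψ : U C →ₗ[K] K) (j : Fin N) (n k : ℤ) (s : ℕ) (Y : Tw C) :
    twMap C (res C ψ k) LinearMap.id (tmul C (theta C j s) (E C j n) * Y) =
      ∑ p ∈ antidiagonal s, tmul C (theta C j p.2) (E C j n) *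
        twMap C (res C (ψ ∘ₗ LinearMap.mulLeft K (theta C j p.1) ∘ₗ (tau C (root j)).toLinearMap)
          (k - p.1)) LinearMap.id Y := by
  induction Y using Tw_induction with
  | zero => simp
  | add X Y hX hY =>
    rw [mul_add, map_add, hX, hY, ← Finset.sum_add_distrib]
    exact Finset.sum_congr rfl fun p _ => by rw [map_add, mul_add]
  | tm a b =>
    rw [tmul_mul_tmul_of_isHom C _ (isHom_E C j n), twMap_tmul, res_theta_mul, sum_tmul]
    refine Finset.sum_congr rfl fun p _ => ?_
    rw [twMap_tmul, tmul_mul_tmul_of_isHom C _ (isHom_E C j n), res_tau]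
    rfl

/-- Coassociativity of the coproduct. -/
theorem deltaC_res (ψ : U C →ₗ[K] K) (k l : ℤ) (x : U C) :
    deltaC C l (res C ψ k x) = twMap C (res C ψ k) LinearMap.id (deltaC C (k + l) x) := by
  -- Removing a generator from x changes the linear form and both degrees, so all three must vary.
  induction x using U_induction generalizing ψ k l with
  | one =>
    rw [res_one, deltaC_one]
    by_cases hk : k = 0
    · subst hk
      rw [if_pos rfl, map_smul, deltaC_one, zero_add]
      split_ifs
      · rw [twMap_tmul, res_one, if_pos rfl, smul_tmul]; rfl
      · rw [smul_zero, map_zero]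
    · rw [if_neg hk, map_zero]
      split_ifs
      · rw [twMap_tmul, res_one, if_neg hk, zero_tmul]
      · rw [map_zero]
  | add x y hx hy => simp only [map_add, hx, hy]
  | smul c x hx => simp only [map_smul, hx]
  | H_mul j s x hx =>
    have h1 : ∀ Y : Tw C, twMap C (res C ψ k) LinearMap.id (tmul C (H C j s) 1 * Y) =
        twMap C (res C (ψ ∘ₗ LinearMap.mulLeft K (H C j s)) (k - s)) LinearMap.id Y +
          tmul C (H C j s) 1 * twMap C (res C ψ k) LinearMap.id Y := by
      intro Y
      induction Y using Tw_induction with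
      | zero => simp
      | add X Y hX hY => simp only [mul_add, map_add, hX, hY]; abel
      | tm a b =>
        rw [tmul_mul_zero C _ (isHom_one C), twMap_tmul, twMap_tmul, twMap_tmul,
          tmul_mul_zero C _ (isHom_one C), res_H_mul, add_tmul, one_mul, one_mul]
    have h2 : ∀ Y : Tw C, twMap C (res C ψ k) LinearMap.id (tmul C 1 (H C j s) * Y) =
        tmul C 1 (H C j s) * twMap C (res C ψ k) LinearMap.id Y := by
      intro Y
      induction Y using Tw_induction with
      | zero => simp
      | add X Y hX hY => simp only [mul_add, map_add, hX, hY]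
      | tm a b =>
        rw [tmul_mul_zero C _ (isHom_H C j s), twMap_tmul, twMap_tmul,
          tmul_mul_zero C _ (isHom_H C j s), one_mul, one_mul]
        rfl
    rw [res_H_mul, map_add, deltaC_H_mul, deltaC_H_mul, hx, hx, hx, map_add, h1, h2,
      show k - (s : ℤ) + l = k + l - s by ring, show k + (l - (s : ℤ)) = k + l - s by ring]
    abel
  | E_mul j n x hx =>
    obtain ⟨n₀, h₀⟩ := exists_lowerBdd (deltaHom C x)
    obtain ⟨M₀, hM₀⟩ := twMap_res_E C ψ j n k (deltaC C (k + l - n) x)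
    set M := M₀ + (k - n₀ + 1).toNat + (k + l - n₀ + 1).toNat with hMdef
    set ψt : ℕ → U C →ₗ[K] K := fun t =>
      ψ ∘ₗ LinearMap.mulLeft K (theta C j t) ∘ₗ (tau C (root j)).toLinearMap with hψt
    have hb : ∀ t : ℕ, LowerBdd (deltaHom C (res C (ψt t) (k - t) x)) (n₀ - k + t) := by
      intro t l' hl'
      refine (hx (ψt t) (k - t) l').trans ?_
      rw [show deltaC C (k - t + l') x = 0 from h₀ _ (by omega), map_zero]
    rw [res_E_mul C ψ j n k h₀ (M := M) (by omega), map_add, map_sum, hx,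
      deltaC_E_mul C j n (k + l) h₀ (M := M) (by omega), map_add, map_sum,
      hM₀ M (by omega), add_assoc, show k - n + l = k + l - n by ring]
    congr 1
    have e1 : ∀ t ∈ Finset.range M, deltaC C l (E C j (n - t) * res C (ψt t) (k - t) x) =
        tmul C (E C j (n - t)) 1 *
          twMap C (res C (ψt t) (k - t)) LinearMap.id (deltaC C (k + l - n) x) +
        ∑ u ∈ Finset.range M, tmul C (theta C j u) (E C j (n - (t + u : ℕ))) *
          twMap C (res C (ψt t) (k - t)) LinearMap.id (deltaC C (k + l - (t + u : ℕ)) x) := by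
      intro t _
      rw [deltaC_E_mul C j (n - t) l (hb t) (M := M) (by omega), hx,
        show k - (t : ℤ) + (l - (n - t)) = k + l - n by ring]
      congr 1
      refine Finset.sum_congr rfl fun u _ => ?_
      rw [hx]
      push_cast
      rw [show k - (t : ℤ) + (l - u) = k + l - (t + u) by ring,
        show n - (t : ℤ) - u = n - (t + u) by ring]
    rw [Finset.sum_congr rfl e1, Finset.sum_add_distrib]
    congr 1
    -- Grouping the double sum by s = t + u yields, for each s, the terms of the coproduct of θ_s,
    -- which is the form taken by the other side.
    rw [sum_range_antidiagonal M]
    · refine Finset.sum_congr rfl fun s _ => ?_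
      rw [twMap_res_theta]
      refine Finset.sum_congr rfl fun p hp => ?_
      rw [mem_antidiagonal.1 hp]
    · intro t u htu
      rw [show deltaC C (k + l - (t + u : ℕ)) x = 0 from h₀ _ (by omega), map_zero, mul_zero]

/-- The counit law. -/
theorem res_eps (k : ℤ) (x : U C) :
    res C (eps C).toLinearMap k x = if k = 0 then x else 0 := by
  induction x using U_induction generalizing k with
  | one => rw [res_one]; simp
  | add x y hx hy =>
    rw [map_add, hx, hy]
    split_ifs <;> simp
  | smul c x hx =>
    rw [map_smul, hx]
    split_ifs <;> simp
  | E_mul j n x hx =>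
    obtain ⟨n₀, h₀⟩ := exists_lowerBdd (deltaHom C x)
    have e0 : (eps C).toLinearMap ∘ₗ LinearMap.mulLeft K (E C j n) = 0 := by
      ext x; simp [eps_E]
    have e1 : ∀ t : ℕ, (eps C).toLinearMap ∘ₗ LinearMap.mulLeft K (theta C j t) ∘ₗ
        (tau C (root j)).toLinearMap = if t = 0 then (eps C).toLinearMap else 0 := by
      intro t
      ext x
      simp only [LinearMap.comp_apply, LinearMap.mulLeft_apply, AlgHom.toLinearMap_apply, map_mul,
        eps_theta, eps_tau]
      split_ifs <;> simp
    rw [res_E_mul C _ j n k h₀ (M := (k - n₀).toNat + 1) (by omega), e0, res_zero,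
      Finset.sum_eq_single 0]
    · rw [e1, if_pos rfl, Nat.cast_zero, sub_zero, sub_zero, hx]
      split_ifs <;> simp
    · intro t _ ht
      rw [e1, if_neg ht, res_zero]; simp
    · intro h; simp at h
  | H_mul j s x hx =>
    have e0 : (eps C).toLinearMap ∘ₗ LinearMap.mulLeft K (H C j s) = 0 := by
      ext x; simp [eps_H]
    rw [res_H_mul, e0, hx]
    rw [res_zero]
    split_ifs <;> simp

end

section

variable {N : ℕ} (C : CartanDatum N)

/-! ### The adjoint operators of the generators -/

/-- The adjoint of left multiplication by `E_{i,m}`. -/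
def dE (i : Fin N) (m : ℤ) : U C →ₗ[K] U C := res C (psi C i m) m

/-- The adjoint of left multiplication by `H_{i,s}`. -/
def dH (i : Fin N) (s : ℕ+) : U C →ₗ[K] U C := res C (psiH C i s) s

/-- The coefficients in the commutation relation of `dE` with left multiplications. -/
def gam (i j : Fin N) (t : ℕ) : K := pq C i j * gCoeff (pq C i j) t

theorem gam_symm (i j : Fin N) (t : ℕ) : gam C i j t = gam C j i t := by rw [gam, gam, pq_symm]

theorem dE_one (i : Fin N) (m : ℤ) : dE C i m 1 = 0 := by
  rw [dE, res_one, psi_one, zero_smul, ite_self]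

theorem dH_one (i : Fin N) (s : ℕ+) : dH C i s 1 = 0 := by
  rw [dH, res_one, psiH_one, zero_smul, ite_self]

theorem exists_dE_eq_zero (i : Fin N) (x : U C) : ∃ n₀ : ℤ, ∀ m < n₀, dE C i m x = 0 := by
  obtain ⟨n₀, h₀⟩ := exists_lowerBdd (deltaHom C x)
  refine ⟨n₀, fun m hm => ?_⟩
  rw [dE, res_apply, show deltaC C m x = 0 from h₀ m hm, map_zero]

/-- The summand E ⊗ 1 of Δ'(E_{j,n}) gives the Kronecker term, by the counit law; the summand θ_t ⊗
E_{j,n-t} gives `gam` by `psi_theta_tau`. Terms with large t vanish, hence the freedom in M. -/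
theorem dE_E_mul (i j : Fin N) (m n : ℤ) (x : U C) :
    ∃ M₀ : ℕ, ∀ M ≥ M₀, dE C i m (E C j n * x) = (if i = j ∧ n = m then cE • x else 0) +
      ∑ t ∈ Finset.range M, gam C i j t • (E C j (n - t) * dE C i (m - t) x) := by
  obtain ⟨n₀, h₀⟩ := exists_lowerBdd (deltaHom C x)
  refine ⟨(m - n₀ + 1).toNat, fun M hM => ?_⟩
  rw [dE, res_E_mul C _ j n m h₀ (M := M) (by omega)]
  congr 1
  · by_cases h : i = j ∧ n = m
    · rw [if_pos h]
      have : psi C i m ∘ₗ LinearMap.mulLeft K (E C j n) = cE • (eps C).toLinearMap :=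
        LinearMap.ext fun y => by
          rw [LinearMap.comp_apply, LinearMap.mulLeft_apply, psi_E_mul, if_pos h]; rfl
      rw [this, res_smul, res_eps, if_pos (by omega)]
    · rw [if_neg h]
      have : psi C i m ∘ₗ LinearMap.mulLeft K (E C j n) = 0 :=
        LinearMap.ext fun y => by
          rw [LinearMap.comp_apply, LinearMap.mulLeft_apply, psi_E_mul, if_neg h]; rfl
      rw [this, res_zero]
  · refine Finset.sum_congr rfl fun t _ => ?_
    have : psi C i m ∘ₗ LinearMap.mulLeft K (theta C j t) ∘ₗ (tau C (root j)).toLinearMap =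
        gam C i j t • psi C i (m - t) :=
      LinearMap.ext fun y => psi_theta_tau C i j t m y
    rw [this, res_smul, mul_smul_comm]
    rfl

theorem dE_H_mul (i j : Fin N) (m : ℤ) (s : ℕ+) (x : U C) :
    dE C i m (H C j s * x) = hE C i j s • dE C i (m - s) x + H C j s * dE C i m x := by
  rw [dE, res_H_mul]
  have : psi C i m ∘ₗ LinearMap.mulLeft K (H C j s) = hE C i j s • psi C i (m - s) :=
    LinearMap.ext fun y => psi_H_mul C i j s m y
  rw [this, res_smul]
  rfl

/-- Among the summands θ_t ⊗ E_{j,n-t} only t = 0 and t = s are seen by the form (H_{i,s}, -). -/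
theorem dH_E_mul (i j : Fin N) (s : ℕ+) (n : ℤ) (x : U C) :
    dH C i s (E C j n * x) = hE C i j s • (E C j (n - s) * x) + E C j n * dH C i s x := by
  obtain ⟨n₀, h₀⟩ := exists_lowerBdd (deltaHom C x)
  have e0 : psiH C i s ∘ₗ LinearMap.mulLeft K (E C j n) = 0 :=
    LinearMap.ext fun y => psiH_E_mul C i j s n y
  have e1 : ∀ t : ℕ, res C (psiH C i s ∘ₗ LinearMap.mulLeft K (theta C j t) ∘ₗ
      (tau C (root j)).toLinearMap) (s - t) x =
      (if t = s then hE C i j s • x else 0) + if t = 0 then dH C i s x else 0 := by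
    intro t
    have : psiH C i s ∘ₗ LinearMap.mulLeft K (theta C j t) ∘ₗ (tau C (root j)).toLinearMap =
        (if t = s then hE C i j s • (eps C).toLinearMap else 0) +
          if t = 0 then psiH C i s else 0 := LinearMap.ext fun y => by
      simp only [LinearMap.comp_apply, LinearMap.mulLeft_apply, AlgHom.toLinearMap_apply,
        psiH_theta_mul, eps_tau, psiH_tau, LinearMap.add_apply]
      split_ifs <;> rfl
    rw [this, res_add]
    congr 1
    · split_ifs with h
      · rw [res_smul, res_eps, if_pos (by rw [h]; simp)]
      · rw [res_zero]
    · split_ifs with h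
      · rw [h, Nat.cast_zero, sub_zero]; rfl
      · rw [res_zero]
  rw [dH, res_E_mul C _ j n s h₀ (M := (s - n₀ + 1).toNat + s + 1) (by omega), e0, res_zero,
    zero_add]
  simp only [e1, mul_add, Finset.sum_add_distrib, mul_ite, mul_zero]
  rw [Finset.sum_ite_eq', Finset.sum_ite_eq', if_pos (by rw [Finset.mem_range]; omega),
    if_pos (by rw [Finset.mem_range]; omega), mul_smul_comm, Nat.cast_zero, sub_zero]
  rfl

theorem dH_H_mul (i j : Fin N) (s t : ℕ+) (x : U C) :
    dH C i s (H C j t * x) = (if s = t then cH C i j s • x else 0) + H C j t * dH C i s x := by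
  rw [dH, res_H_mul]
  congr 1
  split_ifs with h
  · have : psiH C i s ∘ₗ LinearMap.mulLeft K (H C j t) = cH C i j s • (eps C).toLinearMap :=
      LinearMap.ext fun y => by
        rw [LinearMap.comp_apply, LinearMap.mulLeft_apply, psiH_H_mul, if_pos h]; rfl
    rw [this, res_smul, res_eps, if_pos (by rw [h]; simp)]
  · have : psiH C i s ∘ₗ LinearMap.mulLeft K (H C j t) = 0 :=
      LinearMap.ext fun y => by
        rw [LinearMap.comp_apply, LinearMap.mulLeft_apply, psiH_H_mul, if_neg h]; rfl
    rw [this, res_zero]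

/-- The adjoint of left multiplication by a generator. -/
def dGen : Gen N → Module.End K (U C)
  | Gen.E i m => dE C i m
  | Gen.H i s => dH C i s

/-- The degree of a generator. -/
def degGen : Gen N → ℤ
  | Gen.E _ m => m
  | Gen.H _ s => s

theorem dGen_one (g : Gen N) : dGen C g 1 = 0 := by
  cases g with
  | E i m => exact dE_one C i m
  | H i s => exact dH_one C i s

theorem deltaC_dGen (g : Gen N) (l : ℤ) (x : U C) : deltaC C l (dGen C g x) =
    twMap C (dGen C g) LinearMap.id (deltaC C (degGen g + l) x) := by
  cases g with
  | E i m => exact deltaC_res C _ _ l x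
  | H i s => exact deltaC_res C _ _ l x

/-! ### The bilinear form -/

/-- The adjoint of left multiplication by (the image of) an element of the free algebra. -/
def adj (w : FreeAlgebra K (Gen N)) : Module.End K (U C) :=
  (FreeAlgebra.lift K (fun g => MulOpposite.op (dGen C g)) w).unop

theorem adj_one : adj C 1 = 1 := by rw [adj, map_one]; rfl

theorem adj_add (w w' : FreeAlgebra K (Gen N)) : adj C (w + w') = adj C w + adj C w' := by
  rw [adj, map_add]; rfl

theorem adj_smul (c : K) (w : FreeAlgebra K (Gen N)) : adj C (c • w) = c • adj C w := by
  rw [adj, map_smul]; rfl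

theorem adj_mul (w w' : FreeAlgebra K (Gen N)) (x : U C) :
    adj C (w * w') x = adj C w' (adj C w x) := by
  rw [adj, map_mul]; rfl

theorem adj_ι (g : Gen N) : adj C (FreeAlgebra.ι K g) = dGen C g := by
  rw [adj, FreeAlgebra.lift_ι_apply]; rfl

/-- The linear form `(-, w)`. -/
def beta (w : FreeAlgebra K (Gen N)) : U C →ₗ[K] K := (eps C).toLinearMap ∘ₗ adj C w

theorem beta_apply (w : FreeAlgebra K (Gen N)) (x : U C) : beta C w x = eps C (adj C w x) := rfl

theorem beta_one (x : U C) : beta C 1 x = eps C x := by rw [beta_apply, adj_one]; rfl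

theorem beta_add (w w' : FreeAlgebra K (Gen N)) (x : U C) :
    beta C (w + w') x = beta C w x + beta C w' x := by
  rw [beta_apply, adj_add]; exact map_add (eps C) _ _

theorem beta_smul (c : K) (w : FreeAlgebra K (Gen N)) (x : U C) :
    beta C (c • w) x = c * beta C w x := by
  rw [beta_apply, adj_smul]; exact map_smul (eps C) _ _

theorem beta_zero (x : U C) : beta C 0 x = 0 := by
  have := beta_smul C 0 0 x
  rwa [zero_smul, zero_mul] at this

theorem beta_sum {ι : Type*} (s : Finset ι) (f : ι → FreeAlgebra K (Gen N)) (x : U C) :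
    beta C (∑ a ∈ s, f a) x = ∑ a ∈ s, beta C (f a) x := by
  classical
  induction s using Finset.induction_on with
  | empty => rw [Finset.sum_empty, Finset.sum_empty, beta_zero]
  | insert a s ha ih => rw [Finset.sum_insert ha, Finset.sum_insert ha, beta_add, ih]

theorem beta_ι_mul (g : Gen N) (w : FreeAlgebra K (Gen N)) (x : U C) :
    beta C (FreeAlgebra.ι K g * w) x = beta C w (dGen C g x) := by
  rw [beta_apply, adj_mul, adj_ι]; rfl

theorem proj_ι_mul (g : Gen N) (w : FreeAlgebra K (Gen N)) :
    proj C (FreeAlgebra.ι K g * w) = gen C g * proj C w := by rw [map_mul, proj_ι]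

/-- Lifts to the free algebra of the elements `dGen g w`, compatible with the form. -/
structure IsDeriv (w : FreeAlgebra K (Gen N)) (D : Gen N → FreeAlgebra K (Gen N)) : Prop where
  proj_eq : ∀ g, proj C (D g) = dGen C g (proj C w)
  beta_eq : ∀ g x, beta C w (gen C g * x) = beta C (D g) x
  bdd : ∀ j, ∃ n₀ : ℤ, ∀ n < n₀, D (Gen.E j n) = 0

variable {C}

/-- `D'` copies the formulas `dE_E_mul` and `dH_E_mul` into the free algebra. Since `gam` and `hE`
are symmetric in i and j, the same element works both as the lift of `dGen g` applied to E_{i,m} w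
and as the result of moving g across the form. The field `bdd` makes the sum over t finite. -/
theorem IsDeriv.E_mul {w : FreeAlgebra K (Gen N)} {D : Gen N → FreeAlgebra K (Gen N)}
    (h : IsDeriv C w D) (i : Fin N) (m : ℤ) :
    ∃ D', IsDeriv C (FreeAlgebra.ι K (Gen.E i m) * w) D' := by
  choose b hb using h.bdd
  let T : Fin N → ℤ → ℕ → FreeAlgebra K (Gen N) := fun j n t =>
    gam C i j t • (FreeAlgebra.ι K (Gen.E i (m - t)) * D (Gen.E j (n - t)))
  let bd : Fin N → ℤ → ℕ := fun j n => (n - b j + 1).toNat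
  have hT : ∀ j n t, bd j n ≤ t → T j n t = 0 := by
    intro j n t ht
    simp only [T]
    rw [hb j _ (by simp only [bd] at ht; omega), mul_zero, smul_zero]
  have hsum : ∀ j n M, bd j n ≤ M →
      ∑ t ∈ Finset.range (bd j n), T j n t = ∑ t ∈ Finset.range M, T j n t := by
    intro j n M hM
    refine Finset.sum_subset (Finset.range_mono hM) fun t _ ht => hT j n t ?_
    rw [Finset.mem_range] at ht; omega
  let D' : Gen N → FreeAlgebra K (Gen N) := fun g => match g with
    | Gen.E j n => (if i = j ∧ n = m then cE • w else 0) + ∑ t ∈ Finset.range (bd j n), T j n t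
    | Gen.H j s => FreeAlgebra.ι K (Gen.E i m) * D (Gen.H j s) +
        hE C i j s • (FreeAlgebra.ι K (Gen.E i (m - s)) * w)
  refine ⟨D', ⟨fun g => ?_, fun g x => ?_, fun j => ?_⟩⟩
  · cases g with
    | E j n =>
      change proj C ((if i = j ∧ n = m then cE • w else 0) +
        ∑ t ∈ Finset.range (bd j n), T j n t) = dE C j n (proj C _)
      obtain ⟨M₀, hM₀⟩ := dE_E_mul C j i n m (proj C w)
      rw [proj_ι_mul]
      change _ = dE C j n (E C i m * proj C w)
      rw [hM₀ (max M₀ (bd j n)) (le_max_left _ _), hsum j n _ (le_max_right M₀ (bd j n)), map_add,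
        map_sum]
      congr 1
      · by_cases hc : i = j ∧ n = m
        · rw [if_pos hc, if_pos ⟨hc.1.symm, hc.2.symm⟩, map_smul]
        · rw [if_neg hc, if_neg fun h => hc ⟨h.1.symm, h.2.symm⟩, map_zero]
      · refine Finset.sum_congr rfl fun t _ => ?_
        simp only [T]
        rw [map_smul, proj_ι_mul, h.proj_eq, gam_symm]
        rfl
    | H j s =>
      change proj C (_ + _) = dH C j s (proj C _)
      rw [proj_ι_mul, map_add, map_smul, proj_ι_mul, proj_ι_mul, h.proj_eq]
      change _ = dH C j s (E C i m * proj C w)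
      rw [dH_E_mul, hE_symm, add_comm]
      rfl
  · rw [beta_ι_mul]
    cases g with
    | E j n =>
      change beta C w (dE C i m (E C j n * x)) = beta C ((if i = j ∧ n = m then cE • w else 0) +
        ∑ t ∈ Finset.range (bd j n), T j n t) x
      obtain ⟨M₀, hM₀⟩ := dE_E_mul C i j m n x
      rw [hM₀ (max M₀ (bd j n)) (le_max_left _ _), hsum j n _ (le_max_right M₀ (bd j n)), map_add,
        map_sum, beta_add, beta_sum]
      congr 1
      · split_ifs
        · rw [map_smul, beta_smul, smul_eq_mul]
        · rw [map_zero, beta_zero]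
      · refine Finset.sum_congr rfl fun t _ => ?_
        simp only [T]
        rw [map_smul, beta_smul, beta_ι_mul, smul_eq_mul]
        exact congrArg _ (h.beta_eq (Gen.E j (n - t)) _)
    | H j s =>
      change beta C w (dE C i m (H C j s * x)) = beta C (_ + _) x
      rw [dE_H_mul, map_add, map_smul, beta_add, beta_smul, beta_ι_mul, beta_ι_mul, add_comm]
      congr 1
      exact h.beta_eq (Gen.H j s) _
  · refine ⟨min m (b j), fun n hn => ?_⟩
    have h1 : n < m := lt_of_lt_of_le hn (min_le_left _ _)
    have h2 : n < b j := lt_of_lt_of_le hn (min_le_right _ _)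
    change (if i = j ∧ n = m then cE • w else 0) + ∑ t ∈ Finset.range (bd j n), T j n t = 0
    rw [if_neg (by omega), show bd j n = 0 by simp only [bd]; omega, Finset.range_zero,
      Finset.sum_empty, add_zero]

theorem IsDeriv.H_mul {w : FreeAlgebra K (Gen N)} {D : Gen N → FreeAlgebra K (Gen N)}
    (h : IsDeriv C w D) (i : Fin N) (s : ℕ+) :
    ∃ D', IsDeriv C (FreeAlgebra.ι K (Gen.H i s) * w) D' := by
  let D' : Gen N → FreeAlgebra K (Gen N) := fun g => match g with
    | Gen.E j n => hE C i j s • D (Gen.E j (n - s)) + FreeAlgebra.ι K (Gen.H i s) * D (Gen.E j n)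
    | Gen.H j t => (if s = t then cH C i j s • w else 0) +
        FreeAlgebra.ι K (Gen.H i s) * D (Gen.H j t)
  refine ⟨D', ⟨fun g => ?_, fun g x => ?_, fun j => ?_⟩⟩
  · cases g with
    | E j n =>
      change proj C (_ + _) = dE C j n (proj C _)
      rw [proj_ι_mul, map_add, map_smul, proj_ι_mul, h.proj_eq, h.proj_eq]
      change _ = dE C j n (H C i s * proj C w)
      rw [dE_H_mul, hE_symm]
      rfl
    | H j t =>
      change proj C (_ + _) = dH C j t (proj C _)
      rw [proj_ι_mul, map_add, proj_ι_mul, h.proj_eq]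
      change _ = dH C j t (H C i s * proj C w)
      rw [dH_H_mul]
      congr 1
      by_cases hst : s = t
      · rw [if_pos hst, if_pos hst.symm, map_smul, cH_symm, hst]
      · rw [if_neg hst, if_neg fun h => hst h.symm, map_zero]
  · rw [beta_ι_mul]
    cases g with
    | E j n =>
      change beta C w (dH C i s (E C j n * x)) = beta C (_ + _) x
      rw [dH_E_mul, map_add, map_smul, beta_add, beta_smul, beta_ι_mul, smul_eq_mul]
      congr 1
      · exact congrArg _ (h.beta_eq (Gen.E j (n - s)) x)
      · exact h.beta_eq (Gen.E j n) _
    | H j t =>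
      change beta C w (dH C i s (H C j t * x)) = beta C (_ + _) x
      rw [dH_H_mul, map_add, beta_add, beta_ι_mul]
      congr 1
      · split_ifs
        · rw [map_smul, beta_smul, smul_eq_mul]
        · rw [map_zero, beta_zero]
      · exact h.beta_eq (Gen.H j t) _
  · obtain ⟨n₀, h₀⟩ := h.bdd j
    refine ⟨n₀, fun n hn => ?_⟩
    change hE C i j s • D (Gen.E j (n - s)) + FreeAlgebra.ι K (Gen.H i s) * D (Gen.E j n) = 0
    rw [h₀ n hn, h₀ (n - s) (by have := s.pos; omega), smul_zero, mul_zero, add_zero]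

variable (C)

theorem exists_isDeriv (w : FreeAlgebra K (Gen N)) : ∃ D, IsDeriv C w D := by
  induction w using free_induction with
  | one =>
    refine ⟨fun _ => 0, ⟨fun g => ?_, fun g x => ?_, fun j => ⟨0, fun _ _ => rfl⟩⟩⟩
    · rw [map_zero, map_one, dGen_one]
    · rw [beta_one, beta_zero, map_mul]
      cases g with
      | E i m => exact (congrArg (· * _) (eps_E C i m)).trans (zero_mul _)
      | H i s => exact (congrArg (· * _) (eps_H C i s)).trans (zero_mul _)
  | add w w' h h' =>
    obtain ⟨D, hD⟩ := h
    obtain ⟨D', hD'⟩ := h'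
    refine ⟨fun g => D g + D' g, ⟨fun g => ?_, fun g x => ?_, fun j => ?_⟩⟩
    · rw [map_add, map_add, map_add, hD.proj_eq, hD'.proj_eq]
    · rw [beta_add, beta_add, hD.beta_eq, hD'.beta_eq]
    · obtain ⟨n₀, h₀⟩ := hD.bdd j
      obtain ⟨n₁, h₁⟩ := hD'.bdd j
      refine ⟨min n₀ n₁, fun n hn => ?_⟩
      rw [h₀ n (lt_of_lt_of_le hn (min_le_left _ _)), h₁ n (lt_of_lt_of_le hn (min_le_right _ _)),
        add_zero]
  | smul c w h =>
    obtain ⟨D, hD⟩ := h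
    refine ⟨fun g => c • D g, ⟨fun g => ?_, fun g x => ?_, fun j => ?_⟩⟩
    · rw [map_smul, map_smul, map_smul, hD.proj_eq]
    · rw [beta_smul, beta_smul, hD.beta_eq]
    · obtain ⟨n₀, h₀⟩ := hD.bdd j
      exact ⟨n₀, fun n hn => by rw [h₀ n hn, smul_zero]⟩
  | gen_mul g w h =>
    obtain ⟨D, hD⟩ := h
    cases g with
    | E i m => exact hD.E_mul i m
    | H i s => exact hD.H_mul i s

theorem beta_apply_one (w : FreeAlgebra K (Gen N)) : beta C w 1 = eps C (proj C w) := by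
  induction w using free_induction with
  | one => rw [beta_one, map_one (proj C)]
  | add w w' h h' => rw [beta_add, h, h', map_add, map_add]
  | smul c w h => rw [beta_smul, h, map_smul, map_smul, smul_eq_mul]
  | gen_mul g w h =>
    rw [beta_ι_mul, dGen_one, map_zero, proj_ι_mul, map_mul]
    cases g with
    | E i m => exact ((congrArg (· * _) (eps_E C i m)).trans (zero_mul _)).symm
    | H i s => exact ((congrArg (· * _) (eps_H C i s)).trans (zero_mul _)).symm

/-- Induction on x: a generator on the left of x is moved to the other argument by `IsDeriv`, where
the class of the new argument depends only on the class of the old one; for x = 1 the form is the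
counit. Thus the adjoint operators never have to be checked against the defining relations. -/
theorem beta_eq_of_proj_eq {w w' : FreeAlgebra K (Gen N)} (h : proj C w = proj C w') :
    beta C w = beta C w' := by
  refine LinearMap.ext fun x => ?_
  have step : ∀ (g : Gen N) (x : U C), (∀ w w' : FreeAlgebra K (Gen N), proj C w = proj C w' →
      beta C w x = beta C w' x) → ∀ w w' : FreeAlgebra K (Gen N), proj C w = proj C w' →
      beta C w (gen C g * x) = beta C w' (gen C g * x) := by
    intro g x ih w w' h
    obtain ⟨D, hD⟩ := exists_isDeriv C w
    obtain ⟨D', hD'⟩ := exists_isDeriv C w'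
    rw [hD.beta_eq, hD'.beta_eq]
    exact ih _ _ (by rw [hD.proj_eq, hD'.proj_eq, h])
  induction x using U_induction generalizing w w' with
  | one => rw [beta_apply_one, beta_apply_one, h]
  | add x y hx hy => rw [map_add, map_add, hx h, hy h]
  | smul c x hx => rw [map_smul, map_smul, hx h]
  | E_mul i l x hx => exact step (Gen.E i l) x (fun _ _ h => hx h) w w' h
  | H_mul i s x hx => exact step (Gen.H i s) x (fun _ _ h => hx h) w _ h

/-- A linear form in `x`, linear in `y`: the value `(x, y)` of the Hopf pairing. -/
def formB : LinearMap.BilinForm K (U C) :=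
  LinearMap.mk₂ K (fun x y => beta C (Function.surjInv (proj_surjective C) y) x)
    (fun x x' y => map_add _ x x') (fun c x y => map_smul _ c x)
    (fun x y y' => by
      rw [← beta_add]
      exact LinearMap.congr_fun (beta_eq_of_proj_eq C (by
        simp only [map_add, Function.surjInv_eq (proj_surjective C)])) x)
    (fun c x y => by
      rw [smul_eq_mul, ← beta_smul]
      exact LinearMap.congr_fun (beta_eq_of_proj_eq C (by
        simp only [map_smul, Function.surjInv_eq (proj_surjective C)])) x)

theorem formB_proj (x : U C) (w : FreeAlgebra K (Gen N)) : formB C x (proj C w) = beta C w x :=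
  LinearMap.congr_fun (beta_eq_of_proj_eq C (Function.surjInv_eq (proj_surjective C) _)) x

theorem formB_one_right (x : U C) : formB C x 1 = eps C x := by
  rw [← map_one (proj C), formB_proj, beta_one]

theorem formB_one_left (y : U C) : formB C 1 y = eps C y := by
  obtain ⟨w, rfl⟩ := proj_surjective C y
  rw [formB_proj, beta_apply_one]

theorem formB_gen_mul_right (g : Gen N) (x y : U C) :
    formB C x (gen C g * y) = formB C (dGen C g x) y := by
  obtain ⟨w, rfl⟩ := proj_surjective C y
  rw [← proj_ι_mul, formB_proj, beta_ι_mul, formB_proj]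

theorem formB_gen_mul_left (g : Gen N) (x y : U C) :
    formB C (gen C g * x) y = formB C x (dGen C g y) := by
  obtain ⟨w, rfl⟩ := proj_surjective C y
  obtain ⟨D, hD⟩ := exists_isDeriv C w
  rw [formB_proj, hD.beta_eq, ← formB_proj, hD.proj_eq]

theorem formB_symm (x y : U C) : formB C x y = formB C y x := by
  induction x using U_induction generalizing y with
  | one => rw [formB_one_left, formB_one_right]
  | add x x' hx hx' => rw [map_add, map_add, LinearMap.add_apply, hx, hx']
  | smul c x hx => rw [map_smul, map_smul, LinearMap.smul_apply, hx]
  | E_mul i l x hx =>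
    exact (formB_gen_mul_left C (Gen.E i l) x y).trans
      ((hx _).trans (formB_gen_mul_right C (Gen.E i l) y x).symm)
  | H_mul i s x hx =>
    exact (formB_gen_mul_left C (Gen.H i s) x y).trans
      ((hx _).trans (formB_gen_mul_right C (Gen.H i s) y x).symm)

/-- The adjoint of left multiplication by `w`, in terms of the coproduct. -/
theorem res_beta (w : FreeAlgebra K (Gen N)) (x : U C) :
    (Function.support fun k : ℤ => res C (beta C w) k x).Finite ∧
      ∑ᶠ k : ℤ, res C (beta C w) k x = adj C w x := by
  induction w using free_induction generalizing x with
  | one =>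
    have h : ∀ k, res C (beta C 1) k x = if k = 0 then x else 0 := by
      intro k
      rw [← res_eps]
      congr 2
      exact LinearMap.ext fun y => beta_one C y
    refine ⟨(Set.finite_singleton (0 : ℤ)).subset fun k hk => ?_, ?_⟩
    · by_contra h0
      exact hk (by simp only [h]; exact if_neg h0)
    · rw [finsum_eq_single _ 0 fun k hk => by rw [h, if_neg hk], h, if_pos rfl, adj_one]; rfl
  | add w w' hw hw' =>
    have h : ∀ k, res C (beta C (w + w')) k x = res C (beta C w) k x + res C (beta C w') k x := by
      intro k
      rw [← res_add]
      congr 2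
      exact LinearMap.ext fun y => beta_add C w w' y
    simp only [h]
    refine ⟨((hw x).1.union (hw' x).1).subset (Function.support_add _ _), ?_⟩
    rw [finsum_add_distrib (hw x).1 (hw' x).1, (hw x).2, (hw' x).2, adj_add]; rfl
  | smul c w hw =>
    have h : ∀ k, res C (beta C (c • w)) k x = c • res C (beta C w) k x := by
      intro k
      rw [← res_smul]
      congr 2
      exact LinearMap.ext fun y => beta_smul C c w y
    simp only [h]
    refine ⟨(hw x).1.subset (Function.support_const_smul_subset c _), ?_⟩
    rw [← smul_finsum' c (hw x).1, (hw x).2, adj_smul]; rfl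
  | gen_mul g w hw =>
    -- By coassociativity the first generator of the word acts first and takes up its own degree;
    -- the translation of k does not affect the sum over all integers.
    have h : ∀ k, res C (beta C (FreeAlgebra.ι K g * w)) k x =
        res C (beta C w) (k - degGen g) (dGen C g x) := by
      intro k
      rw [res_apply, res_apply, deltaC_dGen, add_sub_cancel]
      induction deltaC C k x using Tw_induction with
      | zero => simp only [map_zero]
      | add X Y hX hY => simp only [map_add, hX, hY]
      | tm a b => rw [twMap_tmul, contr_tmul, contr_tmul, beta_ι_mul]; rfl
    simp only [h]
    refine ⟨?_, ?_⟩
    · exact (hw (dGen C g x)).1.preimage (Equiv.subRight (degGen g)).injective.injOn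
    · rw [adj_mul, adj_ι, ← (hw (dGen C g x)).2]
      exact finsum_comp_equiv (Equiv.subRight (degGen g))
        (f := fun k => res C (beta C w) k (dGen C g x))

theorem pair_eq (B : LinearMap.BilinForm K (U C)) (y z : U C) (Y : Tw C) :
    pair B y z Y = B (contr C (B.flip y) Y) z := by
  induction Y using Tw_induction with
  | zero => simp only [map_zero, LinearMap.zero_apply]
  | add X Y hX hY => simp only [map_add, hX, hY, LinearMap.add_apply]
  | tm a b =>
    rw [contr_tmul, map_smul, LinearMap.smul_apply]
    rfl

theorem formB_flip_proj (w : FreeAlgebra K (Gen N)) : (formB C).flip (proj C w) = beta C w :=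
  LinearMap.ext fun x => formB_proj C x w

theorem pair_deltaC (w : FreeAlgebra K (Gen N)) (x z : U C) (k : ℤ) :
    pair (formB C) (proj C w) z (deltaC C k x) = formB C (res C (beta C w) k x) z := by
  rw [pair_eq, formB_flip_proj]; rfl

theorem isHopfPairing_formB : IsHopfPairing (deltaHom C).toLinearMap (formB C) where
  symm := formB_symm C
  one_one := by rw [formB_one_left, map_one]
  one_E i k := by rw [formB_one_left, eps_E]
  one_H i m := by rw [formB_one_left, eps_H]
  E_E i j k l := by
    have := formB_gen_mul_left C (Gen.E i k) 1 (E C j l)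
    rw [mul_one, formB_one_left] at this
    refine this.trans ?_
    obtain ⟨M₀, h⟩ := dE_E_mul C i j k l 1
    rw [mul_one] at h
    change eps C (dE C i k (E C j l)) = _
    have h0 : ∀ t ∈ Finset.range M₀, gam C i j t • (E C j (l - t) * dE C i (k - t) 1) = 0 :=
      fun t _ => by rw [dE_one, mul_zero, smul_zero]
    rw [h M₀ le_rfl, Finset.sum_eq_zero h0, add_zero]
    by_cases hc : i = j ∧ k = l
    · rw [if_pos hc, if_pos ⟨hc.1, hc.2.symm⟩, map_smul, map_one, smul_eq_mul, mul_one]; rfl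
    · rw [if_neg hc, if_neg fun h => hc ⟨h.1, h.2.symm⟩, map_zero]
  H_H i j m n := by
    have := formB_gen_mul_left C (Gen.H i m) 1 (H C j n)
    rw [mul_one, formB_one_left] at this
    refine this.trans ?_
    have h := dH_H_mul C i j m n 1
    rw [mul_one, dH_one, mul_zero, add_zero] at h
    change eps C (dH C i m (H C j n)) = _
    rw [h]
    split_ifs
    · rw [map_smul, map_one, smul_eq_mul, mul_one]; rfl
    · rw [map_zero]
  E_H i j k m := by
    have := formB_gen_mul_right C (Gen.H j m) (E C i k) 1
    rw [mul_one, formB_one_right] at this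
    refine this.trans ?_
    have h := dH_E_mul C j i m k 1
    rw [mul_one, mul_one, dH_one, mul_zero, add_zero] at h
    change eps C (dH C j m (E C i k)) = _
    rw [h, map_smul, eps_E, smul_zero]
  hopf_finite x y z := by
    obtain ⟨w, rfl⟩ := proj_surjective C y
    refine (res_beta C w x).1.subset fun k hk h0 => hk ?_
    change pair (formB C) (proj C w) z (deltaC C k x) = 0
    rw [pair_deltaC]
    simp only at h0
    rw [h0, map_zero, LinearMap.zero_apply]
  hopf x y z := by
    obtain ⟨w, rfl⟩ := proj_surjective C y
    obtain ⟨w', rfl⟩ := proj_surjective C z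
    rw [← map_mul, formB_proj, beta_apply, adj_mul, ← beta_apply, ← (res_beta C w x).2,
      map_finsum (beta C w') (res_beta C w x).1]
    refine finsum_congr fun k => ?_
    change _ = pair (formB C) (proj C w) (proj C w') (deltaC C k x)
    rw [pair_deltaC, formB_proj]

end

section

variable {N : ℕ} {C : CartanDatum N}

/-! ### Uniqueness of the pairing -/

theorem pair_tmul (B : LinearMap.BilinForm K (U C)) (y z a b : U C) :
    pair B y z (tmul C a b) = B a y * B b z := TensorProduct.lift.tmul a b

theorem finsum_single (L : Tw C →ₗ[K] K) (n : ℤ) (X : Tw C) :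
    ∑ᶠ k : ℤ, L ((HahnSeries.single n X : CTw C).coeff k) = L X := by
  rw [finsum_eq_single _ n fun k hk => by rw [HahnSeries.coeff_single_of_ne hk, map_zero],
    HahnSeries.coeff_single_same]

theorem finite_single (L : Tw C →ₗ[K] K) (n : ℤ) (X : Tw C) :
    (Function.support fun k : ℤ => L ((HahnSeries.single n X : CTw C).coeff k)).Finite := by
  refine (Set.finite_singleton n).subset fun k hk => ?_
  by_contra h
  exact hk (by simp only; rw [HahnSeries.coeff_single_of_ne h, map_zero])

section Uniqueness

variable {B B' : LinearMap.BilinForm K (U C)}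

theorem IsHopfPairing.one_mul (h : IsHopfPairing (deltaHom C).toLinearMap B) (y z : U C) :
    B 1 (y * z) = B 1 y * B 1 z := by
  rw [h.hopf]
  simp only [AlgHom.toLinearMap_apply, map_one]
  exact (finsum_single (pair B y z) 0 (tmul C 1 1)).trans (pair_tmul B y z 1 1)

theorem IsHopfPairing.H_mul (h : IsHopfPairing (deltaHom C).toLinearMap B) (i : Fin N) (s : ℕ+)
    (y z : U C) : B (H C i s) (y * z) = B (H C i s) y * B 1 z + B 1 y * B (H C i s) z := by
  rw [h.hopf]
  simp only [AlgHom.toLinearMap_apply, deltaHom_H, HahnSeries.coeff_add, map_add]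
  rw [finsum_add_distrib (finite_single _ _ _) (finite_single _ _ _), finsum_single, finsum_single,
    pair_tmul, pair_tmul]

theorem IsHopfPairing.E_mul_eq (h : IsHopfPairing (deltaHom C).toLinearMap B)
    (h' : IsHopfPairing (deltaHom C).toLinearMap B') (i : Fin N) (n : ℤ) {y z : U C}
    (h1 : ∀ n, B (E C i n) y = B' (E C i n) y) (h2 : B 1 z = B' 1 z)
    (h3 : ∀ t, B (theta C i t) y = B' (theta C i t) y)
    (h4 : ∀ n, B (E C i n) z = B' (E C i n) z) :
    B (E C i n) (y * z) = B' (E C i n) (y * z) := by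
  rw [h.hopf, h'.hopf]
  refine finsum_congr fun k => ?_
  rw [(isCoproduct_deltaHom C).map_E, map_add, map_add]
  congr 1
  · split_ifs
    · rw [pair_tmul, pair_tmul, h1, h2]
    · rw [map_zero, map_zero]
  · split_ifs
    · rw [pair_tmul, pair_tmul, h3, h4]
    · rw [map_zero, map_zero]

/-- The values are pinned down with the first argument equal to 1, then H, then E. The last case
needs (E, θ) and (H, θ) beforehand, as Δ'(E) involves θ. A general first argument then follows by
induction on the second. -/
theorem IsHopfPairing.unique (h : IsHopfPairing (deltaHom C).toLinearMap B)
    (h' : IsHopfPairing (deltaHom C).toLinearMap B') : B = B' := by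
  have u1 : ∀ x, B 1 x = B' 1 x := by
    intro x
    induction x using U_induction with
    | one => rw [h.one_one, h'.one_one]
    | add x y hx hy => rw [map_add, map_add, hx, hy]
    | smul c x hx => rw [map_smul, map_smul, hx]
    | E_mul i l x hx => rw [h.one_mul, h'.one_mul, h.one_E, h'.one_E, zero_mul, zero_mul]
    | H_mul i s x hx => rw [h.one_mul, h'.one_mul, h.one_H, h'.one_H, zero_mul, zero_mul]
  have uH : ∀ i s x, B (H C i s) x = B' (H C i s) x := by
    intro i s x
    induction x using U_induction with
    | one => rw [h.symm, h'.symm, u1]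
    | add x y hx hy => rw [map_add, map_add, hx, hy]
    | smul c x hx => rw [map_smul, map_smul, hx]
    | E_mul j l x hx =>
      have hE : B (H C i s) (E C j l) = 0 := by rw [h.symm, h.E_H]
      have hE' : B' (H C i s) (E C j l) = 0 := by rw [h'.symm, h'.E_H]
      rw [h.H_mul, h'.H_mul, u1, u1, hx, hE, hE']
    | H_mul j t x hx => rw [h.H_mul, h'.H_mul, u1, u1, hx, h.H_H, h'.H_H]
  have e1 : ∀ i n, B (E C i n) 1 = B' (E C i n) 1 := fun i n => by rw [h.symm, h'.symm, u1]
  have uθ : ∀ i t j n, B (E C j n) (theta C i t) = B' (E C j n) (theta C i t) := by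
    intro i t j
    refine theta_induction C i (P := fun _ x => ∀ n, B (E C j n) x = B' (E C j n) x) (e1 j)
      (fun m hm ih n => ?_) t
    rw [map_smul, map_smul, map_sum, map_sum]
    congr 1
    refine Finset.sum_congr rfl fun p hp => ?_
    rw [mem_antidiagonal] at hp
    rcases Nat.eq_zero_or_pos p.1 with h0 | h0
    · rw [h0, Nat.cast_zero, zero_smul, map_zero, map_zero]
    · obtain ⟨s, hs⟩ : ∃ s : ℕ+, (s : ℕ) = p.1 := ⟨⟨p.1, h0⟩, rfl⟩
      rw [map_smul, map_smul, ← hs, hCoeff_pos, smul_mul_assoc, map_smul, map_smul,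
        h.E_mul_eq h' j n (fun n => by rw [h.E_H, h'.E_H]) (u1 _)
          (fun t => by rw [h.symm, h'.symm, uH]) (ih p.2 (by omega))]
  have uE : ∀ i n x, B (E C i n) x = B' (E C i n) x := by
    intro i n x
    induction x using U_induction generalizing n with
    | one => exact e1 i n
    | add x y hx hy => rw [map_add, map_add, hx, hy]
    | smul c x hx => rw [map_smul, map_smul, hx]
    | E_mul j l x hx =>
      exact h.E_mul_eq h' i n (fun n => by rw [h.E_E, h'.E_E]) (u1 x)
        (fun t => by rw [h.symm, h'.symm, uθ]) hx
    | H_mul j s x hx =>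
      exact h.E_mul_eq h' i n (fun n => by rw [h.E_H, h'.E_H]) (u1 x)
        (fun t => by rw [h.symm, h'.symm, uH]) hx
  have step : ∀ g z : U C, (∀ a, B a g = B' a g) → (∀ a, B a z = B' a z) →
      ∀ x, B x (g * z) = B' x (g * z) := by
    intro g z hg hz x
    rw [h.hopf, h'.hopf]
    refine finsum_congr fun k => ?_
    induction ((deltaHom C).toLinearMap x).coeff k using Tw_induction with
    | zero => rw [map_zero, map_zero]
    | add X Y hX hY => rw [map_add, map_add, hX, hY]
    | tm a b => rw [pair_tmul, pair_tmul, hg, hz]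
  refine LinearMap.ext fun x => LinearMap.ext fun y => ?_
  induction y using U_induction generalizing x with
  | one => rw [h.symm, h'.symm, u1]
  | add y y' hy hy' => rw [map_add, map_add, hy, hy']
  | smul c y hy => rw [map_smul, map_smul, hy]
  | E_mul i l y hy => exact step _ _ (fun a => by rw [h.symm, h'.symm, uE]) hy x
  | H_mul i s y hy => exact step _ _ (fun a => by rw [h.symm, h'.symm, uH]) hy x

end Uniqueness

/-! ### The operators `F'` -/

/-- By `res_beta` the operator is recovered from the linear form `beta C w` and the coproduct, and
the form depends only on the class of w. Hence the adjoint operators satisfy all relations of `U` in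
reversed order. -/
theorem adj_eq_of_proj_eq {w w' : FreeAlgebra K (Gen N)} (h : proj C w = proj C w') (x : U C) :
    adj C w x = adj C w' x := by
  rw [← (res_beta C w x).2, ← (res_beta C w' x).2, beta_eq_of_proj_eq C h]

theorem dE_quadratic (i j : Fin N) (l m : ℤ) (x : U C) :
    v ^ C.b i j • dE C j m (dE C i (l + 1) x) - dE C i (l + 1) (dE C j m x) =
      dE C j (m + 1) (dE C i l x) - v ^ C.b i j • dE C i l (dE C j (m + 1) x) := by
  have h := adj_eq_of_proj_eq (proj_rel C (Rel.EE i j l m)) x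
  have hs : ∀ a b : FreeAlgebra K (Gen N), adj C (a - b) x = adj C a x - adj C b x := by
    intro a b
    have := adj_add C (a - b) b
    rw [sub_add_cancel] at this
    rw [this]; simp
  have hE' : ∀ i l, adj C (freeE i l) = dE C i l := fun i l => adj_ι C (Gen.E i l)
  rw [hs, hs, adj_smul, adj_smul, LinearMap.smul_apply, LinearMap.smul_apply] at h
  simp only [adj_mul, hE'] at h
  exact h

theorem Un_induction {P : U C → Prop} (one : P 1) (add : ∀ x y, P x → P y → P (x + y))
    (smul : ∀ (c : K) x, P x → P (c • x)) (E_mul : ∀ i l x, x ∈ Un C → P x → P (E C i l * x))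
    {x : U C} (hx : x ∈ Un C) : P x := by
  have key : ∀ y ∈ Un C, ∀ z, z ∈ Un C → P z → P (y * z) := by
    intro y hy
    refine Algebra.adjoin_induction (p := fun y _ => ∀ z, z ∈ Un C → P z → P (y * z))
      ?_ ?_ ?_ ?_ hy
    · rintro _ ⟨i, l, rfl⟩ z hz hPz
      exact E_mul i l z hz hPz
    · intro c z _ hPz
      rw [← Algebra.smul_def]
      exact smul c z hPz
    · intro a b _ _ ha hb z hz hPz
      rw [add_mul]
      exact add _ _ (ha z hz hPz) (hb z hz hPz)
    · intro a b _ hb' ha hb z hz hPz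
      rw [mul_assoc]
      exact ha _ ((Un C).mul_mem hb' hz) (hb z hz hPz)
  simpa using key x hx 1 (Un C).one_mem one

theorem E_mem_Un (i : Fin N) (l : ℤ) : E C i l ∈ Un C := Algebra.subset_adjoin ⟨i, l, rfl⟩

theorem dE_mem_Un (i : Fin N) (m : ℤ) {x : U C} (hx : x ∈ Un C) : dE C i m x ∈ Un C := by
  refine Un_induction (P := fun x => ∀ m, dE C i m x ∈ Un C) (fun m => ?_)
    (fun x y hx hy m => ?_) (fun c x hx m => ?_) (fun j n x hx ih m => ?_) hx m
  · rw [dE_one]; exact (Un C).zero_mem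
  · rw [map_add]; exact (Un C).add_mem (hx m) (hy m)
  · rw [map_smul]; exact (Un C).smul_mem (hx m) c
  · obtain ⟨M, hM⟩ := dE_E_mul C i j m n x
    rw [hM M le_rfl]
    refine (Un C).add_mem ?_ ((Un C).sum_mem fun t _ =>
      (Un C).smul_mem ((Un C).mul_mem (E_mem_Un j _) (ih _)) _)
    split_ifs
    · exact (Un C).smul_mem hx _
    · exact (Un C).zero_mem

variable (C)

/-- The operators `F'_{i,n}`. -/
def Fprime (i : Fin N) (n : ℤ) : Module.End K (Un C) :=
  (v ^ (-2 : ℤ) - 1) • (dE C i n).restrict (p := Subalgebra.toSubmodule (Un C))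
    (q := Subalgebra.toSubmodule (Un C)) fun _ hx => dE_mem_Un i n hx

variable {C}

theorem Fprime_coe (i : Fin N) (n : ℤ) (x : Un C) :
    ((Fprime C i n x : Un C) : U C) = (v ^ (-2 : ℤ) - 1) • dE C i n x := rfl

theorem v_sq_sub_one_ne_zero : v ^ (-2 : ℤ) - 1 ≠ 0 :=
  sub_ne_zero.2 (v_zpow_ne_one (by norm_num))

/-- Contraction with E_{i,n} over all degrees of the first factor adds up to `dE C i n`, by
`res_beta` for the one-letter word. -/
theorem isFprime_Fprime : IsFprime (deltaHom C).toLinearMap (formB C) (Fprime C) := by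
  intro i n x
  have h : ∀ k, contract (formB C) (E C i n) (((deltaHom C).toLinearMap (x : U C)).coeff k) =
      res C (beta C (freeE i n)) k x := by
    intro k
    have : formB C (E C i n) = beta C (freeE i n) := LinearMap.ext fun y => by
      rw [formB_symm]; exact formB_proj C y (freeE i n)
    change contr C (formB C (E C i n)) (deltaC C k x) = _
    rw [this]; rfl
  simp only [h]
  refine ⟨(res_beta C (freeE i n) x).1, ?_⟩
  rw [← smul_finsum' _ (res_beta C (freeE i n) x).1, (res_beta C (freeE i n) x).2, Fprime_coe]
  have : adj C (freeE i n) = dE C i n := adj_ι C (Gen.E i n)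
  rw [this]

theorem gam_pos (i j : Fin N) (t : ℕ+) :
    gam C i j t = v ^ (-(t : ℤ) * C.b i j) * (v ^ (-C.b i j) - v ^ C.b i j) := by
  obtain ⟨u, hu⟩ : ∃ u : ℕ, (t : ℕ) = u + 1 := ⟨(t : ℕ) - 1, by have := t.pos; omega⟩
  have hp : (pq C i j)⁻¹ = v ^ C.b i j := by rw [pq, zpow_neg, inv_inv]
  have h2 : v ^ (-(t : ℤ) * C.b i j) = pq C i j ^ (u + 1) := by
    rw [pq, ← zpow_natCast, ← zpow_mul, ← hu]
    congr 1; ring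
  rw [h2, gam, hu, gCoeff_succ, hp, pow_succ]
  change _ = _ * (pq C i j - _)
  ring

/-- This is `dE_E_mul` with the term t = 0 moved to the left, where `gam` is v^{-b_ij}; the
normalisation v⁻² - 1 cancels the constant (E_{i,n}, E_{i,n}). -/
theorem Fprime_E_mul (i j : Fin N) (m n : ℤ) (x : Un C) :
    (Function.support fun t : ℕ+ =>
      (v ^ (-(t : ℤ) * C.b i j) * (v ^ (-C.b i j) - v ^ C.b i j)) •
        (En C j (n - t) * Fprime C i (m - t) x)).Finite ∧
    Fprime C i m (En C j n * x) - v ^ (-C.b i j) • (En C j n * Fprime C i m x) =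
      (if i = j ∧ n = m then x else 0) + ∑ᶠ t : ℕ+,
        (v ^ (-(t : ℤ) * C.b i j) * (v ^ (-C.b i j) - v ^ C.b i j)) •
          (En C j (n - t) * Fprime C i (m - t) x) := by
  simp only [← gam_pos]
  obtain ⟨n₀, h₀⟩ := exists_dE_eq_zero C i (x : U C)
  have hF0 : ∀ k < n₀, Fprime C i k x = 0 := fun k hk =>
    Subtype.ext (by rw [Fprime_coe, h₀ k hk, smul_zero]; rfl)
  obtain ⟨M₀, hM₀⟩ := dE_E_mul C i j m n (x : U C)
  set M := max M₀ (m - n₀ + 1).toNat with hM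
  have hsub : ∀ t : ℕ+, M ≤ t → gam C i j t • (En C j (n - t) * Fprime C i (m - t) x) = 0 := by
    intro t ht
    have : (m - n₀ + 1).toNat ≤ t := le_trans (le_max_right _ _) ht
    rw [hF0 (m - t) (by omega), mul_zero, smul_zero]
  let S : Finset ℕ+ := (Finset.range M).image Nat.succPNat
  have hS : ∀ t : ℕ+, t ∉ S → M ≤ t := by
    intro t ht
    by_contra hlt
    refine ht (Finset.mem_image.2 ⟨t.natPred, Finset.mem_range.2 ?_, PNat.succPNat_natPred t⟩)
    have := t.natPred_add_one
    omega
  have hsupp : (Function.support fun t : ℕ+ =>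
      gam C i j t • (En C j (n - t) * Fprime C i (m - t) x)) ⊆ S := by
    intro t ht
    by_contra h
    exact ht (hsub t (hS t h))
  refine ⟨S.finite_toSet.subset hsupp, ?_⟩
  rw [finsum_eq_sum_of_support_subset _ hsupp,
    Finset.sum_image fun a _ b _ h => Nat.succPNat_injective h]
  apply Subtype.ext
  have hc : (v ^ (-2 : ℤ) - 1) * cE = 1 := by
    rw [cE, mul_one_div, div_self v_sq_sub_one_ne_zero]
  have hE0 : ((Fprime C i m (En C j n * x) : Un C) : U C) =
      (if i = j ∧ n = m then (x : U C) else 0) + ∑ t ∈ Finset.range (M + 1),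
        gam C i j t • (E C j (n - t) * (Fprime C i (m - t) x : Un C)) := by
    rw [Fprime_coe]
    change (v ^ (-2 : ℤ) - 1) • dE C i m (E C j n * x) = _
    rw [hM₀ (M + 1) (le_trans (le_max_left _ _) (Nat.le_succ M)), smul_add, Finset.smul_sum]
    congr 1
    · split_ifs
      · rw [smul_smul, hc, one_smul]
      · rw [smul_zero]
    · refine Finset.sum_congr rfl fun t _ => ?_
      rw [Fprime_coe, mul_smul_comm, smul_comm]
  rw [AddSubgroupClass.coe_sub, hE0, Finset.sum_range_succ']
  have hg0 : gam C i j 0 = v ^ (-C.b i j) := by rw [gam, gCoeff_zero, mul_one]; rfl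
  have hfin : ((((if i = j ∧ n = m then x else 0) + ∑ t ∈ Finset.range M,
      gam C i j (t.succPNat : ℕ) • (En C j (n - (t.succPNat : ℕ)) *
        Fprime C i (m - (t.succPNat : ℕ)) x) : Un C)) : U C) =
      (if i = j ∧ n = m then (x : U C) else 0) + ∑ t ∈ Finset.range M,
        gam C i j (t + 1) • (E C j (n - (t + 1 : ℕ)) * (Fprime C i (m - (t + 1 : ℕ)) x : Un C)) := by
    rw [Subalgebra.coe_add, AddSubmonoidClass.coe_finsetSum]
    congr 1
    split_ifs <;> rfl
  refine Eq.trans ?_ hfin.symm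
  rw [hg0, Nat.cast_zero, sub_zero, sub_zero]
  change _ + (_ + v ^ (-C.b i j) • (E C j n * _)) - v ^ (-C.b i j) • (E C j n * _) = _
  abel

theorem mem_Z'_iff (i : Fin N) (k : ℤ) (x : Un C) :
    x ∈ Z' (Fprime C) i k ↔ ∀ n ≤ k, dE C i n (x : U C) = 0 := by
  simp only [Z', Submodule.mem_iInf, LinearMap.mem_ker]
  refine forall₂_congr fun n _ => ?_
  rw [← Subtype.coe_inj, Fprime_coe]
  change _ = (0 : U C) ↔ _
  rw [smul_eq_zero, or_iff_right v_sq_sub_one_ne_zero]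

/-- In the formulas for a product with E_{i,n}, every term containing F'_{i,k} x with k < n
vanishes, which gives the first and third claims. For the second, F'_{i,k} must be moved past
F'_{i,n} by the quadratic relation. -/
theorem Z'_stable (i : Fin N) (n : ℤ) {x : Un C} (hx : x ∈ Z' (Fprime C) i (n - 1)) :
    En C i n * x ∈ Z' (Fprime C) i (n - 1) ∧ Fprime C i n x ∈ Z' (Fprime C) i (n - 1) ∧
      Fprime C i n (En C i n * x) - v ^ (-C.b i i) • (En C i n * Fprime C i n x) = x := by
  rw [mem_Z'_iff] at hx
  refine ⟨?_, ?_, ?_⟩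
  · rw [mem_Z'_iff]
    intro k hk
    obtain ⟨M, hM⟩ := dE_E_mul C i i k n (x : U C)
    change dE C i k (E C i n * x) = 0
    rw [hM M le_rfl, if_neg (by omega), zero_add]
    refine Finset.sum_eq_zero fun t _ => ?_
    rw [hx (k - t) (by omega), mul_zero, smul_zero]
  · rw [mem_Z'_iff]
    intro k hk
    rw [Fprime_coe, map_smul]
    have hq := dE_quadratic i i (n - 1) k (x : U C)
    rw [sub_add_cancel, hx k hk, hx (n - 1) le_rfl, map_zero, map_zero, sub_zero, zero_sub] at hq
    have hv : v ^ C.b i i ≠ 0 := zpow_ne_zero _ v_ne_zero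
    have h0 : dE C i k (dE C i n (x : U C)) = 0 := by
      -- For k < n - 1 the remaining right-hand term contains `dE C i (k + 1) x` = 0. For k = n - 1
      -- it is minus the left-hand side, so twice the latter is zero.
      rcases lt_or_eq_of_le hk with hlt | rfl
      · rw [hx (k + 1) (by omega), map_zero, smul_zero, neg_zero, smul_eq_zero] at hq
        exact hq.resolve_left hv
      · rw [sub_add_cancel] at hq
        rw [eq_neg_iff_add_eq_zero, ← two_smul K, smul_smul, smul_eq_zero] at hq
        exact hq.resolve_left (mul_ne_zero two_ne_zero hv)
    rw [h0, smul_zero]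
  · obtain ⟨_, h⟩ := Fprime_E_mul i i n n x
    rw [h, if_pos ⟨rfl, rfl⟩, finsum_eq_zero_of_forall_eq_zero, add_zero]
    intro t
    have : Fprime C i (n - t) x = 0 := Subtype.ext (by
      rw [Fprime_coe, hx (n - t) (by have := t.pos; omega), smul_zero]; rfl)
    rw [this, mul_zero, smul_zero]

end

end QLoop

end

/-- The coproduct `Δ'` and the Hopf pairing exist and are unique, the operators `F'_{i,m}` on
`U_v(𝓛𝔫)` are well defined, they satisfy the commutation relation with left multiplication by
`E_{j,n}`, and on the (stable) subspace `Z'_{i,n-1}` this is the `q`-Boson relation. -/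
theorem mainTheorem4 {N : ℕ} (C : QLoop.CartanDatum N) :
    (∃! Δ : QLoop.U C →ₗ[QLoop.K] QLoop.CTw C, QLoop.IsCoproduct C Δ) ∧
    (∀ Δ : QLoop.U C →ₗ[QLoop.K] QLoop.CTw C, QLoop.IsCoproduct C Δ →
      ∃! B : LinearMap.BilinForm QLoop.K (QLoop.U C), QLoop.IsHopfPairing Δ B) ∧
    (∀ (Δ : QLoop.U C →ₗ[QLoop.K] QLoop.CTw C)
      (B : LinearMap.BilinForm QLoop.K (QLoop.U C)),
      QLoop.IsCoproduct C Δ → QLoop.IsHopfPairing Δ B →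
      ∃ F' : Fin N → ℤ → Module.End QLoop.K (QLoop.Un C),
        QLoop.IsFprime Δ B F' ∧
        (∀ (i j : Fin N) (m n : ℤ) (x : QLoop.Un C),
          (Function.support fun t : ℕ+ =>
            (QLoop.v ^ (-(t : ℤ) * C.b i j) * (QLoop.v ^ (-C.b i j) - QLoop.v ^ C.b i j)) •
              (QLoop.En C j (n - t) * F' i (m - t) x)).Finite ∧
          F' i m (QLoop.En C j n * x) - QLoop.v ^ (-C.b i j) • (QLoop.En C j n * F' i m x) =
            (if i = j ∧ n = m then x else 0) +
            ∑ᶠ t : ℕ+,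
              (QLoop.v ^ (-(t : ℤ) * C.b i j) * (QLoop.v ^ (-C.b i j) - QLoop.v ^ C.b i j)) •
                (QLoop.En C j (n - t) * F' i (m - t) x)) ∧
        (∀ (i : Fin N) (n : ℤ) (x : QLoop.Un C), x ∈ QLoop.Z' F' i (n - 1) →
          QLoop.En C i n * x ∈ QLoop.Z' F' i (n - 1) ∧
          F' i n x ∈ QLoop.Z' F' i (n - 1) ∧
          F' i n (QLoop.En C i n * x) -
            QLoop.v ^ (-C.b i i) • (QLoop.En C i n * F' i n x) = x)) := by
  open QLoop in
  refine ⟨⟨(QLoop.deltaHom C).toLinearMap, QLoop.isCoproduct_deltaHom C,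
    fun _ h => h.eq_deltaHom⟩, fun Δ hΔ => ?_, fun Δ B hΔ hB => ?_⟩
  · rw [hΔ.eq_deltaHom]
    exact ⟨QLoop.formB C, QLoop.isHopfPairing_formB C,
      fun _ h => h.unique (QLoop.isHopfPairing_formB C)⟩
  · rw [hΔ.eq_deltaHom] at hB ⊢
    rw [hB.unique (QLoop.isHopfPairing_formB C)]
    exact ⟨QLoop.Fprime C, QLoop.isFprime_Fprime, QLoop.Fprime_E_mul,
      fun i n _ hx => QLoop.Z'_stable i n hx⟩
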